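/- Let $k\ge 1$ and let $\Lambda$ be a finite, non-empty, strongly connected $k$-graph with vertex set $\Lambda^0$, i.e. a countable small category with a degree functor $d:\Lambda\to\mathbb N^k$ with the factorization property, such that every $\Lambda^n=d^{-1}(n)$ is finite and $v\Lambda w\neq\emptyset$ for all vertices $v,w$. Let $A_i(v,w)=\#(v\Lambda^{e_i}w)$ be its adjacency matrices, $\rho_i$ the spectral radius of $A_i$, and let $x^\Lambda$ be the Perron–Frobenius eigenvector, i.e. the unique vector $x\in(0,\infty)^{\Lambda^0}$ with $\sum_v x_v=1$ and $A_ix=\rho_ix$ for all $i$. Assume that $A=A_1\cdots A_k$ is irreducible. Let $\mathcal B_\Lambda$ be the stationary $k$-Bratteli diagram of $\Lambda$: all vertex sets $\mathcal V_n$ ($n\ge0$) are $\Lambda^0$, and the edges from $\mathcal V_n$ to $\mathcal V_{n-1}$ are the elements of $\Lambda^{e_i}$, where $n\equiv i \pmod k$, $1\le i\le k$. Let $X=X_{\mathcal B_\Lambda}$ be its space of infinite paths, $F\mathcal B_\Lambda$ the set of its finite paths with range in $\mathcal V_0$, and $[\lambda]\subseteq X$ the cylinder set of $\lambda\in F\mathcal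 B_\Lambda$; the cylinder sets generate the topology of $X$. For $\delta\in(0,1)$ and $\lambda\in F\mathcal B_\Lambda$ of length $|\lambda|=qk+t$, $0\le t<k$, put $$w_\delta(\lambda)=\bigl(\rho_1^{q+1}\cdots\rho_t^{q+1}\rho_{t+1}^{q}\cdots\rho_k^{q}\bigr)^{-1/\delta}x^\Lambda_{s(\lambda)},$$ and for $x\ne y$ in $X$ let $d_\delta(x,y)=w_\delta(x\wedge y)$, where $x\wedge y$ is the longest common initial segment of $x$ and $y$ (and $d_\delta(x,y)=1$ if there is none), and $d_\delta(x,x)=0$. Let $\delta\in(0,1)$ be such that $w_\delta(\lambda)=\operatorname{diam}[\lambda]$ for all $\lambda\in F\mathcal B_\Lambda$, where the diameter is taken with respect to $d_\delta$. Let $\tau=(\tau_+,\tau_-)$ be a choice function (such functions exist), i.e. $\tau_\pm(\lambda)\in[\lambda]$ and $d_\delta(\tau_+(\lambda),\tau_-(\lambda))=\operatorname{diam}[\lambda]$ for all $\lambda$. On $\ell^2(F\mathcal B_\Lambda)\otimes\mathbb C^2$ let $$D=\bigoplus_\lambda \frac1{\operatorname{diam}[\lambda]}\begin{pmatrix}0&1\\1&0\end{pmatrix},\qquad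 \pi_\tau(f)=\bigoplus_\lambda\begin{pmatrix}f(\tau_+(\lambda))&0\\0&f(\tau_-(\lambda))\end{pmatrix}$$ for $f:X\to\mathbb C$ Lipschitz with respect to $d_\delta$. Then $\zeta_\delta(s)=\frac12\operatorname{Tr}(|D|^{-s})$ has abscissa of convergence $\delta$, with $\zeta_\delta(s)<\infty$ if and only if $s>\delta$ (for $s>0$), and there is a unique finite Borel measure $\mu_\delta$ on $X$ (the measure induced by the Dixmier trace) such that $$\int_X f\,d\mu_\delta=\lim_{s\searrow\delta}\frac{\operatorname{Tr}(|D|^{-s}\pi_\tau(f))}{\operatorname{Tr}(|D|^{-s})}$$ for all Lipschitz $f$; moreover, for all $\gamma\in F\mathcal B_\Lambda$, $$\mu_\delta([\gamma])=\lim_{s\searrow\delta}\frac{\sum_{\lambda}w_\delta(\lambda)^s}{\sum_{\lambda\in F\mathcal B_\Lambda}w_\delta(\lambda)^s},$$ where the sum in the numerator is over all $\lambda\in F\mathcal B_\Lambda$ with initial segment $\gamma$. This $\mu_\delta$ is a probability measure, and for every $\lambda\in F\mathcal B_\Lambda$ with $|\lambda|=qk+t$, $0\le t<k$, $$\mu_\delta([\lambda])=(\rho_1\cdots\rho_t)^{-(q+1)}(\rho_{t+1}\cdots\rho_k)^{-q}\,x^\Lambda_{s(\lambda)}.$$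 Let $\Lambda^\infty$ be the space of infinite paths of $\Lambda$, i.e. of degree-preserving functors $x:\Omega_k\to\Lambda$, with the topology generated by the sets $[\lambda]=\{x: x(0,d(\lambda))=\lambda\}$, $\lambda\in\Lambda$. There is a unique Borel measure $M$ on $\Lambda^\infty$ (the an Huef–Laca–Raeburn–Sims measure) with $M([\lambda])=\rho_1^{-d(\lambda)_1}\cdots\rho_k^{-d(\lambda)_k}x^\Lambda_{s(\lambda)}$ for all $\lambda\in\Lambda$. The map $\Lambda^\infty\to X$ that writes an infinite path as a product of edges of colours $1,\dots,k,1,\dots,k,\dots$ is a homeomorphism, and under this identification $\mu_\delta=M$. In particular $\mu_\delta$ depends neither on $\delta$ nor on $\tau$. -/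

import Mathlib

open CategoryTheory Filter Topology MeasureTheory
open scoped ENNReal

universe u

noncomputable section

/-! ### Operators on Hilbert space -/

section Operators

variable {H : Type u} [NormedAddCommGroup H] [InnerProductSpace ℂ H]

/-- `R` is a bounded two-sided inverse of the (unbounded) operator `D`. -/
def IsBoundedInverse (D : H →ₗ.[ℂ] H) (R : H →L[ℂ] H) : Prop :=
  (∀ ψ : D.domain, R (D ψ) = ψ) ∧ ∀ φ : H, ∃ h : R φ ∈ D.domain, D ⟨R φ, h⟩ = φ

open Classical in
/-- The bounded inverse `D⁻¹` of an unbounded operator `D` (it is unique if it exists; the value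
is `0` if it does not exist). -/
def boundedInverse (D : H →ₗ.[ℂ] H) : H →L[ℂ] H :=
  if h : ∃ R, IsBoundedInverse D R then h.choose else 0

/-- The bounded operator `|D|^{-s} = |D⁻¹|^s`, for `s > 0`, by continuous functional calculus. -/
def absNegPow [CompleteSpace H] (D : H →ₗ.[ℂ] H) (s : ℝ) : H →L[ℂ] H :=
  CFC.rpow (CFC.abs (boundedInverse D)) s

end Operators

/-- The Hilbert space `ℓ²(ι)`. -/
abbrev EllTwo (ι : Type u) : Type u := lp (fun _ : ι => ℂ) 2

section EllTwo

variable {ι : Type u}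

open Classical in
/-- The diagonal matrix coefficient of a bounded operator on `ℓ²(ι)` at a standard basis
vector. -/
def diagCoeff (T : EllTwo ι →L[ℂ] EllTwo ι) (i : ι) : ℂ :=
  inner ℂ (lp.single 2 i (1 : ℂ) : EllTwo ι) (T (lp.single 2 i (1 : ℂ)))

/-- The trace of a trace class operator. -/
def opTrace (T : EllTwo ι →L[ℂ] EllTwo ι) : ℂ := ∑' i, diagCoeff T i

/-- The trace of a positive operator, possibly infinite. -/
def opTracePos (T : EllTwo ι →L[ℂ] EllTwo ι) : ℝ≥0∞ :=
  ∑' i, ENNReal.ofReal (diagCoeff T i).re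

/-- The zeta function `ζ(s) = ½ Tr(|D|^{-s})`, for `s > 0`. -/
def opZeta (D : EllTwo ι →ₗ.[ℂ] EllTwo ι) (s : ℝ) : ℝ≥0∞ :=
  2⁻¹ * opTracePos (absNegPow D s)

/-- The abscissa of convergence of the zeta function.  As `D` has compact resolvent on an infinite
dimensional space, the zeta function diverges at all `s ≤ 0`, so only `s > 0` has to be looked
at. -/
def abscissa (D : EllTwo ι →ₗ.[ℂ] EllTwo ι) : ℝ :=
  sInf {s : ℝ | 0 < s ∧ opZeta D s < ∞}

/-- The Dixmier trace of the bounded operator `a` with respect to `D` exists and equals `c`: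
`c = lim_{s ↘ s₀} Tr(|D|^{-s} a) / Tr(|D|^{-s})`, where `s₀` is the abscissa of convergence. -/
def HasDixmierTrace (D : EllTwo ι →ₗ.[ℂ] EllTwo ι) (a : EllTwo ι →L[ℂ] EllTwo ι) (c : ℂ) : Prop :=
  Tendsto (fun s : ℝ => opTrace (absNegPow D s ∘L a) / opTrace (absNegPow D s))
    (𝓝[>] (abscissa D)) (𝓝 c)

theorem memℓp_mul_of_bounded {m : ι → ℂ} {C : ℝ} (hm : ∀ i, ‖m i‖ ≤ C) {ψ : ι → ℂ}
    (hψ : Memℓp ψ 2) : Memℓp (fun i => m i * ψ i) 2 := by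
  have h2 : (0 : ℝ) < (2 : ℝ≥0∞).toReal := by norm_num
  refine memℓp_gen (Summable.of_nonneg_of_le (fun i => by positivity) (fun i => ?_)
    ((hψ.summable h2).mul_left (C ^ (2 : ℝ≥0∞).toReal)))
  rw [norm_mul, Real.mul_rpow (norm_nonneg _) (norm_nonneg _)]
  gcongr
  exact hm i

/-- The diagonal operator on `ℓ²(ι)` with a bounded diagonal `m`. -/
def mulOp (m : ι → ℂ) (hm : ∃ C : ℝ, ∀ i, ‖m i‖ ≤ C) : EllTwo ι →L[ℂ] EllTwo ι :=
  LinearMap.mkContinuousOfExistsBound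
    { toFun := fun ψ => ⟨fun i => m i * ψ i, memℓp_mul_of_bounded hm.choose_spec ψ.2⟩
      map_add' := fun ψ φ => by
        ext i
        exact mul_add (m i) (ψ i) (φ i)
      map_smul' := fun c ψ => by
        ext i
        exact mul_left_comm (m i) c (ψ i) }
    (by
      obtain ⟨C, hC⟩ := hm
      refine ⟨|C|, fun ψ => ?_⟩
      have h2 : (2 : ℝ≥0∞) ≠ 0 := by norm_num
      refine (lp.norm_mono (y := ((|C| : ℝ) : ℂ) • ψ) h2 fun i => ?_).trans
        ((lp.norm_const_smul_le h2 _ ψ).trans (by simp))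
      change ‖m i * ψ i‖ ≤ ‖((|C| : ℝ) : ℂ) * ψ i‖
      rw [norm_mul, norm_mul]
      gcongr
      simpa using (hC i).trans (le_abs_self C))

end EllTwo

/-! ### Bratteli diagrams -/

/-- A Bratteli diagram.  `E n` is the finite set of edges with range in `V n` and source in
`V (n + 1)`. -/
structure BratteliDiagram where
  V : ℕ → Type u
  E : ℕ → Type u
  r : ∀ {n}, E n → V n
  s : ∀ {n}, E n → V (n + 1)
  finite_V : ∀ n, Finite (V n)
  finite_E : ∀ n, Finite (E n)

namespace BratteliDiagram

/-- Finite paths with range in `V 0`; those of length `0` are the vertices in `V 0`. -/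
@[ext] structure FinPath (B : BratteliDiagram.{u}) where
  len : ℕ
  range : B.V 0
  edge : (i : Fin len) → B.E i
  range_eq : ∀ h : 0 < len, B.r (edge ⟨0, h⟩) = range
  comp : ∀ (i : ℕ) (h : i + 1 < len),
    B.s (edge ⟨i, (Nat.lt_succ_self i).trans h⟩) = B.r (edge ⟨i + 1, h⟩)

/-- The space of infinite paths. -/
@[ext] structure InfPath (B : BratteliDiagram.{u}) where
  edge : (n : ℕ) → B.E n
  comp : ∀ n, B.s (edge n) = B.r (edge (n + 1))

variable (B : BratteliDiagram.{u})

variable {B}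

/-- The source of a finite path. -/
def FinPath.source : (l : FinPath B) → B.V l.len
  | ⟨0, v, _, _, _⟩ => v
  | ⟨n + 1, _, e, _, _⟩ => B.s (n := n) (e ⟨n, Nat.lt_succ_self n⟩)

/-- `η` is a sub-path (that is, an initial segment) of `l`. -/
def FinPath.IsSubpath (η l : FinPath B) : Prop :=
  ∃ h : η.len ≤ l.len, η.range = l.range ∧
    ∀ i : Fin η.len, η.edge i = l.edge ⟨i, i.2.trans_le h⟩

/-- The initial segment of length `n` of an infinite path. -/
def InfPath.take (x : InfPath B) (n : ℕ) : FinPath B where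
  len := n
  range := B.r (x.edge 0)
  edge i := x.edge i
  range_eq _ := rfl
  comp i _ := x.comp i

/-- The cylinder set `[l]`. -/
def cylinder (l : FinPath B) : Set (InfPath B) := {x | x.take l.len = l}

instance : TopologicalSpace (InfPath B) :=
  TopologicalSpace.generateFrom (Set.range (cylinder (B := B)))

instance : MeasurableSpace (InfPath B) := borel _

instance : BorelSpace (InfPath B) := ⟨rfl⟩

open Classical in
/-- The function `d_w` on pairs of infinite paths: `1` if `x` and `y` have no common initial
segment, `0` if `x = y`, and otherwise `w` of the longest common initial segment. -/
def pathDist (w : FinPath B → ℝ) (x y : InfPath B) : ℝ :=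
  if x = y then 0
  else if x.take 0 = y.take 0 then w (x.take (sSup {n : ℕ | x.take n = y.take n}))
  else 1

/-- The diameter of the cylinder set `[l]` for `d_w`. -/
def cylDiam (w : FinPath B → ℝ) (l : FinPath B) : ℝ :=
  sSup {t : ℝ | ∃ x ∈ cylinder l, ∃ y ∈ cylinder l, t = pathDist w x y}

/-- Choice functions: maps `l ↦ (τ₊(l), τ₋(l)) ∈ [l] × [l]` realizing the diameter of `[l]`. -/
structure ChoiceFunction (w : FinPath B → ℝ) where
  plus : FinPath B → InfPath B
  minus : FinPath B → InfPath B
  plus_mem : ∀ l, plus l ∈ cylinder l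
  minus_mem : ∀ l, minus l ∈ cylinder l
  dist_eq : ∀ l, pathDist w (plus l) (minus l) = cylDiam w l

/-- The Lipschitz functions for `d_w`.  (They are automatically bounded when `d_w` is.) -/
structure LipFun (w : FinPath B → ℝ) where
  toFun : InfPath B → ℂ
  lipschitz : ∃ C : ℝ, ∀ x y, ‖toFun x - toFun y‖ ≤ C * pathDist w x y
  bounded : ∃ C : ℝ, ∀ x, ‖toFun x‖ ≤ C

variable (B) in
/-- The Hilbert space `ℓ²(FB) ⊗ ℂ²`, realized as `ℓ²(FB × {±})`. -/
abbrev PathHilbert : Type u := EllTwo (FinPath B × Bool)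

/-- The representation `π_τ`: in the summand indexed by `l`, the function `f` acts as the
diagonal matrix with entries `f(τ₊(l))` and `f(τ₋(l))`. -/
def pathRep {w : FinPath B → ℝ} (τ : ChoiceFunction w) (f : LipFun w) :
    PathHilbert B →L[ℂ] PathHilbert B :=
  mulOp (fun p => if p.2 then f.toFun (τ.plus p.1) else f.toFun (τ.minus p.1)) (by
    obtain ⟨C, hC⟩ := f.bounded
    refine ⟨C, fun p => ?_⟩
    split_ifs <;> exact hC _)

/-- The coordinates of `D ψ`, where `D` acts in the summand indexed by `l` as `1 / diam [l]` times
the matrix that exchanges the two basis vectors. -/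
def diracFun (w : FinPath B → ℝ) (ψ : FinPath B × Bool → ℂ) : FinPath B × Bool → ℂ :=
  fun p => (((cylDiam w p.1)⁻¹ : ℝ) : ℂ) * ψ (p.1, !p.2)

/-- The Dirac operator, an unbounded operator with its maximal domain. -/
def dirac (w : FinPath B → ℝ) : PathHilbert B →ₗ.[ℂ] PathHilbert B where
  domain :=
    { carrier := {ψ | Memℓp (diracFun w ψ) 2}
      zero_mem' := by
        have h : diracFun w (⇑(0 : PathHilbert B)) = 0 := by
          funext p
          simp [diracFun]
        simpa only [Set.mem_ofPred_eq, h] using (zero_memℓp : Memℓp (0 : FinPath B × Bool → ℂ) 2)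
      add_mem' := fun {ψ φ} hψ hφ => by
        have h : diracFun w (⇑(ψ + φ)) = diracFun w ψ + diracFun w φ := by
          funext p
          simp [diracFun, mul_add]
        simpa only [Set.mem_ofPred_eq, h] using Memℓp.add hψ hφ
      smul_mem' := fun c ψ hψ => by
        have h : diracFun w (⇑(c • ψ)) = c • diracFun w ψ := by
          funext p
          simp [diracFun, mul_left_comm]
        simpa only [Set.mem_ofPred_eq, h] using Memℓp.const_smul hψ c }
  toFun :=
    { toFun := fun ψ => ⟨diracFun w ψ.1, ψ.2⟩
      map_add' := fun ψ φ => by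
        ext p
        exact mul_add _ _ _
      map_smul' := fun c ψ => by
        ext p
        exact mul_left_comm _ _ _ }

/-- The finite Borel measure `μ` is induced by the Dixmier trace: the Dixmier trace of every
Lipschitz function `f` exists and equals `∫ f dμ`. -/
def IsDixmierMeasure {w : FinPath B → ℝ} (τ : ChoiceFunction w) (μ : Measure (InfPath B)) : Prop :=
  IsFiniteMeasure μ ∧
    ∀ f : LipFun w, HasDixmierTrace (dirac w) (pathRep τ f) (∫ x, f.toFun x ∂μ)

open Classical in
/-- The measure induced by the Dixmier trace. -/
def dixmierMeasure {w : FinPath B → ℝ} (τ : ChoiceFunction w) : Measure (InfPath B) :=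
  if h : ∃ μ, IsDixmierMeasure τ μ then h.choose else 0

end BratteliDiagram

/-! ### Higher-rank graphs -/

/-- A `k`-graph: a countable small category with a degree functor to `ℕ^k` that has the
factorization property.  A morphism `l : a ⟶ b` has source `a` and range `b`; the product `μν` of
two morphisms with `s(μ) = r(ν)` is `ν ≫ μ`.  By the factorization property the objects are
identified with the morphisms of degree `0`. -/
structure KGraph (k : ℕ) (V : Type u) [SmallCategory V] where
  countable : Countable (Arrow V)
  deg : ∀ {a b : V}, (a ⟶ b) → (Fin k → ℕ)
  deg_id : ∀ a : V, deg (𝟙 a) = 0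
  deg_comp : ∀ {a b c : V} (ν : a ⟶ b) (μ : b ⟶ c), deg (ν ≫ μ) = deg μ + deg ν
  factorization : ∀ {a b : V} (l : a ⟶ b) (m n : Fin k → ℕ), deg l = m + n →
    ∃! p : Σ c : V, (a ⟶ c) × (c ⟶ b), deg p.2.2 = m ∧ deg p.2.1 = n ∧ p.2.1 ≫ p.2.2 = l

namespace KGraph

variable {k : ℕ} {V : Type u} [SmallCategory V]

/-- `Λ` is finite: there are finitely many morphisms of each degree. -/
class IsFinite (Λ : KGraph k V) : Prop where
  finite : ∀ n : Fin k → ℕ, Finite {l : Arrow V // Λ.deg l.hom = n}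

variable (Λ : KGraph k V)

/-- `v Λ w` is non-empty for all vertices `v` and `w`. -/
def StronglyConnected (_Λ : KGraph k V) : Prop := ∀ v w : V, Nonempty (w ⟶ v)

/-- The adjacency matrices `A_i(v, w) = #(v Λ^{e_i} w)`. -/
def adj (i : Fin k) : Matrix V V ℕ :=
  fun v w => Nat.card {l : w ⟶ v // Λ.deg l = Pi.single i 1}

/-- The product `A = A_1 ⋯ A_k`. -/
def adjProd [Fintype V] [DecidableEq V] : Matrix V V ℕ := (List.ofFn Λ.adj).prod

/-- The spectral radius `ρ_i` of `A_i`. -/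
def rho [Fintype V] [DecidableEq V] (i : Fin k) : ℝ :=
  (spectralRadius ℂ ((Λ.adj i).map (Nat.cast : ℕ → ℂ))).toReal

/-- `x` is a positive vector with coordinate sum `1` and `A_i x = ρ_i x` for all `i`. -/
def IsPerronFrobenius [Fintype V] [DecidableEq V] (x : V → ℝ) : Prop :=
  (∀ v, 0 < x v) ∧ ∑ v, x v = 1 ∧
    ∀ i, ((Λ.adj i).map (Nat.cast : ℕ → ℝ)).mulVec x = Λ.rho i • x

open Classical in
/-- The Perron-Frobenius eigenvector `x^Λ`. -/
def pfVector [Fintype V] [DecidableEq V] : V → ℝ :=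
  if h : ∃ x, Λ.IsPerronFrobenius x then h.choose else 0

/-- The infinite paths of `Λ`: the degree preserving functors `x : Ω_k → Λ`.  The category `Ω_k`
has object set `ℕ^k` and exactly one morphism with range `m` and source `n`, of degree `n - m`,
whenever `m ≤ n`. -/
@[ext] structure InfPath where
  obj : (Fin k → ℕ) → V
  map : ∀ {m n : Fin k → ℕ}, m ≤ n → (obj n ⟶ obj m)
  map_refl : ∀ m : Fin k → ℕ, map (le_refl m) = 𝟙 (obj m)
  map_trans : ∀ {m n p : Fin k → ℕ} (h : m ≤ n) (h' : n ≤ p), map (h.trans h') = map h' ≫ map h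
  deg_map : ∀ {m n : Fin k → ℕ} (h : m ≤ n), Λ.deg (map h) = n - m

variable {Λ} in
/-- The morphism `x(m, n)`. -/
def InfPath.seg (x : Λ.InfPath) {m n : Fin k → ℕ} (h : m ≤ n) : Arrow V :=
  Arrow.mk (x.map h)

/-- The cylinder set `[l] = {x : x(0, d(l)) = l}`. -/
def cylinder (l : Arrow V) : Set Λ.InfPath :=
  {x | x.seg (zero_le : (0 : Fin k → ℕ) ≤ Λ.deg l.hom) = l}

instance : TopologicalSpace Λ.InfPath := TopologicalSpace.generateFrom (Set.range Λ.cylinder)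

instance : MeasurableSpace Λ.InfPath := borel _

instance : BorelSpace Λ.InfPath := ⟨rfl⟩

/-- The property `M([l]) = ρ(Λ)^{-d(l)} x^Λ_{s(l)}` for all `l ∈ Λ`, which characterizes the
measure of an Huef, Laca, Raeburn and Sims. -/
def IsAHLRS [Fintype V] [DecidableEq V] (M : Measure Λ.InfPath) : Prop :=
  ∀ l : Arrow V, M (Λ.cylinder l) =
    ENNReal.ofReal ((∏ i, Λ.rho i ^ Λ.deg l.hom i)⁻¹ * Λ.pfVector l.left)

open Classical in
/-- The measure `M` of an Huef, Laca, Raeburn and Sims on the infinite path space. -/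
def aHLRS [Fintype V] [DecidableEq V] : Measure Λ.InfPath :=
  if h : ∃ M, Λ.IsAHLRS M then h.choose else 0

variable (k) in
/-- The colour of the edges from level `n + 1` to level `n`: the colours repeat cyclically. -/
def color [NeZero k] (n : ℕ) : Fin k := Fin.ofNat k n

/-- The stationary `k`-Bratteli diagram of `Λ`.  All vertex sets are the set of vertices of `Λ`,
and the edges from level `n + 1` to level `n` are the edges of `Λ` of colour `color k n`, so that
there are `A_i(p, q)` of them from `q` to `p`, where `i` is that colour. -/
def bratteli [NeZero k] [Finite V] [Λ.IsFinite] : BratteliDiagram.{u} where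
  V _ := V
  E n := {l : Arrow V // Λ.deg l.hom = Pi.single (color k n) 1}
  r l := l.1.right
  s l := l.1.left
  finite_V _ := inferInstance
  finite_E _ := IsFinite.finite _

variable (k) in
/-- The degree of the paths of length `n` in the Bratteli diagram:
`(q + 1, …, q + 1, q, …, q)` with `t` entries `q + 1`, where `n = q k + t`. -/
def levelDeg [NeZero k] (n : ℕ) : Fin k → ℕ :=
  ∑ j ∈ Finset.range n, Pi.single (color k j) 1

theorem levelDeg_succ [NeZero k] (n : ℕ) :
    levelDeg k (n + 1) = levelDeg k n + Pi.single (color k n) 1 :=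
  Finset.sum_range_succ _ _

theorem levelDeg_le [NeZero k] (n : ℕ) : levelDeg k n ≤ levelDeg k (n + 1) := by
  rw [levelDeg_succ]
  exact le_self_add

variable {Λ} in
/-- The canonical identification of the infinite paths of `Λ` with those of its Bratteli diagram:
`x` is written as a product of edges whose colours repeat cyclically. -/
def toBratteli [NeZero k] [Finite V] [Λ.IsFinite] (x : Λ.InfPath) : Λ.bratteli.InfPath where
  edge n := ⟨x.seg (levelDeg_le n), by
    refine (x.deg_map (levelDeg_le n)).trans ?_
    rw [levelDeg_succ, add_tsub_cancel_left]⟩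
  comp _ := rfl

/-- For `n = q k + t` with `t < k`, the number `ρ_1^{q+1} ⋯ ρ_t^{q+1} ρ_{t+1}^q ⋯ ρ_k^q`. -/
def rhoProd [Fintype V] [DecidableEq V] (q t : ℕ) : ℝ :=
  (∏ i : Fin k with i.val < t, Λ.rho i) ^ (q + 1) * (∏ i : Fin k with t ≤ i.val, Λ.rho i) ^ q

/-- The weight `w_δ`. -/
def weight [NeZero k] [Fintype V] [DecidableEq V] [Λ.IsFinite] (δ : ℝ)
    (l : Λ.bratteli.FinPath) : ℝ :=
  Λ.rhoProd (l.len / k) (l.len % k) ^ (-1 / δ) * Λ.pfVector l.source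

/-- The standing hypothesis: `w_δ(l) = diam [l]` for all finite paths `l`. -/
def WeightEqDiam [NeZero k] [Fintype V] [DecidableEq V] [Λ.IsFinite] (δ : ℝ) : Prop :=
  ∀ l : Λ.bratteli.FinPath, Λ.weight δ l = BratteliDiagram.cylDiam (Λ.weight δ) l

end KGraph

end

/-! ### Functional calculus on eigenvectors -/

noncomputable section

section Operators

variable {H : Type u} [NormedAddCommGroup H] [InnerProductSpace ℂ H]

/-! The operator `D⁻¹` exchanges the two signs and multiplies by `diam [λ] = w(λ)`. The exchange
cancels in `(D⁻¹)* D⁻¹`, so `|D|^{-s}` is diagonal with entries `w(λ)^s`, and `Tr(|D|^{-s} π_τ(f)) /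
Tr(|D|^{-s})` is the average of `f` over the points `τ_±(λ)` with weights `w(λ)^s`. If `f` is the
indicator of `[γ]` and `|λ| ≥ |γ|`, then `f(τ_±(λ)) = 1` exactly when `γ` is an initial segment of
`λ`. The finitely many shorter `λ` are negligible once the denominator tends to infinity as `s ↘ δ`.
On cylinder sets everything comes down to the limit of the sum of `w(λ)^s` over the extensions of
`γ`, divided by the sum over all `λ`.

Group the extensions of `γ` by length. With `m = |γ|`, those of length `n` correspond to the
morphisms of degree `levelDeg k n - levelDeg k m` into `s(γ)`, so each level contributes a
`levelTerm`: a power of `ρ` times a path matrix applied to `x^s`, with `x` the Perron-Frobenius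
vector. Comparing `x^s` with multiples of `x` shows that the levels behave like a geometric series
with ratio `(ρ_1 ⋯ ρ_k)^{1 - s/δ}` per period of `k` levels. Positive diameters force `ρ_1 ⋯ ρ_k >
1` (`one_lt_rhoPow_one`), so the series converges exactly for `s > δ`, and it tends to infinity as
`s ↘ δ` (`tendsto_totalSum`).

The limit is found without computing residues. The sums over the paths with range `v`, divided by
the total, form a probability vector. Splitting off one period gives a recursion (`levelTerm_add`),
which in the limit says that every cluster point `y` satisfies `A y = ρ_1 ⋯ ρ_k y`. The eigenspace
is one-dimensional, so `y = x` (`tendsto_vertexSum_div`). The same recursion, started at level `m`,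
gives the value on `[γ]` (`tendsto_pathSum_div`).

By the eigenvector equation and compactness these values define a measure
(`exists_bratteli_measure`). Convergence on cylinder sets is weak convergence and therefore covers
Lipschitz functions; indicators of cylinder sets are themselves Lipschitz, which gives uniqueness.
Finally, the degrees `levelDeg k n` are cofinal in `ℕ^k`, so an infinite path of `Λ` is the same as
its sequence of coloured edges, and the measures `M` and `μ_δ` agree on the cylinder sets of these
degrees, which determine both. -/

theorem IsBoundedInverse.unique {D : H →ₗ.[ℂ] H} {R R' : H →L[ℂ] H} (h : IsBoundedInverse D R)
    (h' : IsBoundedInverse D R') : R = R' := by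
  ext φ
  obtain ⟨hd, hD⟩ := h.2 φ
  have := h'.1 ⟨R φ, hd⟩
  rw [hD] at this
  exact this.symm

theorem IsBoundedInverse.boundedInverse_eq {D : H →ₗ.[ℂ] H} {R : H →L[ℂ] H}
    (h : IsBoundedInverse D R) : boundedInverse D = R := by
  have hex : ∃ R, IsBoundedInverse D R := ⟨R, h⟩
  rw [boundedInverse, dif_pos hex]
  exact hex.choose_spec.unique h

theorem aeval_apply_eigenvector {T : H →L[ℂ] H} {e : H} {w : ℝ} (he : T e = (w : ℂ) • e)
    (p : Polynomial ℝ) : (Polynomial.aeval T p) e = ((p.eval w : ℝ) : ℂ) • e := by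
  induction p using Polynomial.induction_on' with
  | add p q hp hq => simp [hp, hq, add_smul]
  | monomial n a =>
    have hn : (T ^ n) e = ((w : ℂ) ^ n) • e := by
      induction n with
      | zero => simp
      | succ n ih => rw [pow_succ', mul_apply_eq_comp, ih, map_smul, he, smul_smul,
          pow_succ]
    rw [Polynomial.aeval_monomial, mul_apply_eq_comp, hn, Polynomial.eval_monomial,
      Algebra.algebraMap_eq_smul_one]
    simp only [smul_apply, one_apply_eq_self]
    rw [← Complex.coe_smul, smul_smul]
    push_cast
    rfl

/-- Polynomials in `T` act on `e` through their value at `w`. Weierstrass approximation on an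
interval containing both the spectrum and `w` extends this to continuous `f`. -/
theorem cfc_apply_eigenvector [CompleteSpace H] {T : H →L[ℂ] H} (hT : IsSelfAdjoint T) {e : H}
    {w : ℝ} (he : T e = (w : ℂ) • e) {f : ℝ → ℝ} (hf : Continuous f) :
    cfc f T e = ((f w : ℝ) : ℂ) • e := by
  rw [← sub_eq_zero, ← norm_le_zero_iff]
  refine le_of_forall_pos_le_add fun ε hε => ?_
  -- Two errors of size `η ‖e‖` have to stay below `ε`; the `+ 1` covers `e = 0`.
  set η : ℝ := ε / (2 * (‖e‖ + 1)) with hη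
  have hη0 : 0 < η := by positivity
  -- The maximum with `|w|` avoids showing that `w` lies in the spectrum, which can fail for `e =
  -- 0`.
  set r : ℝ := max (‖T‖ * ‖(1 : H →L[ℂ] H)‖) |w| with hr
  obtain ⟨p, hp⟩ := exists_polynomial_near_of_continuousOn (-r) r f hf.continuousOn η hη0
  have h1 : ‖cfc f T - Polynomial.aeval T p‖ ≤ η := by
    rw [← cfc_polynomial p T, ← cfc_sub f p.eval T hf.continuousOn (by fun_prop)]
    refine norm_cfc_le hη0.le fun x hx => ?_
    rw [Real.norm_eq_abs, abs_sub_comm]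
    refine (hp x ?_).le
    have := spectrum.norm_le_norm_mul_of_mem hx
    rw [Real.norm_eq_abs] at this
    exact abs_le.1 (this.trans (le_max_left _ _))
  have h2 : |p.eval w - f w| ≤ η := (hp w (abs_le.1 (le_max_right _ _))).le
  have h3 : cfc f T e - ((f w : ℝ) : ℂ) • e =
      (cfc f T - Polynomial.aeval T p) e + (((p.eval w - f w : ℝ)) : ℂ) • e := by
    rw [sub_apply, aeval_apply_eigenvector he]
    push_cast
    rw [sub_smul]
    abel
  rw [h3]
  calc _ ≤ η * ‖e‖ + η * ‖e‖ := by
        refine (norm_add_le _ _).trans (add_le_add ?_ ?_)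
        · exact (ContinuousLinearMap.le_opNorm _ _).trans (by gcongr)
        · rw [norm_smul, Complex.norm_real, Real.norm_eq_abs]
          gcongr
    _ = ε * (‖e‖ / (‖e‖ + 1)) := by rw [hη]; field_simp; ring
    _ ≤ 0 + ε := by
        rw [zero_add]
        refine mul_le_of_le_one_right hε.le ?_
        rw [div_le_one (by positivity)]
        linarith

/-- By uniqueness of positive square roots, `W` is `|R|`, so it suffices to guess the absolute value
and verify its square. -/
theorem absNegPow_apply_eigenvector [CompleteSpace H] {D : H →ₗ.[ℂ] H} {R W : H →L[ℂ] H}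
    (hR : IsBoundedInverse D R) (hW : 0 ≤ W) (hWR : W * W = star R * R) {e : H} {w : ℝ}
    (he : W e = (w : ℂ) • e) {s : ℝ} (hs : 0 < s) :
    absNegPow D s e = ((w ^ s : ℝ) : ℂ) • e := by
  have habs : CFC.abs R = W := CFC.sqrt_unique hWR hW
  rw [absNegPow, hR.boundedInverse_eq, habs, CFC.rpow_eq_pow, CFC.rpow_eq_cfc_real hW]
  exact cfc_apply_eigenvector (IsSelfAdjoint.of_nonneg hW) he (Real.continuous_rpow_const hs.le)

end Operators

/-! ### Diagonal and permutation operators on `ℓ²` -/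

section EllTwo

variable {ι : Type u}

theorem mulOp_apply (m : ι → ℂ) (hm : ∃ C : ℝ, ∀ i, ‖m i‖ ≤ C) (ψ : EllTwo ι) (i : ι) :
    mulOp m hm ψ i = m i * ψ i := rfl

open Classical in
theorem mulOp_single (m : ι → ℂ) (hm : ∃ C : ℝ, ∀ i, ‖m i‖ ≤ C) (i : ι) :
    mulOp m hm (lp.single 2 i (1 : ℂ)) = m i • lp.single 2 i (1 : ℂ) := by
  ext j
  rw [mulOp_apply, lp.coeFn_smul, Pi.smul_apply, lp.single_apply]
  rcases eq_or_ne j i with rfl | h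
  · simp
  · simp [Pi.single_eq_of_ne h]

open Classical in
theorem diagCoeff_eq_of_apply_single {T : EllTwo ι →L[ℂ] EllTwo ι} {i : ι} {c : ℂ}
    (h : T (lp.single 2 i (1 : ℂ)) = c • lp.single 2 i (1 : ℂ)) : diagCoeff T i = c := by
  rw [diagCoeff, h, inner_smul_right, lp.inner_single_left, lp.single_apply_self]
  simp

open Classical in
theorem diagCoeff_comp_mulOp {T : EllTwo ι →L[ℂ] EllTwo ι} {i : ι} {c : ℂ} (m : ι → ℂ)
    (hm : ∃ C : ℝ, ∀ i, ‖m i‖ ≤ C)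
    (h : T (lp.single 2 i (1 : ℂ)) = c • lp.single 2 i (1 : ℂ)) :
    diagCoeff (T ∘L mulOp m hm) i = c * m i := by
  refine diagCoeff_eq_of_apply_single ?_
  rw [ContinuousLinearMap.comp_apply, mulOp_single, map_smul, h, smul_smul, mul_comm]

theorem mulOp_adjoint_apply (m : ι → ℂ) (hm : ∃ C : ℝ, ∀ i, ‖m i‖ ≤ C)
    (hr : ∀ i, (starRingEnd ℂ) (m i) = m i) : IsSelfAdjoint (mulOp m hm) := by
  rw [ContinuousLinearMap.isSelfAdjoint_iff', eq_comm, ContinuousLinearMap.eq_adjoint_iff]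
  intro x y
  rw [lp.inner_eq_tsum, lp.inner_eq_tsum]
  refine tsum_congr fun i => ?_
  rw [mulOp_apply, mulOp_apply]
  simp [hr]
  ring

/-- The operator has the form `S* S`, where `S` is the diagonal operator of the square roots. -/
theorem mulOp_nonneg (c : ι → ℝ) (hc : ∀ i, 0 ≤ c i) (hm : ∃ C : ℝ, ∀ i, ‖(c i : ℂ)‖ ≤ C) :
    0 ≤ mulOp (fun i => (c i : ℂ)) hm := by
  have hm' : ∃ C : ℝ, ∀ i, ‖((√(c i) : ℝ) : ℂ)‖ ≤ C := by
    obtain ⟨C, hC⟩ := hm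
    refine ⟨√C, fun i => ?_⟩
    have := hC i
    rw [Complex.norm_real, Real.norm_eq_abs] at this ⊢
    rw [abs_of_nonneg (Real.sqrt_nonneg _)]
    exact Real.sqrt_le_sqrt ((le_abs_self _).trans this)
  have h : mulOp (fun i => (c i : ℂ)) hm =
      star (mulOp (fun i => ((√(c i) : ℝ) : ℂ)) hm') * mulOp (fun i => ((√(c i) : ℝ) : ℂ)) hm' := by
    rw [(mulOp_adjoint_apply _ hm' fun i => Complex.conj_ofReal _).star_eq]
    ext ψ i
    rw [mul_apply_eq_comp, mulOp_apply, mulOp_apply, mulOp_apply, ← mul_assoc,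
      ← Complex.ofReal_mul, Real.mul_self_sqrt (hc i)]
  rw [h]
  exact star_mul_self_nonneg _

theorem memℓp_comp_equiv (σ : ι ≃ ι) {ψ : ι → ℂ} (hψ : Memℓp ψ 2) :
    Memℓp (fun i => ψ (σ i)) 2 := by
  have h2 : (0 : ℝ) < (2 : ℝ≥0∞).toReal := by norm_num
  exact memℓp_gen ((σ.summable_iff (f := fun i => ‖ψ i‖ ^ (2 : ℝ≥0∞).toReal)).2 (hψ.summable h2))

/-- The unitary operator on `ℓ²(ι)` that permutes the coordinates. -/
def permOp (σ : ι ≃ ι) : EllTwo ι →L[ℂ] EllTwo ι :=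
  LinearMap.mkContinuous
    { toFun := fun ψ => ⟨fun i => ψ (σ i), memℓp_comp_equiv σ ψ.2⟩
      map_add' := fun ψ φ => by
        ext i
        rfl
      map_smul' := fun c ψ => by
        ext i
        rfl } 1 (fun ψ => by
    have h2 : (0 : ℝ) < (2 : ℝ≥0∞).toReal := by norm_num
    rw [one_mul, lp.norm_eq_tsum_rpow h2, lp.norm_eq_tsum_rpow h2]
    exact (congrArg (· ^ (1 / (2 : ℝ≥0∞).toReal))
      (σ.tsum_eq (fun i => ‖ψ i‖ ^ (2 : ℝ≥0∞).toReal))).le)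

theorem permOp_apply (σ : ι ≃ ι) (ψ : EllTwo ι) (i : ι) : permOp σ ψ i = ψ (σ i) := rfl

theorem permOp_adjoint (σ : ι ≃ ι) : star (permOp σ) = permOp σ.symm := by
  rw [ContinuousLinearMap.star_eq_adjoint, eq_comm, ContinuousLinearMap.eq_adjoint_iff]
  intro x y
  rw [lp.inner_eq_tsum, lp.inner_eq_tsum, ← σ.tsum_eq]
  refine tsum_congr fun i => ?_
  rw [permOp_apply, permOp_apply, σ.symm_apply_apply]

end EllTwo

/-! ### Diagonalization of the Dirac operator -/

namespace BratteliDiagram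

variable {B : BratteliDiagram.{u}}

variable (B) in
/-- The permutation of the index set of `ℓ²(FB × {±})` exchanging the two signs. -/
def signSwap : FinPath B × Bool ≃ FinPath B × Bool where
  toFun p := (p.1, !p.2)
  invFun p := (p.1, !p.2)
  left_inv p := by simp
  right_inv p := by simp

section Dirac

variable {w : FinPath B → ℝ}

/-- The domain is maximal, so a vector belongs to it as soon as its formal image is square summable;
for the candidate inverse this image is the given vector `φ`. -/
theorem isBoundedInverse_dirac (hpos : ∀ l, 0 < cylDiam w l)
    (hm : ∃ C : ℝ, ∀ p : FinPath B × Bool, ‖(cylDiam w p.1 : ℂ)‖ ≤ C) :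
    IsBoundedInverse (dirac w)
      (mulOp (fun p : FinPath B × Bool => (cylDiam w p.1 : ℂ)) hm * permOp (signSwap B)) := by
  have h0 : ∀ l, (cylDiam w l : ℂ) ≠ 0 := fun l => Complex.ofReal_ne_zero.2 (hpos l).ne'
  constructor
  · intro ψ
    ext ⟨l, b⟩
    change (cylDiam w l : ℂ) * ((((cylDiam w l)⁻¹ : ℝ) : ℂ) * (ψ : PathHilbert B) (l, !!b)) = _
    rw [Bool.not_not, Complex.ofReal_inv, mul_inv_cancel_left₀ (h0 l)]
  · intro φ
    have key : diracFun w (⇑((mulOp (fun p : FinPath B × Bool => (cylDiam w p.1 : ℂ)) hm *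
        permOp (signSwap B)) φ)) = ⇑φ := by
      funext ⟨l, b⟩
      change (((cylDiam w l)⁻¹ : ℝ) : ℂ) * ((cylDiam w l : ℂ) * φ (l, !!b)) = _
      rw [Bool.not_not, Complex.ofReal_inv, inv_mul_cancel_left₀ (h0 l)]
    have hd : (mulOp (fun p : FinPath B × Bool => (cylDiam w p.1 : ℂ)) hm *
        permOp (signSwap B)) φ ∈ (dirac w).domain := by
      change Memℓp (diracFun w _) 2
      rw [key]
      exact φ.2
    exact ⟨hd, Subtype.ext key⟩

open Classical in
-- The diameter does not depend on the sign and the swap is an involution, so the swap cancels in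
-- `R* R`, and `|D⁻¹|` is multiplication by the diameter. The decidability instance is spelled out
-- so that the basis vector is literally the one in `diagCoeff`.
theorem absNegPow_dirac_single (hpos : ∀ l, 0 < cylDiam w l)
    (hm : ∃ C : ℝ, ∀ l, cylDiam w l ≤ C) {s : ℝ} (hs : 0 < s) (p : FinPath B × Bool) :
    absNegPow (dirac w) s (@lp.single _ _ _ (fun a b => propDecidable (a = b)) 2 p (1 : ℂ)) =
      ((cylDiam w p.1 ^ s : ℝ) : ℂ) •
        (@lp.single _ _ _ (fun a b => propDecidable (a = b)) 2 p (1 : ℂ) : PathHilbert B) := by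
  have hm' : ∃ C : ℝ, ∀ p : FinPath B × Bool, ‖(cylDiam w p.1 : ℂ)‖ ≤ C := by
    obtain ⟨C, hC⟩ := hm
    refine ⟨C, fun p => ?_⟩
    rw [Complex.norm_real, Real.norm_eq_abs, abs_of_pos (hpos _)]
    exact hC _
  refine absNegPow_apply_eigenvector (isBoundedInverse_dirac hpos hm')
    (mulOp_nonneg (fun p : FinPath B × Bool => cylDiam w p.1) (fun p => (hpos p.1).le) hm') ?_
    (mulOp_single _ hm' p) hs
  rw [star_mul, permOp_adjoint, (mulOp_adjoint_apply _ hm' fun p => Complex.conj_ofReal _).star_eq]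
  ext ψ ⟨l, b⟩
  change (cylDiam w l : ℂ) * ((cylDiam w l : ℂ) * ψ (l, b)) =
    (cylDiam w l : ℂ) * ((cylDiam w l : ℂ) * ψ (l, !!b))
  rw [Bool.not_not]

theorem diagCoeff_absNegPow (hpos : ∀ l, 0 < cylDiam w l)
    (hm : ∃ C : ℝ, ∀ l, cylDiam w l ≤ C) {s : ℝ} (hs : 0 < s) (p : FinPath B × Bool) :
    diagCoeff (absNegPow (dirac w) s) p = ((cylDiam w p.1 ^ s : ℝ) : ℂ) :=
  diagCoeff_eq_of_apply_single (absNegPow_dirac_single hpos hm hs p)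

theorem diagCoeff_absNegPow_comp_pathRep (hpos : ∀ l, 0 < cylDiam w l)
    (hm : ∃ C : ℝ, ∀ l, cylDiam w l ≤ C) {s : ℝ} (hs : 0 < s) (τ : ChoiceFunction w)
    (f : LipFun w) (p : FinPath B × Bool) :
    diagCoeff (absNegPow (dirac w) s ∘L pathRep τ f) p = ((cylDiam w p.1 ^ s : ℝ) : ℂ) *
      f.toFun (if p.2 then τ.plus p.1 else τ.minus p.1) := by
  rw [pathRep, diagCoeff_comp_mulOp _ _ (absNegPow_dirac_single hpos hm hs p), apply_ite f.toFun]

theorem opZeta_dirac (hpos : ∀ l, 0 < cylDiam w l)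
    (hm : ∃ C : ℝ, ∀ l, cylDiam w l ≤ C) {s : ℝ} (hs : 0 < s) :
    opZeta (dirac w) s = ∑' l : FinPath B, ENNReal.ofReal (cylDiam w l ^ s) := by
  rw [opZeta, opTracePos]
  simp_rw [diagCoeff_absNegPow hpos hm hs, Complex.ofReal_re]
  rw [ENNReal.tsum_prod (f := fun l (_ : Bool) => ENNReal.ofReal (cylDiam w l ^ s))]
  simp only [tsum_fintype, Fintype.sum_bool, ← two_mul]
  rw [ENNReal.tsum_mul_left, ← mul_assoc, ENNReal.inv_mul_cancel (by norm_num) (by norm_num),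
    one_mul]

end Dirac

end BratteliDiagram

end

/-! ### Combinatorics of paths and cylinder sets -/

noncomputable section

namespace BratteliDiagram

variable {B : BratteliDiagram.{u}}

section Combinatorics

theorem InfPath.take_eq_iff {x y : InfPath B} {n : ℕ} :
    x.take n = y.take n ↔ B.r (x.edge 0) = B.r (y.edge 0) ∧ ∀ i < n, x.edge i = y.edge i := by
  rw [FinPath.ext_iff]
  simp only [InfPath.take, true_and, heq_eq_eq, funext_iff]
  exact and_congr_right fun _ => ⟨fun h i hi => h ⟨i, hi⟩, fun h i => h i i.2⟩

theorem InfPath.take_eq_of_le {x y : InfPath B} {m n : ℕ} (hmn : m ≤ n)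
    (h : x.take n = y.take n) : x.take m = y.take m := by
  rw [take_eq_iff] at h ⊢
  exact ⟨h.1, fun i hi => h.2 i (hi.trans_le hmn)⟩

theorem InfPath.eq_of_forall_take_eq {x y : InfPath B} (h : ∀ n, x.take n = y.take n) : x = y := by
  ext n
  exact (take_eq_iff.1 (h (n + 1))).2 n n.lt_succ_self

theorem mem_cylinder {l : FinPath B} {x : InfPath B} : x ∈ cylinder l ↔ x.take l.len = l := Iff.rfl

theorem InfPath.mem_cylinder_take (x : InfPath B) (n : ℕ) : x ∈ cylinder (x.take n) := rfl

theorem InfPath.source_take (x : InfPath B) (n : ℕ) :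
    (x.take n).source = (B.r (x.edge n) : B.V n) := by
  cases n with
  | zero => rfl
  | succ n => exact x.comp n

theorem InfPath.take_isSubpath_take (x : InfPath B) {m n : ℕ} (h : m ≤ n) :
    (x.take m).IsSubpath (x.take n) := ⟨h, rfl, fun _ => rfl⟩

theorem FinPath.IsSubpath.mem_cylinder {γ l : FinPath B} (h : γ.IsSubpath l) {x : InfPath B}
    (hx : x ∈ cylinder l) : x ∈ cylinder γ := by
  obtain ⟨h1, h2, h3⟩ := h
  obtain ⟨n, rfl⟩ : ∃ n, l = x.take n := ⟨_, (BratteliDiagram.mem_cylinder.1 hx).symm⟩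
  rw [BratteliDiagram.mem_cylinder]
  ext
  · rfl
  · exact h2.symm
  · exact heq_of_eq (funext fun i => (h3 i).symm)

theorem isSubpath_of_mem_cylinder {γ l : FinPath B} {x : InfPath B} (hγ : x ∈ cylinder γ)
    (hl : x ∈ cylinder l) (h : γ.len ≤ l.len) : γ.IsSubpath l := by
  rw [mem_cylinder] at hγ hl
  have := x.take_isSubpath_take h
  rwa [hγ, hl] at this

theorem FinPath.IsSubpath.cylinder_subset {γ l : FinPath B} (h : γ.IsSubpath l) :
    cylinder l ⊆ cylinder γ := fun _ hx => h.mem_cylinder hx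

variable (B) in
/-- Every vertex of every level receives an edge. -/
def NoDeadEnds : Prop := ∀ (n : ℕ) (v : B.V n), ∃ e : B.E n, B.r e = v

theorem NoDeadEnds.nonempty_cylinder (hB : NoDeadEnds B) (l : FinPath B) :
    (cylinder l).Nonempty := by
  choose nxt hnxt using hB
  -- Follow `l` while it lasts, then append an arbitrary edge at every level.
  let f : ∀ n, B.E n := fun n => Nat.rec (motive := fun n => B.E n)
    (if h : 0 < l.len then l.edge ⟨0, h⟩ else nxt 0 l.range)
    (fun n e => if h : n + 1 < l.len then l.edge ⟨n + 1, h⟩ else nxt (n + 1) (B.s e)) n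
  have hf0 : f 0 = if h : 0 < l.len then l.edge ⟨0, h⟩ else nxt 0 l.range := rfl
  have hfs : ∀ n, f (n + 1) =
      if h : n + 1 < l.len then l.edge ⟨n + 1, h⟩ else nxt (n + 1) (B.s (f n)) := fun n => rfl
  have hf : ∀ n (h : n < l.len), f n = l.edge ⟨n, h⟩ := by
    intro n h
    cases n with
    | zero => rw [hf0, dif_pos h]
    | succ n => rw [hfs, dif_pos h]
  refine ⟨⟨f, fun n => ?_⟩, ?_⟩
  · by_cases h : n + 1 < l.len
    · rw [hf n (by omega), hf (n + 1) h]
      exact l.comp n h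
    · rw [hfs, dif_neg h, hnxt]
  · rw [mem_cylinder]
    ext
    · rfl
    · change B.r (f 0) = l.range
      rw [hf0]
      split_ifs with h
      · exact l.range_eq h
      · exact hnxt _ _
    · exact heq_of_eq (funext fun i => hf i i.2)

/-- The path of length `0` at a vertex of level `0`. -/
def nil (v : B.V 0) : FinPath B where
  len := 0
  range := v
  edge i := i.elim0
  range_eq h := absurd h (lt_irrefl 0)
  comp _ h := absurd h (Nat.not_lt_zero _)

theorem mem_cylinder_nil {v : B.V 0} {x : InfPath B} : x ∈ cylinder (nil v) ↔ B.r (x.edge 0) = v := by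
  rw [mem_cylinder, FinPath.ext_iff]
  simp only [InfPath.take, nil, true_and]
  refine ⟨fun h => h.1, fun h => ⟨h, heq_of_eq (funext fun i : Fin 0 => i.elim0)⟩⟩

instance finite_finPath_len (n : ℕ) : Finite {l : FinPath B // l.len = n} := by
  have := B.finite_V
  have := B.finite_E
  let F : {l : FinPath B // l.len = n} → B.V 0 × (∀ i : Fin n, B.E i) :=
    fun l => (l.1.range, fun i => l.1.edge ⟨i, i.2.trans_eq l.2.symm⟩)
  refine Finite.of_injective F ?_
  rintro ⟨l, rfl⟩ ⟨l', h⟩ hF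
  refine Subtype.ext ?_
  cases l with
  | mk len range edge _ _ =>
    cases l' with
    | mk len' range' edge' _ _ =>
      simp only at h
      subst h
      simp only [F, Prod.mk.injEq] at hF
      simp only [FinPath.mk.injEq, heq_eq_eq, true_and]
      exact hF

instance countable_finPath : Countable (FinPath B) :=
  (Equiv.sigmaFiberEquiv (FinPath.len (B := B))).symm.injective.countable

theorem finite_setOf_len_le (n : ℕ) : {l : FinPath B | l.len ≤ n}.Finite := by
  have : {l : FinPath B | l.len ≤ n} = ⋃ i ∈ Set.Iic n, {l : FinPath B | l.len = i} := by
    ext l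
    simp
  rw [this]
  exact (Set.finite_Iic n).biUnion fun i _ => Set.finite_coe_iff.1 (finite_finPath_len i)

end Combinatorics

/-! ### Topology of the path space -/

section Topology

theorem isOpen_cylinder (l : FinPath B) : IsOpen (cylinder l) :=
  TopologicalSpace.isOpen_generateFrom_of_mem ⟨l, rfl⟩

theorem isClopen_cylinder (l : FinPath B) : IsClopen (cylinder l) := by
  refine ⟨⟨isOpen_iff_forall_mem_open.2 fun x hx => ?_⟩, isOpen_cylinder l⟩
  refine ⟨cylinder (x.take l.len), fun y hy hyl => hx ?_, isOpen_cylinder _, rfl⟩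
  rw [mem_cylinder] at hy hyl ⊢
  change y.take l.len = x.take l.len at hy
  rw [← hy, hyl]

theorem measurableSet_cylinder (l : FinPath B) : MeasurableSet (cylinder l) :=
  (isOpen_cylinder l).measurableSet

instance : SecondCountableTopology (InfPath B) :=
  ⟨⟨Set.range cylinder, Set.countable_range _, rfl⟩⟩

instance : T2Space (InfPath B) := by
  refine ⟨fun x y hxy => ?_⟩
  obtain ⟨n, hn⟩ : ∃ n, x.take n ≠ y.take n := by
    by_contra! h
    exact hxy (InfPath.eq_of_forall_take_eq h)
  refine ⟨_, _, isOpen_cylinder _, isOpen_cylinder _, x.mem_cylinder_take n,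
    y.mem_cylinder_take n, Set.disjoint_left.2 fun z hz hz' => hn ?_⟩
  exact (mem_cylinder.1 hz).symm.trans (mem_cylinder.1 hz')

/-- An ultrafilter selects one edge at every level because each level is finite; the selected edges
are composable and form its limit. -/
instance : CompactSpace (InfPath B) := by
  have := B.finite_E
  refine ⟨isCompact_iff_ultrafilter_le_nhds.2 fun F _ => ?_⟩
  have h : ∀ n, ∃ e : B.E n, ∀ᶠ x : InfPath B in (F : Filter (InfPath B)), x.edge n = e := fun n =>
    Ultrafilter.eventually_exists_iff.1 (Eventually.of_forall fun x => ⟨x.edge n, rfl⟩)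
  choose e he using h
  refine ⟨⟨e, fun n => ?_⟩, Set.mem_univ _, ?_⟩
  · obtain ⟨x, h1, h2⟩ := ((he n).and (he (n + 1))).exists
    rw [← h1, ← h2]
    exact x.comp n
  · refine le_of_le_of_eq ?_ TopologicalSpace.nhds_generateFrom.symm
    refine le_iInf₂ fun s hs => ?_
    obtain ⟨hs, l, rfl⟩ := hs
    rw [le_principal_iff]
    -- Edge `0` is included even if `l` has length `0`, since `take` reads the range off that edge.
    have h2 := (Set.finite_Iio (l.len + 1)).eventually_all.2 fun i _ => he i
    filter_upwards [h2] with x hx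
    rw [mem_cylinder] at hs ⊢
    rw [← hs]
    change x.take l.len = InfPath.take _ l.len
    rw [InfPath.take_eq_iff]
    refine ⟨by rw [hx 0 (Nat.succ_pos _)], fun i hi => hx i (hi.trans (Nat.lt_succ_self _))⟩

/-- Two cylinder sets with a common point are nested, so the generating sets already form a
neighbourhood base. -/
theorem exists_cylinder_subset {U : Set (InfPath B)} (hU : IsOpen U) {x : InfPath B} (hx : x ∈ U) :
    ∃ n, cylinder (x.take n) ⊆ U := by
  induction hU with
  | basic s hs =>
    obtain ⟨l, rfl⟩ := hs
    refine ⟨l.len, ?_⟩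
    rw [mem_cylinder.1 hx]
  | univ => exact ⟨0, Set.subset_univ _⟩
  | inter s t _ _ hs ht =>
    obtain ⟨m, hm⟩ := hs hx.1
    obtain ⟨n, hn⟩ := ht hx.2
    refine ⟨max m n, Set.subset_inter ?_ ?_⟩
    · exact ((x.take_isSubpath_take (le_max_left m n)).cylinder_subset).trans hm
    · exact ((x.take_isSubpath_take (le_max_right m n)).cylinder_subset).trans hn
  | sUnion S _ ih =>
    obtain ⟨s, hs, hxs⟩ := hx
    obtain ⟨n, hn⟩ := ih s hs hxs
    exact ⟨n, hn.trans (Set.subset_sUnion_of_mem hs)⟩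

end Topology

/-! ### Measures on the path space -/

section Measure

variable (B) in
theorem isPiSystem_cylinder : IsPiSystem (Set.range (cylinder (B := B))) := by
  rintro _ ⟨γ, rfl⟩ _ ⟨l, rfl⟩ ⟨x, hx, hx'⟩
  rcases le_total γ.len l.len with h | h
  · exact ⟨l, (Set.inter_eq_right.2 (isSubpath_of_mem_cylinder hx hx' h).cylinder_subset).symm⟩
  · exact ⟨γ, (Set.inter_eq_left.2 (isSubpath_of_mem_cylinder hx' hx h).cylinder_subset).symm⟩

theorem measure_ext_of_cylinder {μ ν : Measure (InfPath B)} (hμ : ∀ l, μ (cylinder l) ≠ ∞)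
    (h : ∀ l, μ (cylinder l) = ν (cylinder l)) : μ = ν := by
  refine Measure.ext_of_generateFrom_of_cover_subset
    (borel_eq_generateFrom_of_subbasis (s := Set.range (cylinder (B := B))) rfl)
    (isPiSystem_cylinder B) subset_rfl (Set.countable_range _) ?_ ?_ ?_
  · exact Set.eq_univ_of_forall fun x => ⟨_, ⟨x.take 0, rfl⟩, rfl⟩
  · rintro _ ⟨l, rfl⟩
    exact hμ l
  · rintro _ ⟨l, rfl⟩
    exact h l

theorem measure_univ_eq_tsum (μ : Measure (InfPath B)) :
    μ Set.univ = ∑' v : B.V 0, μ (cylinder (nil v)) := by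
  have := B.finite_V
  have hU : ⋃ v : B.V 0, cylinder (nil v) = Set.univ :=
    Set.eq_univ_of_forall fun x => Set.mem_iUnion.2 ⟨B.r (x.edge 0), mem_cylinder_nil.2 rfl⟩
  rw [← hU, measure_iUnion]
  · intro v w hvw
    refine Set.disjoint_left.2 fun x hx hx' => hvw ?_
    rw [mem_cylinder_nil] at hx hx'
    exact hx.symm.trans hx'
  · exact fun v => measurableSet_cylinder _

/-- The cylinder sets form a π-system with arbitrarily small neighbourhoods of every point, and the
space is second countable; such a family determines weak convergence. -/
theorem tendsto_probabilityMeasure_of_cylinder {ι : Type*} {L : Filter ι} [L.IsCountablyGenerated]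
    {μ : ι → ProbabilityMeasure (InfPath B)} {ν : ProbabilityMeasure (InfPath B)}
    (h : ∀ l, Tendsto (fun i => (μ i : Measure (InfPath B)).real (cylinder l)) L
      (𝓝 ((ν : Measure (InfPath B)).real (cylinder l)))) : Tendsto μ L (𝓝 ν) := by
  refine (isPiSystem_cylinder B).tendsto_probabilityMeasure_of_tendsto_of_mem ?_ ?_ ?_
  · rintro _ ⟨l, rfl⟩
    exact measurableSet_cylinder l
  · intro U hU x hx
    obtain ⟨n, hn⟩ := exists_cylinder_subset hU hx
    exact ⟨_, ⟨x.take n, rfl⟩, (isOpen_cylinder _).mem_nhds rfl, hn⟩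
  · rintro _ ⟨l, rfl⟩
    rw [← NNReal.tendsto_coe]
    exact h l

/-- A consistent family of weights on the finite paths extends to a probability measure. -/
theorem exists_measure_of_consistent (hB : NoDeadEnds B) (m : FinPath B → ℝ≥0∞)
    (h0 : ∑' v, m (nil v) = 1)
    (hm : ∀ (γ : FinPath B) (n : ℕ), γ.len ≤ n →
      ∑' l : {l : FinPath B // l.len = n ∧ γ.IsSubpath l}, m l.1 = m γ) :
    ∃ μ : Measure (InfPath B), IsProbabilityMeasure μ ∧ ∀ l, μ (cylinder l) = m l := by
  classical
  choose p hp using hB.nonempty_cylinder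
  -- Put mass `m l` at one point of each cylinder of length `n`. Consistency then gives the right
  -- value on all cylinders of length at most `n`.
  let ν : ℕ → Measure (InfPath B) := fun n =>
    Measure.sum fun l : FinPath B => (if l.len = n then m l else 0) • Measure.dirac (p l)
  have hν : ∀ γ n, γ.len ≤ n → ν n (cylinder γ) = m γ := by
    intro γ n hγ
    rw [← hm γ n hγ, Measure.sum_apply _ (measurableSet_cylinder γ)]
    refine Eq.trans (tsum_congr fun l => ?_)
      (tsum_subtype {l : FinPath B | l.len = n ∧ γ.IsSubpath l} m).symm
    rw [Measure.smul_apply, Measure.dirac_apply' _ (measurableSet_cylinder γ), smul_eq_mul]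
    by_cases hl : l.len = n
    · have hiff : p l ∈ cylinder γ ↔ γ.IsSubpath l :=
        ⟨fun h => isSubpath_of_mem_cylinder h (hp l) (hγ.trans_eq hl.symm),
          fun h => h.mem_cylinder (hp l)⟩
      by_cases hs : γ.IsSubpath l
      · simp [hl, hs, hiff]
      · simp [hs, hiff]
    · simp [hl]
  have hν1 : ∀ n, IsProbabilityMeasure (ν n) := fun n => by
    refine ⟨?_⟩
    rw [measure_univ_eq_tsum, ← h0]
    exact tsum_congr fun v => hν _ _ (Nat.zero_le _)
  let P : ℕ → ProbabilityMeasure (InfPath B) := fun n => ⟨ν n, hν1 n⟩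
  -- Probability measures on the compact path space form a weakly compact set. A cluster point
  -- inherits the values on cylinder sets because these have empty frontier.
  obtain ⟨Q, hQ⟩ := exists_clusterPt_of_compactSpace (map P atTop)
  obtain ⟨U, hU, hUQ⟩ := mapClusterPt_iff_ultrafilter.1 hQ
  refine ⟨Q, inferInstance, fun l => ?_⟩
  have h1 := ProbabilityMeasure.tendsto_measure_of_null_frontier_of_tendsto' hUQ
    (E := cylinder l) (by rw [(isClopen_cylinder l).frontier_eq, measure_empty])
  refine tendsto_nhds_unique h1 (tendsto_const_nhds.congr' ?_)
  filter_upwards [hU (eventually_ge_atTop l.len)] with n hn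
  exact (hν l n hn).symm

/-- If normalized weighted sums of point masses converge on cylinder sets, then they converge
on continuous functions. -/
theorem tendsto_weighted_average {ι : Type*} {I : Type*} [Countable I] {L : Filter ι} [L.IsCountablyGenerated]
    {a : ι → I → ℝ} {p : I → InfPath B} {μ : Measure (InfPath B)} [IsProbabilityMeasure μ]
    (ha : ∀ s i, 0 ≤ a s i) (hsum : ∀ᶠ s in L, Summable (a s))
    (hpos : ∀ᶠ s in L, 0 < ∑' i, a s i)
    (hcyl : ∀ l, Tendsto (fun s => (∑' i, a s i * (cylinder l).indicator 1 (p i)) / ∑' i, a s i) L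
      (𝓝 (μ.real (cylinder l))))
    {f : InfPath B → ℂ} (hf : Continuous f) :
    Tendsto (fun s => (∑' i, (a s i : ℂ) * f (p i)) / ((∑' i, a s i : ℝ) : ℂ)) L
      (𝓝 (∫ x, f x ∂μ)) := by
  let ν : ι → Measure (InfPath B) := fun s =>
    Measure.sum fun i => ENNReal.ofReal (a s i / ∑' i, a s i) • Measure.dirac (p i)
  have hZ : ∀ s i, 0 ≤ a s i / ∑' i, a s i := fun s i =>
    div_nonneg (ha s i) (tsum_nonneg (ha s))
  have hν1 : ∀ s, Summable (a s) → 0 < ∑' i, a s i → IsProbabilityMeasure (ν s) := by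
    intro s h1 h2
    refine ⟨?_⟩
    rw [Measure.sum_apply _ MeasurableSet.univ]
    simp only [Measure.smul_apply, measure_univ, smul_eq_mul, mul_one]
    rw [← ENNReal.ofReal_tsum_of_nonneg (hZ s) (h1.div_const _), tsum_div_const, div_self h2.ne',
      ENNReal.ofReal_one]
  have hint : ∀ s, ∀ g : InfPath B → ℂ,
      ∫ x, g x ∂(ν s) = (∑' i, (a s i : ℂ) * g (p i)) / ((∑' i, a s i : ℝ) : ℂ) := by
    intro s g
    rw [integral_sum_dirac fun i => ENNReal.ofReal_ne_top, ← tsum_div_const]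
    refine tsum_congr fun i => ?_
    rw [ENNReal.toReal_ofReal (hZ s i), Complex.real_smul]
    push_cast
    ring
  have hreal : ∀ s l, (ν s).real (cylinder l) =
      (∑' i, a s i * (cylinder l).indicator 1 (p i)) / ∑' i, a s i := by
    intro s l
    rw [← integral_indicator_one (measurableSet_cylinder l),
      integral_sum_dirac fun i => ENNReal.ofReal_ne_top, ← tsum_div_const]
    refine tsum_congr fun i => ?_
    rw [ENNReal.toReal_ofReal (hZ s i), smul_eq_mul]
    ring
  let μ' : ProbabilityMeasure (InfPath B) := ⟨μ, inferInstance⟩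
  classical
  -- Where `ν s` fails to be normalized, `P s` takes the irrelevant default `μ'`; along `L` this
  -- eventually does not happen.
  let P : ι → ProbabilityMeasure (InfPath B) := fun s =>
    if h : IsProbabilityMeasure (ν s) then ⟨ν s, h⟩ else μ'
  have hP : ∀ᶠ s in L, (P s : Measure (InfPath B)) = ν s := by
    filter_upwards [hsum, hpos] with s h1 h2
    have hPs : P s = ⟨ν s, hν1 s h1 h2⟩ := dif_pos (hν1 s h1 h2)
    rw [hPs]
    rfl
  have hlim : Tendsto P L (𝓝 μ') := by
    refine tendsto_probabilityMeasure_of_cylinder fun l => ?_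
    refine (hcyl l).congr' ?_
    filter_upwards [hP] with s hs
    rw [hs, hreal]
  rw [ProbabilityMeasure.tendsto_iff_forall_integral_rclike_tendsto ℂ] at hlim
  refine (hlim (BoundedContinuousFunction.mkOfCompact ⟨f, hf⟩)).congr' ?_
  filter_upwards [hP] with s hs
  rw [hs, ← hint]
  rfl

end Measure

end BratteliDiagram

end

/-! ### The distance, choice functions and the Dixmier trace -/

noncomputable section

namespace BratteliDiagram

variable {B : BratteliDiagram.{u}} {w : FinPath B → ℝ}

theorem pathDist_self (w : FinPath B → ℝ) (x : InfPath B) : pathDist w x x = 0 := by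
  simp [pathDist]

theorem pathDist_of_take_zero_ne {x y : InfPath B} (h : x.take 0 ≠ y.take 0) :
    pathDist w x y = 1 := by
  have hxy : x ≠ y := fun h' => h (h' ▸ rfl)
  rw [pathDist, if_neg hxy, if_neg h]

theorem exists_pathDist_eq (w : FinPath B → ℝ) {x y : InfPath B} (hxy : x ≠ y)
    (h : x.take 0 = y.take 0) :
    ∃ n, pathDist w x y = w (x.take n) ∧ ∀ m, x.take m = y.take m ↔ m ≤ n := by
  obtain ⟨N, hN⟩ : ∃ n, x.take n ≠ y.take n := by
    by_contra! h
    exact hxy (InfPath.eq_of_forall_take_eq h)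
  have hb : BddAbove {n : ℕ | x.take n = y.take n} :=
    ⟨N, fun n hn => le_of_not_gt fun h' => hN (InfPath.take_eq_of_le h'.le hn)⟩
  refine ⟨sSup {n : ℕ | x.take n = y.take n}, ?_, fun m => ⟨fun hm => le_csSup hb hm, fun hm => ?_⟩⟩
  · rw [pathDist, if_neg hxy, if_pos h]
  · exact InfPath.take_eq_of_le hm (Nat.sSup_mem (s := {n : ℕ | x.take n = y.take n}) ⟨0, h⟩ hb)

theorem pathDist_nonneg (hw : ∀ l, 0 < w l) (x y : InfPath B) : 0 ≤ pathDist w x y := by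
  unfold pathDist
  split_ifs
  · exact le_rfl
  · exact (hw _).le
  · exact zero_le_one

/-- The weights tend to zero. -/
def WeightVanishes (w : FinPath B → ℝ) : Prop := ∀ ε, 0 < ε → {l | ε ≤ w l}.Finite

theorem WeightVanishes.exists_len_lt (hv : WeightVanishes w) {ε : ℝ} (hε : 0 < ε) :
    ∃ N, ∀ l : FinPath B, N ≤ l.len → w l < ε := by
  obtain ⟨N, hN⟩ := ((hv ε hε).image FinPath.len).bddAbove
  refine ⟨N + 1, fun l hl => lt_of_not_ge fun h => ?_⟩
  have := hN ⟨l, h, rfl⟩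
  omega

/-- Distinct points that agree up to level `N` are at a distance equal to the weight of a path of
length at least `N`, and such weights are uniformly small. -/
theorem LipFun.continuous (hw : ∀ l, 0 < w l) (hv : WeightVanishes w) (f : LipFun w) : Continuous f.toFun := by
  obtain ⟨C, hC⟩ := f.lipschitz
  refine continuous_iff_continuousAt.2 fun x => Metric.tendsto_nhds.2 fun ε hε => ?_
  -- The constant `C` need not be positive, hence `|C| + 1`.
  obtain ⟨N, hN⟩ := hv.exists_len_lt (ε := ε / (|C| + 1)) (by positivity)
  filter_upwards [(isOpen_cylinder (x.take N)).mem_nhds (x.mem_cylinder_take N)] with y hy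
  rcases eq_or_ne y x with rfl | hyx
  · simpa using hε
  have hN' : y.take N = x.take N := hy
  obtain ⟨n, h1, h2⟩ := exists_pathDist_eq w hyx (InfPath.take_eq_of_le (Nat.zero_le _) hN')
  have h3 := hN (y.take n) ((h2 N).1 hN')
  rw [dist_eq_norm]
  refine (hC y x).trans_lt ?_
  rw [h1]
  calc C * w (y.take n) ≤ (|C| + 1) * w (y.take n) := by
        have := hw (y.take n)
        gcongr
        linarith [le_abs_self C]
    _ < (|C| + 1) * (ε / (|C| + 1)) := by gcongr
    _ = ε := by field_simp

/-- The indicator function of a cylinder set is Lipschitz. -/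
def indicatorLip (hw : ∀ l, 0 < w l) (γ : FinPath B) : LipFun w where
  toFun := (cylinder γ).indicator 1
  lipschitz := by
    have hfin := finite_setOf_len_le (B := B) γ.len
    -- Points separated by `[γ]` have a common initial segment shorter than `γ`, or none. In the
    -- first case the distance is one of finitely many weights, compensated by its inverse in the
    -- sum; in the second it is `1`, compensated by the summand `1`.
    refine ⟨1 + ∑ l ∈ hfin.toFinset, (w l)⁻¹, ?_⟩
    have hnn : 0 ≤ ∑ l ∈ hfin.toFinset, (w l)⁻¹ :=
      Finset.sum_nonneg fun l _ => (inv_pos.2 (hw l)).le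
    have key : ∀ x y, (x ∈ cylinder γ ↔ y ∈ cylinder γ) ∨
        1 ≤ (1 + ∑ l ∈ hfin.toFinset, (w l)⁻¹) * pathDist w x y := by
      intro x y
      by_cases hxy : x = y
      · left
        rw [hxy]
      by_cases h0 : x.take 0 = y.take 0
      · obtain ⟨n, h1, h2⟩ := exists_pathDist_eq w hxy h0
        rcases le_or_gt γ.len n with hn | hn
        · left
          rw [mem_cylinder, mem_cylinder, (h2 γ.len).2 hn]
        · right
          rw [h1]
          have hle := Finset.single_le_sum (f := fun l => (w l)⁻¹)
            (fun l _ => (inv_pos.2 (hw l)).le) (hfin.mem_toFinset.2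
              (show x.take n ∈ {l : FinPath B | l.len ≤ γ.len} from hn.le))
          calc (1 : ℝ) = (w (x.take n))⁻¹ * w (x.take n) := (inv_mul_cancel₀ (hw _).ne').symm
            _ ≤ _ := mul_le_mul_of_nonneg_right (hle.trans (by linarith)) (hw _).le
      · right
        rw [pathDist_of_take_zero_ne h0]
        linarith
    intro x y
    have hd := pathDist_nonneg hw x y
    rcases key x y with h | h
    · have : (cylinder γ).indicator (1 : InfPath B → ℂ) x = (cylinder γ).indicator 1 y := by
        by_cases hy : y ∈ cylinder γ <;> simp [h, hy]
      rw [this, sub_self, norm_zero]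
      positivity
    · refine le_trans ?_ h
      simp only [Set.indicator, Pi.one_apply]
      split_ifs <;> simp
  bounded := ⟨1, fun x => by
    simp only [Set.indicator, Pi.one_apply]
    split_ifs <;> simp⟩

/-- Only finitely many values of the distance exceed half of the supremum, so the supremum is
attained. -/
theorem exists_choiceFunction (hB : NoDeadEnds B) (hw : ∀ l, 0 < w l) (hv : WeightVanishes w)
    (hd : ∀ l, w l = cylDiam w l) : Nonempty (ChoiceFunction w) := by
  have key : ∀ l : FinPath B, ∃ x ∈ cylinder l, ∃ y ∈ cylinder l, pathDist w x y = cylDiam w l := by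
    intro l
    set S : Set ℝ := {t | ∃ x ∈ cylinder l, ∃ y ∈ cylinder l, t = pathDist w x y} with hS
    have hSl : w l = sSup S := hd l
    suffices h : sSup S ∈ S by
      obtain ⟨x, hx, y, hy, h⟩ := h
      exact ⟨x, hx, y, hy, h.symm⟩
    have hne : S.Nonempty := by
      obtain ⟨x, hx⟩ := hB.nonempty_cylinder l
      exact ⟨_, x, hx, x, hx, rfl⟩
    have hpos : 0 < sSup S := hSl ▸ hw l
    have hfin : (S ∩ Set.Ioi (sSup S / 2)).Finite := by
      refine ((hv (sSup S / 2) (by positivity)).image w).subset ?_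
      rintro t ⟨⟨x, hx, y, hy, rfl⟩, ht⟩
      rw [Set.mem_Ioi] at ht
      have hxy : x ≠ y := by
        rintro rfl
        rw [pathDist_self] at ht
        linarith
      have h0 : x.take 0 = y.take 0 := by
        have : x.take l.len = y.take l.len := (mem_cylinder.1 hx).trans (mem_cylinder.1 hy).symm
        exact InfPath.take_eq_of_le (Nat.zero_le _) this
      obtain ⟨n, h1, -⟩ := exists_pathDist_eq w hxy h0
      rw [h1] at ht ⊢
      exact ⟨x.take n, ht.le, rfl⟩
    have hne' : (S ∩ Set.Ioi (sSup S / 2)).Nonempty := by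
      obtain ⟨t, ht, ht'⟩ := exists_lt_of_lt_csSup hne (half_lt_self hpos)
      exact ⟨t, ht, ht'⟩
    obtain ⟨t, ⟨htS, ht⟩, hmax⟩ := hfin.exists_maximalFor id _ hne'
    have hle : ∀ u ∈ S, u ≤ t := by
      intro u hu
      by_contra! h
      exact h.not_ge (hmax ⟨hu, lt_trans ht h⟩ h.le)
    rwa [le_antisymm (csSup_le hne hle) (le_csSup ⟨t, hle⟩ htS)]
  choose p hp q hq hpq using key
  exact ⟨⟨p, q, hp, hq, hpq⟩⟩

theorem exists_ne_of_cylDiam_pos {l : FinPath B} (h : 0 < cylDiam w l) :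
    ∃ x ∈ cylinder l, ∃ y ∈ cylinder l, x ≠ y := by
  by_contra! hne
  refine h.not_ge (Real.sSup_nonpos ?_)
  rintro t ⟨x, hx, y, hy, rfl⟩
  rw [hne x hx y hy, pathDist_self]

theorem opTrace_absNegPow (hw : ∀ l, 0 < w l) (hb : ∃ C : ℝ, ∀ l, w l ≤ C)
    (hd : ∀ l, w l = cylDiam w l) {s : ℝ} (hs : 0 < s) :
    opTrace (absNegPow (dirac w) s) = ((∑' p : FinPath B × Bool, w p.1 ^ s : ℝ) : ℂ) := by
  rw [opTrace, Complex.ofReal_tsum]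
  refine tsum_congr fun p => ?_
  rw [diagCoeff_absNegPow (fun l => hd l ▸ hw l) (by simpa only [← hd] using hb) hs, ← hd]

theorem opTrace_absNegPow_comp_pathRep (hw : ∀ l, 0 < w l) (hb : ∃ C : ℝ, ∀ l, w l ≤ C)
    (hd : ∀ l, w l = cylDiam w l) {s : ℝ} (hs : 0 < s) (τ : ChoiceFunction w) (f : LipFun w) :
    opTrace (absNegPow (dirac w) s ∘L pathRep τ f) = ∑' p : FinPath B × Bool,
      ((w p.1 ^ s : ℝ) : ℂ) * f.toFun (if p.2 then τ.plus p.1 else τ.minus p.1) := by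
  rw [opTrace]
  refine tsum_congr fun p => ?_
  rw [diagCoeff_absNegPow_comp_pathRep (fun l => hd l ▸ hw l) (by simpa only [← hd] using hb) hs,
    ← hd]

theorem summable_prod_bool {I : Type*} {a : I → ℝ} (ha : ∀ i, 0 ≤ a i) (hs : Summable a)
    {c : I × Bool → ℝ} (hc : ∀ p, 0 ≤ c p) (hc1 : ∀ p, c p ≤ 1) :
    Summable (fun p : I × Bool => a p.1 * c p) ∧
      ∑' p : I × Bool, a p.1 * c p = ∑' i, a i * (c (i, true) + c (i, false)) := by
  have h1 : Summable fun p : I × Bool => a p.1 := by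
    refine (summable_prod_of_nonneg fun p => ha p.1).2 ⟨fun i => Summable.of_finite, ?_⟩
    simpa only [tsum_fintype, Fintype.sum_bool] using hs.add hs
  have h2 : Summable (fun p : I × Bool => a p.1 * c p) :=
    Summable.of_nonneg_of_le (fun p => mul_nonneg (ha _) (hc _))
      (fun p => mul_le_of_le_one_right (ha _) (hc1 p)) h1
  refine ⟨h2, ?_⟩
  rw [h2.tsum_prod' fun i => Summable.of_finite]
  refine tsum_congr fun i => ?_
  rw [tsum_fintype, Fintype.sum_bool, mul_add]

/-- Weak convergence reduces the claim to indicators of cylinder sets. There the trace and twice the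
sum over the extensions of `γ` differ by finitely many terms, an error that the diverging
denominator removes. -/
theorem isDixmierMeasure_of_tendsto (hw : ∀ l, 0 < w l) (hv : WeightVanishes w)
    (hb : ∃ C : ℝ, ∀ l, w l ≤ C) (hd : ∀ l, w l = cylDiam w l) {δ : ℝ} (hδ : 0 < δ)
    (habs : abscissa (dirac w) = δ) (hsum : ∀ s, δ < s → Summable fun l => w l ^ s)
    (hinf : Tendsto (fun s => ∑' l, w l ^ s) (𝓝[>] δ) atTop)
    {μ : Measure (InfPath B)} [IsProbabilityMeasure μ]
    (hcyl : ∀ γ : FinPath B, Tendsto (fun s : ℝ =>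
      (∑' l : {l : FinPath B // γ.IsSubpath l}, w l.1 ^ s) / ∑' l, w l ^ s) (𝓝[>] δ)
      (𝓝 (μ.real (cylinder γ)))) (τ : ChoiceFunction w) : IsDixmierMeasure τ μ := by
  classical
  refine ⟨inferInstance, fun f => ?_⟩
  have hnn : ∀ (s : ℝ) l, 0 ≤ w l ^ s := fun s l => (Real.rpow_pos_of_pos (hw l) s).le
  have hpos : ∀ᶠ s : ℝ in 𝓝[>] δ, 0 < s := by
    filter_upwards [self_mem_nhdsWithin] with s hs using hδ.trans hs
  have htot : ∀ s, δ < s → ∑' p : FinPath B × Bool, w p.1 ^ s = 2 * ∑' l, w l ^ s := by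
    intro s hs
    have := (summable_prod_bool (hnn s) (hsum s hs) (c := fun _ => 1) (fun _ => zero_le_one)
      (fun _ => le_rfl)).2
    simp only [mul_one] at this
    rw [this, tsum_mul_right]
    ring
  have key := tendsto_weighted_average (L := 𝓝[>] δ) (I := FinPath B × Bool)
    (a := fun s p => w p.1 ^ s) (p := fun p => if p.2 then τ.plus p.1 else τ.minus p.1) (μ := μ)
    (fun s p => hnn s p.1) ?_ ?_ ?_ (f.continuous hw hv)
  · rw [HasDixmierTrace, habs]
    refine key.congr' ?_
    filter_upwards [hpos] with s hs
    rw [opTrace_absNegPow hw hb hd hs, opTrace_absNegPow_comp_pathRep hw hb hd hs]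
  · filter_upwards [self_mem_nhdsWithin] with s hs
    have := (summable_prod_bool (hnn s) (hsum s hs) (c := fun _ => 1) (fun _ => zero_le_one)
      (fun _ => le_rfl)).1
    simpa only [mul_one] using this
  · filter_upwards [self_mem_nhdsWithin, hinf.eventually_gt_atTop 0] with s hs h0
    rw [htot s hs]
    positivity
  · intro γ
    set c : FinPath B × Bool → ℝ := fun p =>
      (cylinder γ).indicator 1 (if p.2 then τ.plus p.1 else τ.minus p.1) with hc
    have hc0 : ∀ p, 0 ≤ c p := fun p => Set.indicator_nonneg (fun _ _ => zero_le_one) _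
    have hc1 : ∀ p, c p ≤ 1 := fun p => Set.indicator_le_self' (fun _ _ => zero_le_one) _
    have hmem : ∀ p : FinPath B × Bool, (if p.2 then τ.plus p.1 else τ.minus p.1) ∈ cylinder p.1 := by
      intro p
      split_ifs
      exacts [τ.plus_mem _, τ.minus_mem _]
    have hfin := finite_setOf_len_le (B := B) γ.len
    -- The discrepancy at `l` between the trace and the sum over extensions. If `l` is at least as
    -- long as `γ`, then `[l]` lies inside `[γ]` or is disjoint from it, so both signs agree with
    -- the indicator and `e l = 0`.
    set e : FinPath B → ℝ := fun l => (c (l, true) + c (l, false)) -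
      2 * {l : FinPath B | γ.IsSubpath l}.indicator 1 l with he
    have he0 : ∀ l ∉ hfin.toFinset, e l = 0 := by
      intro l hl
      have hl' : γ.len ≤ l.len := by
        have := mt hfin.mem_toFinset.2 hl
        exact (not_le.1 this).le
      have hcl : ∀ b, c (l, b) = {l : FinPath B | γ.IsSubpath l}.indicator 1 l := by
        intro b
        have hiff : (if b then τ.plus l else τ.minus l) ∈ cylinder γ ↔ γ.IsSubpath l :=
          ⟨fun h => isSubpath_of_mem_cylinder h (hmem (l, b)) hl', fun h => h.mem_cylinder (hmem (l, b))⟩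
        simp only [hc, Set.indicator, hiff, Set.mem_ofPred_eq, Pi.one_apply]
      simp only [he, hcl]
      ring
    have hE : Tendsto (fun s : ℝ => ∑ l ∈ hfin.toFinset, w l ^ s * e l) (𝓝[>] δ)
        (𝓝 (∑ l ∈ hfin.toFinset, w l ^ δ * e l)) := by
      refine tendsto_finsetSum _ fun l _ => Tendsto.mul_const _ ?_
      exact (Real.continuous_const_rpow (hw l).ne').continuousAt.tendsto.mono_left nhdsWithin_le_nhds
    have hlim := (hcyl γ).add ((hE.div_atTop hinf).mul_const 2⁻¹)
    rw [zero_mul, add_zero] at hlim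
    refine hlim.congr' ?_
    filter_upwards [self_mem_nhdsWithin, hinf.eventually_gt_atTop 0] with s hs h0
    have hsub : ∑' l : {l : FinPath B // γ.IsSubpath l}, w l.1 ^ s =
        ∑' l, w l ^ s * {l : FinPath B | γ.IsSubpath l}.indicator 1 l := by
      refine (tsum_subtype {l : FinPath B | γ.IsSubpath l} fun l => w l ^ s).trans
        (tsum_congr fun l => ?_)
      by_cases h : l ∈ {l : FinPath B | γ.IsSubpath l} <;> simp [h]
    have hs1 : Summable fun l => w l ^ s * {l : FinPath B | γ.IsSubpath l}.indicator 1 l :=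
      Summable.of_nonneg_of_le
        (fun l => mul_nonneg (hnn s l) (Set.indicator_nonneg (fun _ _ => zero_le_one) _))
        (fun l => mul_le_of_le_one_right (hnn s l)
          (Set.indicator_le_self' (fun _ _ => zero_le_one) _)) (hsum s hs)
    have hs2 : ∑' p : FinPath B × Bool, w p.1 ^ s * c p =
        2 * (∑' l, w l ^ s * {l : FinPath B | γ.IsSubpath l}.indicator 1 l) +
          ∑ l ∈ hfin.toFinset, w l ^ s * e l := by
      rw [(summable_prod_bool (hnn s) (hsum s hs) hc0 hc1).2, ← tsum_mul_left,
        ← tsum_eq_sum (L := .unconditional _) (s := hfin.toFinset) (f := fun l => w l ^ s * e l)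
          fun l hl => by rw [he0 l hl, mul_zero],
        ← (hs1.mul_left 2).tsum_add (summable_of_ne_finset_zero (s := hfin.toFinset)
          fun l hl => by rw [he0 l hl, mul_zero])]
      refine tsum_congr fun l => ?_
      simp only [he]
      ring
    rw [htot s hs, hs2, hsub]
    field_simp

/-- Indicators of cylinder sets are Lipschitz, so the Dixmier trace determines the measure on a
π-system. -/
theorem IsDixmierMeasure.unique (hw : ∀ l, 0 < w l) {τ : ChoiceFunction w}
    {μ ν : Measure (InfPath B)} (hμ : IsDixmierMeasure τ μ) (hν : IsDixmierMeasure τ ν) :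
    μ = ν := by
  have := hμ.1
  have := hν.1
  have hint : ∀ (μ : Measure (InfPath B)) (γ : FinPath B), ∫ x, (indicatorLip hw γ).toFun x ∂μ =
      ((μ.real (cylinder γ) : ℝ) : ℂ) := fun μ γ => by
    change ∫ x, (cylinder γ).indicator (fun _ => (1 : ℂ)) x ∂μ = _
    rw [integral_indicator_const _ (measurableSet_cylinder γ)]
    simp
  refine measure_ext_of_cylinder (fun l => measure_ne_top _ _) fun γ => ?_
  have h := tendsto_nhds_unique (hμ.2 (indicatorLip hw γ)) (hν.2 (indicatorLip hw γ))
  rw [hint, hint, Complex.ofReal_inj] at h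
  exact (measureReal_eq_measureReal_iff).1 h

theorem dixmierMeasure_eq (hw : ∀ l, 0 < w l) {τ : ChoiceFunction w}
    {μ : Measure (InfPath B)} (hμ : IsDixmierMeasure τ μ) : dixmierMeasure τ = μ := by
  have hex : ∃ μ, IsDixmierMeasure τ μ := ⟨μ, hμ⟩
  rw [dixmierMeasure, dif_pos hex]
  exact hex.choose_spec.unique hw hμ

end BratteliDiagram

end

/-! ### Perron-Frobenius theory of irreducible matrices -/

noncomputable section

namespace Matrix

variable {V : Type*} [Fintype V] [DecidableEq V] {A : Matrix V V ℝ}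

/-- One exponent is chosen for each pair `(i, j)`. The resulting sum of powers is strictly positive,
commutes with `A` and preserves its eigenvectors; it plays the role of the usual `(1 + A)^n`. -/
theorem IsIrreducible.exists_commute_pos (hA : A.IsIrreducible) :
    ∃ k : V → V → ℕ, ∀ i j, 0 < (∑ p : V × V, A ^ k p.1 p.2) i j := by
  have h := (isIrreducible_iff_exists_pow_pos hA.nonneg).1 hA
  choose k _ hk using h
  refine ⟨k, fun i j => ?_⟩
  rw [Matrix.sum_apply]
  refine Finset.sum_pos' (fun p _ => pow_apply_nonneg hA.nonneg _ _ _) ⟨(i, j), Finset.mem_univ _, hk i j⟩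

omit [DecidableEq V] in
theorem mulVec_pos_of_pos {B : Matrix V V ℝ} (hB : ∀ i j, 0 < B i j) {z : V → ℝ} (hz : ∀ v, 0 ≤ z v)
    (hz0 : z ≠ 0) (v : V) : 0 < (B *ᵥ z) v := by
  obtain ⟨w, hw⟩ := Function.ne_iff.1 hz0
  exact Finset.sum_pos' (fun u _ => mul_nonneg (hB v u).le (hz u))
    ⟨w, Finset.mem_univ _, mul_pos (hB v w) (lt_of_le_of_ne (hz w) (Ne.symm hw))⟩

theorem pow_mulVec_of_eigen {R : Type*} [CommSemiring R] {A : Matrix V V R} {z : V → R} {r : R}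
    (h : A *ᵥ z = r • z) (n : ℕ) : A ^ n *ᵥ z = r ^ n • z := by
  induction n with
  | zero => simp
  | succ n ih => rw [pow_succ, ← mulVec_mulVec, h, mulVec_smul, ih, smul_smul, pow_succ, mul_comm]

/-- A nonzero nonnegative eigenvector of an irreducible matrix is positive. -/
theorem IsIrreducible.eigenvector_pos (hA : A.IsIrreducible) {z : V → ℝ} (hz : ∀ v, 0 ≤ z v)
    (hz0 : z ≠ 0) {r : ℝ} (h : A *ᵥ z = r • z) (v : V) : 0 < z v := by
  obtain ⟨k, hk⟩ := hA.exists_commute_pos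
  have h1 := mulVec_pos_of_pos hk hz hz0 v
  rw [sum_mulVec] at h1
  -- The positive matrix multiplies `z` by a scalar, so `z` vanishes nowhere.
  simp only [pow_mulVec_of_eigen h, ← Finset.sum_smul, Pi.smul_apply, smul_eq_mul] at h1
  refine lt_of_le_of_ne (hz v) fun h0 => ?_
  rw [← h0, mul_zero] at h1
  exact lt_irrefl _ h1

/-- The Collatz-Wielandt argument: maximize `r` subject to `r x ≤ A x` over the simplex. If the
inequality were strict somewhere at the maximum, a positive matrix commuting with `A` would make it
strict everywhere, and `r` could be increased. -/
theorem IsIrreducible.exists_perron [Nonempty V] (hA : A.IsIrreducible) :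
    ∃ (x : V → ℝ) (r : ℝ), (∀ v, 0 < x v) ∧ ∑ v, x v = 1 ∧ A *ᵥ x = r • x := by
  -- The sum of all entries bounds every admissible `r`, which makes the set of pairs compact.
  set M : ℝ := ∑ v, ∑ w, A v w with hM
  set S : Set (ℝ × (V → ℝ)) := (Set.Icc 0 M ×ˢ stdSimplex ℝ V) ∩
    {p | ∀ v, p.1 * p.2 v ≤ (A *ᵥ p.2) v} with hS
  have hmv : ∀ v, Continuous fun p : ℝ × (V → ℝ) => (A *ᵥ p.2) v := fun v => by
    simp only [mulVec, dotProduct]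
    fun_prop
  have hcompact : IsCompact S := by
    refine (isCompact_Icc.prod (isCompact_stdSimplex ℝ V)).inter_right ?_
    simp only [Set.ofPred_forall]
    refine isClosed_iInter fun v => isClosed_le (by fun_prop) (hmv v)
  have hMnn : 0 ≤ M := Finset.sum_nonneg fun v _ => Finset.sum_nonneg fun w _ => hA.nonneg v w
  have hmvnn : ∀ x : V → ℝ, (∀ v, 0 ≤ x v) → ∀ v, 0 ≤ (A *ᵥ x) v := fun x hx v =>
    Finset.sum_nonneg fun w _ => mul_nonneg (hA.nonneg v w) (hx w)
  have hne : S.Nonempty := by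
    obtain ⟨v⟩ := ‹Nonempty V›
    refine ⟨(0, Pi.single v 1), ⟨⟨le_rfl, hMnn⟩, single_mem_stdSimplex ℝ v⟩, fun w => ?_⟩
    rw [zero_mul]
    exact hmvnn _ (single_mem_stdSimplex ℝ v).1 w
  obtain ⟨⟨r, x⟩, ⟨⟨⟨hr0, hrM⟩, hx⟩, hrx⟩, hmax⟩ :=
    hcompact.exists_isMaxOn hne continuous_fst.continuousOn
  simp only [Set.mem_ofPred_eq] at hrx hr0 hrM hx
  have hbound : ∀ (t : ℝ) (y : V → ℝ), y ∈ stdSimplex ℝ V → (∀ v, t * y v ≤ (A *ᵥ y) v) → t ≤ M := by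
    intro t y hy hty
    calc t = ∑ v, t * y v := by rw [← Finset.mul_sum, hy.2, mul_one]
      _ ≤ ∑ v, (A *ᵥ y) v := Finset.sum_le_sum fun v _ => hty v
      _ ≤ M := by
          refine Finset.sum_le_sum fun v _ => Finset.sum_le_sum fun w _ => ?_
          refine mul_le_of_le_one_right (hA.nonneg v w) ?_
          rw [← hy.2]
          exact Finset.single_le_sum (fun u _ => hy.1 u) (Finset.mem_univ w)
  have hx0 : x ≠ 0 := by
    rintro rfl
    simpa using hx.2
  have heig : A *ᵥ x = r • x := by
    by_contra hne
    set z : V → ℝ := A *ᵥ x - r • x with hz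
    have hz0 : z ≠ 0 := sub_ne_zero.2 hne
    have hznn : ∀ v, 0 ≤ z v := fun v => sub_nonneg.2 (hrx v)
    obtain ⟨k, hk⟩ := hA.exists_commute_pos
    set B : Matrix V V ℝ := ∑ p : V × V, A ^ k p.1 p.2 with hB
    have hcomm : B * A = A * B := by
      rw [hB, Finset.sum_mul, Finset.mul_sum]
      exact Finset.sum_congr rfl fun p _ => (Commute.pow_self A _).eq
    set y : V → ℝ := B *ᵥ x with hy
    have hypos : ∀ v, 0 < y v := mulVec_pos_of_pos hk hx.1 hx0
    have hBz : ∀ v, 0 < (A *ᵥ y) v - r * y v := fun v => by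
      have := mulVec_pos_of_pos hk hznn hz0 v
      rwa [hz, mulVec_sub, mulVec_mulVec, hcomm, ← mulVec_mulVec, mulVec_smul] at this
    obtain ⟨ε, hε, hεy⟩ : ∃ ε > 0, ∀ v, ε * y v ≤ (A *ᵥ y) v - r * y v := by
      obtain ⟨v0, hv0⟩ := Finite.exists_min fun v => ((A *ᵥ y) v - r * y v) / y v
      exact ⟨_, div_pos (hBz v0) (hypos v0), fun v => (le_div_iff₀ (hypos v)).1 (hv0 v)⟩
    have hsum : 0 < ∑ v, y v := Finset.sum_pos (fun v _ => hypos v) Finset.univ_nonempty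
    set u : V → ℝ := (∑ v, y v)⁻¹ • y with hu
    have hus : u ∈ stdSimplex ℝ V := by
      refine ⟨fun v => mul_nonneg (inv_nonneg.2 hsum.le) (hypos v).le, ?_⟩
      simp only [hu, Pi.smul_apply, smul_eq_mul, ← Finset.mul_sum]
      exact inv_mul_cancel₀ hsum.ne'
    have hru : ∀ v, (r + ε) * u v ≤ (A *ᵥ u) v := fun v => by
      rw [hu, mulVec_smul, Pi.smul_apply, Pi.smul_apply, smul_eq_mul, smul_eq_mul, mul_left_comm]
      refine mul_le_mul_of_nonneg_left ?_ (inv_nonneg.2 hsum.le)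
      linarith [hεy v]
    have hmem : (r + ε, u) ∈ S :=
      ⟨⟨⟨add_nonneg hr0 hε.le, hbound _ _ hus hru⟩, hus⟩, hru⟩
    have := hmax hmem
    simp only [Set.mem_ofPred_eq] at this
    linarith
  exact ⟨x, r, hA.eigenvector_pos hx.1 hx0 heig, hx.2, heig⟩

/-- The eigenspace of a positive eigenvector of an irreducible matrix is one-dimensional. -/
theorem IsIrreducible.eq_smul_of_eigen [Nonempty V] (hA : A.IsIrreducible) {x y : V → ℝ} {r : ℝ}
    (hx : ∀ v, 0 < x v) (hAx : A *ᵥ x = r • x) (hAy : A *ᵥ y = r • y) : ∃ c : ℝ, y = c • x := by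
  -- With the minimal ratio as coefficient, `y - c x` is nonnegative and vanishes at `v0`, so it
  -- cannot be a nonzero eigenvector.
  obtain ⟨v0, hv0⟩ := Finite.exists_min fun v => y v / x v
  refine ⟨y v0 / x v0, ?_⟩
  by_contra hne
  have hz : ∀ v, 0 ≤ (y - (y v0 / x v0) • x) v := fun v =>
    sub_nonneg.2 ((le_div_iff₀ (hx v)).1 (hv0 v))
  have := hA.eigenvector_pos hz (sub_ne_zero.2 hne) (r := r)
    (by rw [mulVec_sub, mulVec_smul, hAx, hAy, smul_sub, smul_comm]) v0
  rw [Pi.sub_apply, Pi.smul_apply, smul_eq_mul, div_mul_cancel₀ _ (hx v0).ne', sub_self] at this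
  exact lt_irrefl _ this

/-- A positive eigenvector of a nonnegative matrix belongs to the spectral radius. -/
theorem spectralRadius_eq_of_pos_eigenvector [Nonempty V] {N : Matrix V V ℕ} {x : V → ℝ} {r : ℝ}
    (hx : ∀ v, 0 < x v) (h : (N.map (Nat.cast : ℕ → ℝ)) *ᵥ x = r • x) :
    (spectralRadius ℂ (N.map (Nat.cast : ℕ → ℂ))).toReal = r := by
  have hrow : ∀ v, ∑ w, (N v w : ℝ) * x w = r * x v := fun v => congrFun h v
  have hr : 0 ≤ r := by
    obtain ⟨v⟩ := ‹Nonempty V›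
    refine nonneg_of_mul_nonneg_left (b := x v) ?_ (hx v)
    rw [← hrow v]
    exact Finset.sum_nonneg fun w _ => mul_nonneg (Nat.cast_nonneg _) (hx w).le
  have hspec : ∀ μ : ℂ, μ ∈ spectrum ℂ (N.map (Nat.cast : ℕ → ℂ)) ↔
      ∃ z : V → ℂ, z ≠ 0 ∧ (N.map (Nat.cast : ℕ → ℂ)) *ᵥ z = μ • z := by
    intro μ
    rw [← Matrix.spectrum_toLin', ← Module.End.hasEigenvalue_iff_mem_spectrum]
    constructor
    · intro hμ
      obtain ⟨z, hz⟩ := hμ.exists_hasEigenvector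
      refine ⟨z, hz.2, ?_⟩
      have := hz.apply_eq_smul
      rwa [Matrix.toLin'_apply] at this
    · rintro ⟨z, hz0, hz⟩
      refine Module.End.hasEigenvalue_of_hasEigenvector (x := z) ⟨?_, hz0⟩
      rw [Module.End.mem_eigenspace_iff, Matrix.toLin'_apply, hz]
  have heq : spectralRadius ℂ (N.map (Nat.cast : ℕ → ℂ)) = ENNReal.ofReal r := by
    refine le_antisymm (iSup₂_le fun μ hμ => ?_) ?_
    · obtain ⟨z, hz0, hz⟩ := (hspec μ).1 hμ
      -- At a vertex where `|z| / x` is largest, the eigenvalue equation for `z` bounds `|μ|` by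
      -- `r`.
      obtain ⟨v0, hv0⟩ := Finite.exists_max fun v => ‖z v‖ / x v
      have hzx : ∀ w, ‖z w‖ ≤ ‖z v0‖ / x v0 * x w := fun w => (div_le_iff₀ (hx w)).1 (hv0 w)
      have hpos : 0 < ‖z v0‖ := by
        obtain ⟨w, hw⟩ := Function.ne_iff.1 hz0
        have h1 : 0 < ‖z w‖ := norm_pos_iff.2 hw
        have h2 := (mul_pos_iff_of_pos_right (hx w)).1 (h1.trans_le (hzx w))
        exact (div_pos_iff_of_pos_right (hx v0)).1 h2
      have hle : ‖μ‖ * ‖z v0‖ ≤ r * ‖z v0‖ := by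
        calc ‖μ‖ * ‖z v0‖ = ‖∑ w, (N v0 w : ℂ) * z w‖ := by
              rw [← norm_mul]
              exact congrArg norm (congrFun hz v0).symm
          _ ≤ ∑ w, (N v0 w : ℝ) * ‖z w‖ := by
              refine (norm_sum_le _ _).trans (Finset.sum_le_sum fun w _ => ?_)
              rw [norm_mul, Complex.norm_natCast]
          _ ≤ ∑ w, (N v0 w : ℝ) * (‖z v0‖ / x v0 * x w) := by
              gcongr with w
              exact hzx w
          _ = ‖z v0‖ / x v0 * ∑ w, (N v0 w : ℝ) * x w := by
              rw [Finset.mul_sum]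
              exact Finset.sum_congr rfl fun w _ => by ring
          _ = r * ‖z v0‖ := by
              rw [hrow]
              field_simp [(hx v0).ne']
      have hμr := le_of_mul_le_mul_right hle hpos
      rw [← enorm_eq_nnnorm, ← ofReal_norm]
      exact ENNReal.ofReal_le_ofReal hμr
    · have hmem : (r : ℂ) ∈ spectrum ℂ (N.map (Nat.cast : ℕ → ℂ)) := by
        refine (hspec _).2 ⟨fun v => (x v : ℂ), ?_, ?_⟩
        · obtain ⟨v⟩ := ‹Nonempty V›
          exact Function.ne_iff.2 ⟨v, Complex.ofReal_ne_zero.2 (hx v).ne'⟩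
        · funext v
          have := congrArg (fun t : ℝ => (t : ℂ)) (hrow v)
          simpa [mulVec, dotProduct] using this
      have h1 : ENNReal.ofReal r = (‖(r : ℂ)‖₊ : ℝ≥0∞) := by
        rw [← enorm_eq_nnnorm, ← ofReal_norm, Complex.norm_real, Real.norm_of_nonneg hr]
      rw [h1]
      exact le_iSup₂ (f := fun (k : ℂ) (_ : k ∈ spectrum ℂ (N.map (Nat.cast : ℕ → ℂ))) =>
        (‖k‖₊ : ℝ≥0∞)) _ hmem
  rw [heq, ENNReal.toReal_ofReal hr]

end Matrix

end

/-! ### Unique factorization, path matrices and the Perron-Frobenius vector -/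

noncomputable section

namespace KGraph

variable {k : ℕ} {V : Type u} [SmallCategory V] (Λ : KGraph k V)

section Factorization

theorem factorization_unique {a b : V} {c c' : V} {ν : a ⟶ c} {μ : c ⟶ b} {ν' : a ⟶ c'}
    {μ' : c' ⟶ b} (h : ν ≫ μ = ν' ≫ μ') (hd : Λ.deg μ = Λ.deg μ') :
    (⟨c, ν, μ⟩ : Σ c : V, (a ⟶ c) × (c ⟶ b)) = ⟨c', ν', μ'⟩ := by
  have hd' : Λ.deg ν = Λ.deg ν' := by
    have := congrArg Λ.deg h
    rw [Λ.deg_comp, Λ.deg_comp, hd] at this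
    exact add_left_cancel this
  exact (Λ.factorization (ν ≫ μ) _ _ (Λ.deg_comp ν μ)).unique ⟨rfl, rfl, rfl⟩
    ⟨hd.symm, hd'.symm, h.symm⟩

include Λ in
theorem cancel_right {a c b : V} {ν ν' : a ⟶ c} {μ : c ⟶ b} (h : ν ≫ μ = ν' ≫ μ) : ν = ν' := by
  have := Λ.factorization_unique h rfl
  simpa using this

theorem exists_factorization {a b : V} (l : a ⟶ b) {m : Fin k → ℕ} (h : m ≤ Λ.deg l) :
    ∃ (c : V) (ν : a ⟶ c) (μ : c ⟶ b), Λ.deg μ = m ∧ Λ.deg ν = Λ.deg l - m ∧ ν ≫ μ = l := by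
  obtain ⟨⟨c, ν, μ⟩, h, -⟩ := Λ.factorization l m (Λ.deg l - m) (add_tsub_cancel_of_le h).symm
  exact ⟨c, ν, μ, h⟩

theorem eq_id_of_deg_eq_zero {a b : V} (l : a ⟶ b) (h : Λ.deg l = 0) :
    ∃ h : a = b, l = eqToHom h := by
  -- Composing `l` with the identity on either side gives two factorizations into factors of degree
  -- `0`.
  have := Λ.factorization_unique (ν := l) (μ := 𝟙 b) (ν' := 𝟙 a) (μ' := l) (by simp)
    (by rw [h, Λ.deg_id])
  obtain ⟨rfl, h2⟩ := Sigma.mk.inj_iff.1 this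
  refine ⟨rfl, ?_⟩
  simp only [heq_eq_eq, Prod.mk.injEq] at h2
  exact h2.1

end Factorization

section PathMatrix

/-- The matrix that counts the paths of degree `d` between given vertices. -/
def pathMat (d : Fin k → ℕ) : Matrix V V ℕ := fun v w => Nat.card {l : w ⟶ v // Λ.deg l = d}

instance finite_hom_deg [Λ.IsFinite] (v w : V) (d : Fin k → ℕ) :
    Finite {l : w ⟶ v // Λ.deg l = d} := by
  have := IsFinite.finite (Λ := Λ) d
  refine Finite.of_injective (β := {l : Arrow V // Λ.deg l.hom = d})
    (fun l => ⟨Arrow.mk l.1, l.2⟩) fun l l' h => Subtype.ext ?_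
  have h' : Arrow.mk l.1 = Arrow.mk l'.1 := congrArg Subtype.val h
  exact Arrow.mk_injective _ _ h'

/-- Unique factorization of the paths of degree `m + n`. -/
def factorEquiv (v w : V) (m n : Fin k → ℕ) : {l : w ⟶ v // Λ.deg l = m + n} ≃
    Σ c : V, {μ : c ⟶ v // Λ.deg μ = m} × {ν : w ⟶ c // Λ.deg ν = n} :=
  (Equiv.ofBijective (fun p : Σ c : V, {μ : c ⟶ v // Λ.deg μ = m} × {ν : w ⟶ c // Λ.deg ν = n} =>
    (⟨p.2.2.1 ≫ p.2.1.1, by rw [Λ.deg_comp, p.2.1.2, p.2.2.2]⟩ : {l : w ⟶ v // Λ.deg l = m + n}))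
    ⟨by
      rintro ⟨c, ⟨μ, hμ⟩, ⟨ν, hν⟩⟩ ⟨c', ⟨μ', hμ'⟩, ⟨ν', hν'⟩⟩ h
      have h' : ν ≫ μ = ν' ≫ μ' := congrArg Subtype.val h
      have := Λ.factorization_unique h' (hμ.trans hμ'.symm)
      obtain ⟨rfl, h2⟩ := Sigma.mk.inj_iff.1 this
      simp only [heq_eq_eq, Prod.mk.injEq] at h2
      obtain ⟨rfl, rfl⟩ := h2
      rfl, by
      rintro ⟨l, hl⟩
      obtain ⟨⟨c, ν, μ⟩, ⟨h1, h2, h3⟩, -⟩ := Λ.factorization l m n hl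
      exact ⟨⟨c, ⟨μ, h1⟩, ⟨ν, h2⟩⟩, Subtype.ext h3⟩⟩).symm

variable [Fintype V] [DecidableEq V]

omit [DecidableEq V] in
-- Unique factorization turns counting into matrix multiplication. As degrees add commutatively, all
-- path matrices commute.
theorem pathMat_add [Λ.IsFinite] (m n : Fin k → ℕ) :
    Λ.pathMat (m + n) = Λ.pathMat m * Λ.pathMat n := by
  ext v w
  rw [Matrix.mul_apply, pathMat, Nat.card_congr (Λ.factorEquiv v w m n), Nat.card_sigma]
  exact Finset.sum_congr rfl fun c _ => Nat.card_prod _ _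

omit [Fintype V] in
theorem pathMat_zero : Λ.pathMat 0 = 1 := by
  ext v w
  rw [pathMat, Matrix.one_apply]
  split_ifs with h
  · subst h
    rw [Nat.card_eq_one_iff_unique]
    refine ⟨⟨fun l l' => Subtype.ext ?_⟩, ⟨⟨𝟙 v, Λ.deg_id v⟩⟩⟩
    obtain ⟨_, h1⟩ := Λ.eq_id_of_deg_eq_zero l.1 l.2
    obtain ⟨_, h2⟩ := Λ.eq_id_of_deg_eq_zero l'.1 l'.2
    rw [h1, h2]
  · rw [Nat.card_eq_zero]
    exact Or.inl ⟨fun l => h (Λ.eq_id_of_deg_eq_zero l.1 l.2).1.symm⟩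

theorem prod_map_pathMat [Λ.IsFinite] (L : List (Fin k → ℕ)) :
    (L.map Λ.pathMat).prod = Λ.pathMat L.sum := by
  induction L with
  | nil => exact Λ.pathMat_zero.symm
  | cons d L ih => rw [List.map_cons, List.prod_cons, ih, List.sum_cons, pathMat_add]

theorem adjProd_eq [Λ.IsFinite] : Λ.adjProd = Λ.pathMat 1 := by
  have h1 : List.ofFn Λ.adj = (List.ofFn fun i : Fin k => (Pi.single i 1 : Fin k → ℕ)).map
      Λ.pathMat := by
    rw [List.map_ofFn]
    rfl
  rw [adjProd, h1, prod_map_pathMat, List.sum_ofFn]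
  congr 1
  exact Finset.univ_sum_single (1 : Fin k → ℕ)

/-- The path matrix with real entries. -/
def pathMatR (d : Fin k → ℕ) : Matrix V V ℝ := (Λ.pathMat d).map (Nat.cast : ℕ → ℝ)

omit [DecidableEq V] in
theorem pathMatR_add [Λ.IsFinite] (m n : Fin k → ℕ) :
    Λ.pathMatR (m + n) = Λ.pathMatR m * Λ.pathMatR n := by
  rw [pathMatR, pathMat_add]
  exact Matrix.map_mul (f := Nat.castRingHom ℝ)

omit [Fintype V] in
theorem pathMatR_zero : Λ.pathMatR 0 = 1 := by
  rw [pathMatR, pathMat_zero]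
  exact Matrix.map_one _ Nat.cast_zero Nat.cast_one

omit [Fintype V] [DecidableEq V] in
theorem pathMatR_nonneg (d : Fin k → ℕ) (v w : V) : 0 ≤ Λ.pathMatR d v w := Nat.cast_nonneg _

/-- `ρ(Λ)^d`. -/
def rhoPow (d : Fin k → ℕ) : ℝ := ∏ i, Λ.rho i ^ d i

theorem rhoPow_add (m n : Fin k → ℕ) : Λ.rhoPow (m + n) = Λ.rhoPow m * Λ.rhoPow n := by
  simp only [rhoPow, Pi.add_apply, pow_add, Finset.prod_mul_distrib]

theorem rhoPow_zero : Λ.rhoPow 0 = 1 := by simp [rhoPow]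

theorem rhoPow_single (i : Fin k) : Λ.rhoPow (Pi.single i 1) = Λ.rho i := by
  rw [rhoPow, Finset.prod_eq_single i]
  · simp
  · intro j _ hj
    simp [Pi.single_eq_of_ne hj]
  · simp

theorem rhoPow_nsmul (n : ℕ) (d : Fin k → ℕ) : Λ.rhoPow (n • d) = Λ.rhoPow d ^ n := by
  induction n with
  | zero => rw [zero_smul, rhoPow_zero, pow_zero]
  | succ n ih => rw [add_smul, one_smul, rhoPow_add, ih, pow_succ]

variable {Λ}

theorem degree_induction {p : (Fin k → ℕ) → Prop} (h0 : p 0)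
    (h1 : ∀ d i, p d → p (d + Pi.single i 1)) (d : Fin k → ℕ) : p d := by
  induction hn : ∑ i, d i generalizing d with
  | zero =>
    have : d = 0 := funext fun i => (Finset.sum_eq_zero_iff.1 hn) i (Finset.mem_univ i)
    rwa [this]
  | succ n ih =>
    obtain ⟨i, -, hi⟩ : ∃ i ∈ Finset.univ, d i ≠ 0 := by
      by_contra! h
      rw [Finset.sum_eq_zero h] at hn
      omega
    have hle : Pi.single i 1 ≤ d := by
      intro j
      rcases eq_or_ne j i with rfl | hj
      · simpa using Nat.one_le_iff_ne_zero.2 hi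
      · simp [Pi.single_eq_of_ne hj]
    rw [← tsub_add_cancel_of_le hle]
    refine h1 _ _ (ih _ ?_)
    have h2 : ∑ j, d j = ∑ j, (d - (Pi.single i 1 : Fin k → ℕ)) j + ∑ j, (Pi.single i 1 : Fin k → ℕ) j := by
      rw [← Finset.sum_add_distrib]
      exact Finset.sum_congr rfl fun j _ => by
        rw [← Pi.add_apply, tsub_add_cancel_of_le hle]
    rw [Finset.sum_pi_single' i 1 Finset.univ] at h2
    simp only [Finset.mem_univ, if_true] at h2
    omega

theorem IsPerronFrobenius.pathMatR_mulVec [Λ.IsFinite] {x : V → ℝ} (hx : Λ.IsPerronFrobenius x)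
    (d : Fin k → ℕ) : (Λ.pathMatR d).mulVec x = Λ.rhoPow d • x := by
  induction d using degree_induction with
  | h0 => rw [pathMatR_zero, rhoPow_zero, Matrix.one_mulVec, one_smul]
  | h1 d i ih =>
    have h : (Λ.pathMatR (Pi.single i 1)).mulVec x = Λ.rho i • x := hx.2.2 i
    rw [pathMatR_add, ← Matrix.mulVec_mulVec, h, Matrix.mulVec_smul, ih, rhoPow_add, rhoPow_single,
      smul_smul, mul_comm]

section PerronFrobenius

variable [Nonempty V] [Λ.IsFinite] (hirr : (Λ.adjProd.map (Nat.cast : ℕ → ℝ)).IsIrreducible)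

include hirr

omit [Nonempty V] in
theorem pathMatR_one_irreducible : (Λ.pathMatR 1).IsIrreducible := by
  rwa [pathMatR, ← adjProd_eq]

/-- Each `A_i` commutes with `A`, so it preserves the one-dimensional eigenspace of `A` spanned by
the positive vector `x`. Thus `x` is an eigenvector of `A_i`, and positivity makes its eigenvalue
the spectral radius. -/
theorem isPerronFrobenius_pfVector : Λ.IsPerronFrobenius Λ.pfVector := by
  have hex : ∃ x, Λ.IsPerronFrobenius x := by
    have hA := pathMatR_one_irreducible hirr
    obtain ⟨x, r, hx, hx1, hAx⟩ := hA.exists_perron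
    refine ⟨x, hx, hx1, fun i => ?_⟩
    have hcomm : (Λ.pathMatR 1).mulVec ((Λ.pathMatR (Pi.single i 1)).mulVec x) =
        r • (Λ.pathMatR (Pi.single i 1)).mulVec x := by
      rw [Matrix.mulVec_mulVec, ← pathMatR_add, add_comm, pathMatR_add, ← Matrix.mulVec_mulVec,
        hAx, Matrix.mulVec_smul]
    obtain ⟨c, hc⟩ := hA.eq_smul_of_eigen hx hAx hcomm
    have hc' : ((Λ.adj i).map (Nat.cast : ℕ → ℝ)).mulVec x = c • x := hc
    rw [rho, Matrix.spectralRadius_eq_of_pos_eigenvector hx hc', hc']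
  rw [pfVector, dif_pos hex]
  exact hex.choose_spec

theorem IsPerronFrobenius.unique {x y : V → ℝ} (hx : Λ.IsPerronFrobenius x)
    (hy : Λ.IsPerronFrobenius y) : x = y := by
  obtain ⟨c, hc⟩ := (pathMatR_one_irreducible hirr).eq_smul_of_eigen hy.1
    (hy.pathMatR_mulVec 1) (hx.pathMatR_mulVec 1)
  have := hx.2.1
  rw [hc] at this
  simp only [Pi.smul_apply, smul_eq_mul, ← Finset.mul_sum, hy.2.1, mul_one] at this
  rw [hc, this, one_smul]

omit [Nonempty V] in
-- An irreducible `A` has no zero row. Since `A` is `A_i` times another path matrix, no `A_i` has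
-- one either, and a path of any degree is built edge by edge.
theorem exists_pathMatR_pos (d : Fin k → ℕ) (v : V) : ∃ w, 0 < Λ.pathMatR d v w := by
  have h1 : ∀ v, ∃ w, 0 < Λ.pathMatR 1 v w := by
    intro v
    have hA := pathMatR_one_irreducible hirr
    obtain ⟨n, hn, hpos⟩ := (Matrix.isIrreducible_iff_exists_pow_pos hA.nonneg).1 hA v v
    obtain ⟨n, rfl⟩ := Nat.exists_eq_succ_of_ne_zero hn.ne'
    by_contra! h
    rw [pow_succ', Matrix.mul_apply] at hpos
    refine hpos.ne' (Finset.sum_eq_zero fun w _ => ?_)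
    rw [le_antisymm (h w) (hA.nonneg v w), zero_mul]
  induction d using degree_induction generalizing v with
  | h0 => exact ⟨v, by rw [pathMatR_zero, Matrix.one_apply_eq]; exact one_pos⟩
  | h1 d i ih =>
    obtain ⟨w, hw⟩ := ih v
    have hle : (Pi.single i 1 : Fin k → ℕ) ≤ 1 := by
      intro j
      rcases eq_or_ne j i with rfl | hj
      · simp
      · simp [Pi.single_eq_of_ne hj]
    obtain ⟨u, hu⟩ := h1 w
    rw [← add_tsub_cancel_of_le hle, pathMatR_add, Matrix.mul_apply] at hu
    obtain ⟨z, hz⟩ : ∃ z, Λ.pathMatR (Pi.single i 1) w z ≠ 0 := by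
      by_contra! h
      rw [Finset.sum_eq_zero fun z _ => by rw [h z, zero_mul]] at hu
      exact lt_irrefl _ hu
    refine ⟨z, ?_⟩
    rw [pathMatR_add, Matrix.mul_apply]
    exact Finset.sum_pos' (fun u _ => mul_nonneg (pathMatR_nonneg _ _ _ _) (pathMatR_nonneg _ _ _ _))
      ⟨w, Finset.mem_univ _, mul_pos hw (lt_of_le_of_ne (pathMatR_nonneg _ _ _ _) hz.symm)⟩

omit [Nonempty V] in
theorem exists_hom_deg (d : Fin k → ℕ) (v : V) : ∃ (w : V) (l : w ⟶ v), Λ.deg l = d := by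
  obtain ⟨w, hw⟩ := exists_pathMatR_pos hirr d v
  have h : Λ.pathMat d v w ≠ 0 := fun h => by
    rw [pathMatR, Matrix.map_apply, h, Nat.cast_zero] at hw
    exact lt_irrefl _ hw
  obtain ⟨⟨l, hl⟩⟩ := (Nat.card_ne_zero.1 h).1
  exact ⟨w, l, hl⟩

/-- At a vertex `v` where `x` is smallest, some entry of row `v` is at least `1`, so the eigenvector
equation gives `ρ^d x_v ≥ x_v`. -/
theorem one_le_rhoPow (d : Fin k → ℕ) : 1 ≤ Λ.rhoPow d := by
  have hx := isPerronFrobenius_pfVector hirr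
  obtain ⟨v, hv⟩ := Finite.exists_min Λ.pfVector
  obtain ⟨w, hw⟩ := exists_pathMatR_pos hirr d v
  have h1 : (1 : ℝ) ≤ Λ.pathMatR d v w := by
    rw [pathMatR, Matrix.map_apply] at hw ⊢
    exact_mod_cast Nat.one_le_iff_ne_zero.2 (fun h => by rw [h, Nat.cast_zero] at hw; exact lt_irrefl _ hw)
  have h2 : Λ.rhoPow d * Λ.pfVector v = ∑ u, Λ.pathMatR d v u * Λ.pfVector u :=
    (congrFun (hx.pathMatR_mulVec d) v).symm
  refine le_of_mul_le_mul_right ?_ (hx.1 v)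
  rw [h2, one_mul]
  calc Λ.pfVector v ≤ Λ.pfVector w := hv w
    _ ≤ Λ.pathMatR d v w * Λ.pfVector w := le_mul_of_one_le_left (hx.1 w).le h1
    _ ≤ _ := Finset.single_le_sum (f := fun u => Λ.pathMatR d v u * Λ.pfVector u)
        (fun u _ => mul_nonneg (pathMatR_nonneg _ _ _ _) (hx.1 u).le) (Finset.mem_univ w)

theorem rhoPow_pos (d : Fin k → ℕ) : 0 < Λ.rhoPow d := zero_lt_one.trans_le (one_le_rhoPow hirr d)

end PerronFrobenius

end PathMatrix

end KGraph

end

/-! ### Infinite paths of `Λ` and of its Bratteli diagram -/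

noncomputable section

namespace KGraph

variable {k : ℕ} {V : Type u} [SmallCategory V] (Λ : KGraph k V)

section Chains

theorem deg_eqToHom {a b : V} (h : a = b) : Λ.deg (eqToHom h) = 0 := by
  subst h
  exact Λ.deg_id a

/-- Equality of arrows includes the endpoints and so avoids transport along equalities of vertices.
-/
theorem arrow_factorization_unique {a c b a' c' b' : V} {ν : a ⟶ c} {μ : c ⟶ b} {ν' : a' ⟶ c'}
    {μ' : c' ⟶ b'} (h : Arrow.mk (ν ≫ μ) = Arrow.mk (ν' ≫ μ')) (hd : Λ.deg μ = Λ.deg μ') :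
    Arrow.mk ν = Arrow.mk ν' ∧ Arrow.mk μ = Arrow.mk μ' := by
  obtain rfl : a = a' := congrArg Arrow.leftFunc.obj h
  obtain rfl : b = b' := congrArg Arrow.rightFunc.obj h
  have := Λ.factorization_unique (Arrow.mk_injective _ _ h) hd
  exact ⟨congrArg (fun p : Σ c : V, (a ⟶ c) × (c ⟶ b) => Arrow.mk p.2.1) this,
    congrArg (fun p : Σ c : V, (a ⟶ c) × (c ⟶ b) => Arrow.mk p.2.2) this⟩

theorem arrow_comp_congr {a c b a' c' b' : V} {ν : a ⟶ c} {μ : c ⟶ b} {ν' : a' ⟶ c'}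
    {μ' : c' ⟶ b'} (h : Arrow.mk ν = Arrow.mk ν') (h' : Arrow.mk μ = Arrow.mk μ') :
    Arrow.mk (ν ≫ μ) = Arrow.mk (ν' ≫ μ') := by
  obtain rfl : a = a' := congrArg Arrow.leftFunc.obj h
  obtain rfl : c = c' := congrArg Arrow.rightFunc.obj h
  obtain rfl : b = b' := congrArg Arrow.rightFunc.obj h'
  rw [Arrow.mk_injective _ _ h, Arrow.mk_injective _ _ h']

theorem arrow_comp_eqToHom {a b c : V} (f : a ⟶ b) (h : b = c) :
    Arrow.mk (f ≫ eqToHom h) = Arrow.mk f := by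
  subst h
  rw [eqToHom_refl, Category.comp_id]

include Λ in
-- An object of `Over v` is a path with range `v`, and a morphism `O ⟶ O'` exhibits `O'` as an
-- initial segment of `O`. By cancellation this category is a preorder, which makes identities
-- between its morphisms automatic.
theorem over_hom_subsingleton {v : V} (O O' : Over v) : Subsingleton (O ⟶ O') :=
  ⟨fun f g => Over.OverMorphism.ext (Λ.cancel_right ((Over.w f).trans (Over.w g).symm))⟩

include Λ in
theorem over_arrow_eq {v : V} {O O' P P' : Over v} (h : O = P) (h' : O' = P') (f : O ⟶ O')
    (g : P ⟶ P') : Arrow.mk f.left = Arrow.mk g.left := by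
  subst h h'
  have := Λ.over_hom_subsingleton O O'
  rw [Subsingleton.elim f g]

theorem deg_over_hom {v : V} {O O' : Over v} (f : O ⟶ O') :
    Λ.deg O.hom = Λ.deg O'.hom + Λ.deg f.left := by
  rw [← Λ.deg_comp, Over.w]

/-- For each degree `p`, a long enough `P n` has exactly one initial segment of degree `p`, and it
does not depend on `n`. These segments and the unique morphisms between them form the functor, whose
laws hold because `Over v` is thin. -/
theorem exists_infPath_of_chain {v : V} (P : ℕ → Over v) (step : ∀ n, P (n + 1) ⟶ P n)
    (hcof : ∀ p : Fin k → ℕ, ∃ n, p ≤ Λ.deg (P n).hom) :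
    ∃ x : Λ.InfPath,
      (∀ (n : ℕ) (p : Fin k → ℕ), Λ.deg (P n).hom = p →
        x.seg (zero_le : 0 ≤ p) = Arrow.mk (P n).hom) ∧
      ∀ (n : ℕ) (p q : Fin k → ℕ) (h : p ≤ q), Λ.deg (P n).hom = p → Λ.deg (P (n + 1)).hom = q →
        x.seg h = Arrow.mk (step n).left := by
  have reach : ∀ m n, m ≤ n → Nonempty (P n ⟶ P m) := by
    intro m n h
    induction n, h using Nat.le_induction with
    | base => exact ⟨𝟙 _⟩
    | succ n _ ih => exact ⟨step n ≫ ih.some⟩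
  let IsInit : (Fin k → ℕ) → Over v → Prop := fun p O =>
    Λ.deg O.hom = p ∧ ∃ n, Nonempty (P n ⟶ O)
  -- Both are initial segments of a common later member of the chain, where unique factorization
  -- applies.
  have uniq : ∀ {p O O'}, IsInit p O → IsInit p O' → O = O' := by
    rintro p O O' ⟨h1, n, ⟨f⟩⟩ ⟨h1', n', ⟨f'⟩⟩
    obtain ⟨g⟩ := reach n (max n n') (le_max_left _ _)
    obtain ⟨g'⟩ := reach n' (max n n') (le_max_right _ _)
    have := Λ.factorization_unique ((Over.w (g ≫ f)).trans (Over.w (g' ≫ f')).symm)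
      (h1.trans h1'.symm)
    exact congrArg (fun p : Σ c : V, ((P (max n n')).left ⟶ c) × (c ⟶ v) => Over.mk p.2.2) this
  have sub : ∀ {m O}, m ≤ Λ.deg O.hom → (∃ n, Nonempty (P n ⟶ O)) →
      ∃ O', IsInit m O' ∧ Nonempty (O ⟶ O') := by
    rintro m O hm ⟨n, ⟨f⟩⟩
    obtain ⟨c, ν, μ, h1, -, h3⟩ := Λ.exists_factorization O.hom hm
    exact ⟨Over.mk μ, ⟨h1, n, ⟨f ≫ Over.homMk ν h3⟩⟩, ⟨Over.homMk ν h3⟩⟩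
  have ex : ∀ p, ∃ O, IsInit p O := by
    intro p
    obtain ⟨n, hn⟩ := hcof p
    obtain ⟨O, hO, -⟩ := sub hn ⟨n, ⟨𝟙 _⟩⟩
    exact ⟨O, hO⟩
  choose I hI using ex
  have hom : ∀ {m n}, m ≤ n → Nonempty (I n ⟶ I m) := by
    intro m n h
    obtain ⟨O, hO, hf⟩ := sub (h.trans_eq (hI n).1.symm) (hI n).2
    rwa [uniq hO (hI m)] at hf
  have hss := Λ.over_hom_subsingleton (v := v)
  let x : Λ.InfPath :=
    { obj := fun p => (I p).left
      map := fun h => (hom h).some.left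
      map_refl := fun m => by
        rw [Subsingleton.elim (hom (le_refl m)).some (𝟙 _)]
        rfl
      map_trans := fun h h' => by
        rw [Subsingleton.elim (hom (h.trans h')).some ((hom h').some ≫ (hom h).some)]
        rfl
      deg_map := fun {m n} h => by
        have := Λ.deg_over_hom (hom h).some
        rw [(hI n).1, (hI m).1] at this
        exact eq_tsub_of_add_eq (by rw [add_comm]; exact this.symm) }
  have hP : ∀ n p, Λ.deg (P n).hom = p → I p = P n := fun n p h =>
    uniq (hI p) ⟨h, n, ⟨𝟙 _⟩⟩
  have h0 : I 0 = Over.mk (𝟙 v) :=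
    uniq (hI 0) ⟨Λ.deg_id v, 0, ⟨Over.homMk (P 0).hom (Category.comp_id _)⟩⟩
  refine ⟨x, fun n p h => ?_, fun n p q h hp hq => ?_⟩
  · exact Λ.over_arrow_eq (hP n p h) h0 (hom zero_le).some
      (Over.homMk (P n).hom (Category.comp_id _))
  · exact Λ.over_arrow_eq (hP (n + 1) q hq) (hP n p hp) (hom h).some (step n)

end Chains

section Segments

variable {Λ}

theorem InfPath.seg_eq_of_le {x y : Λ.InfPath} {m n : Fin k → ℕ} (h : m ≤ n)
    (hxy : x.seg (zero_le : 0 ≤ n) = y.seg (zero_le : 0 ≤ n)) :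
    x.seg h = y.seg h ∧ x.seg (zero_le : 0 ≤ m) = y.seg (zero_le : 0 ≤ m) := by
  have hx := x.map_trans (zero_le : 0 ≤ m) h
  have hy := y.map_trans (zero_le : 0 ≤ m) h
  refine Λ.arrow_factorization_unique (ν := x.map h) (ν' := y.map h)
    (μ := x.map (zero_le : 0 ≤ m)) (μ' := y.map (zero_le : 0 ≤ m)) ?_ ?_
  · rw [← hx, ← hy]
    exact hxy
  · rw [x.deg_map, y.deg_map]

theorem InfPath.seg_eq_of_seg_eq {x y : Λ.InfPath} {m n : Fin k → ℕ} (h : m ≤ n)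
    (h1 : x.seg (zero_le : 0 ≤ m) = y.seg (zero_le : 0 ≤ m)) (h2 : x.seg h = y.seg h) :
    x.seg (zero_le : 0 ≤ n) = y.seg (zero_le : 0 ≤ n) := by
  have hx := x.map_trans (zero_le : 0 ≤ m) h
  have hy := y.map_trans (zero_le : 0 ≤ m) h
  have := arrow_comp_congr h2 h1
  rw [← hx, ← hy] at this
  exact this

theorem InfPath.eq_of_forall_seg_eq {x y : Λ.InfPath}
    (h : ∀ p : Fin k → ℕ, x.seg (zero_le : 0 ≤ p) = y.seg (zero_le : 0 ≤ p)) : x = y := by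
  have h' : ∀ {m n : Fin k → ℕ} (hmn : m ≤ n), x.seg hmn = y.seg hmn := fun hmn =>
    (InfPath.seg_eq_of_le hmn (h _)).1
  have hobj : x.obj = y.obj := funext fun p => congrArg Arrow.leftFunc.obj (h p)
  cases x with
  | mk obj map _ _ _ =>
    cases y with
    | mk obj' map' _ _ _ =>
      obtain rfl : obj = obj' := hobj
      have : @map = @map' := by
        funext m n hmn
        exact Arrow.mk_injective _ _ (h' hmn)
      subst this
      rfl

theorem mem_cylinder_iff {l : Arrow V} {d : Fin k → ℕ} (hd : Λ.deg l.hom = d) {x : Λ.InfPath} :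
    x ∈ Λ.cylinder l ↔ x.seg (zero_le : 0 ≤ d) = l := by
  subst hd
  rfl

theorem InfPath.mem_cylinder_seg {x y : Λ.InfPath} {d : Fin k → ℕ} :
    y ∈ Λ.cylinder (x.seg (zero_le : 0 ≤ d)) ↔
      y.seg (zero_le : 0 ≤ d) = x.seg (zero_le : 0 ≤ d) :=
  mem_cylinder_iff ((x.deg_map _).trans (tsub_zero d))

theorem isOpen_cylinder (l : Arrow V) : IsOpen (Λ.cylinder l) :=
  TopologicalSpace.isOpen_generateFrom_of_mem ⟨l, rfl⟩

end Segments

section LevelDeg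

variable (k) [NeZero k]

theorem levelDeg_zero : levelDeg k 0 = 0 := Finset.sum_range_zero _

theorem levelDeg_mono : Monotone (levelDeg k) := monotone_nat_of_le_succ levelDeg_le

theorem color_add (n : ℕ) : color k (k + n) = color k n := by
  simp [color, Fin.ofNat]

theorem color_val (i : Fin k) : color k i = i := by
  simp [color, Fin.ofNat, Nat.mod_eq_of_lt i.2]

theorem levelDeg_self : levelDeg k k = 1 := by
  rw [levelDeg, Finset.sum_range]
  simp only [color_val]
  exact Finset.univ_sum_single (1 : Fin k → ℕ)

theorem levelDeg_add (n : ℕ) : levelDeg k (k + n) = 1 + levelDeg k n := by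
  rw [levelDeg, Finset.sum_range_add]
  simp only [color_add]
  congr 1
  exact levelDeg_self k

theorem levelDeg_mul_add (q n : ℕ) : levelDeg k (q * k + n) = q • 1 + levelDeg k n := by
  induction q with
  | zero => simp
  | succ q ih => rw [show (q + 1) * k + n = k + (q * k + n) by ring, levelDeg_add, ih, add_smul,
      one_smul, ← add_assoc, add_comm 1]

theorem exists_le_levelDeg (p : Fin k → ℕ) : ∃ n, p ≤ levelDeg k n := by
  -- After `q` periods every coordinate equals `q`, and the sum dominates each `p i`.
  refine ⟨(∑ i, p i) * k + 0, fun i => ?_⟩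
  rw [levelDeg_mul_add, levelDeg_zero, add_zero]
  simpa using Finset.single_le_sum (f := p) (fun _ _ => Nat.zero_le _) (Finset.mem_univ i)

end LevelDeg

section ToBratteli

variable {Λ} [NeZero k] [Finite V] [Λ.IsFinite]

/-- By unique factorization, the segment of degree `levelDeg k (n + 1)` carries the same information
as the previous segment together with the last edge. -/
theorem take_toBratteli_eq_iff {x y : Λ.InfPath} {n : ℕ} :
    (toBratteli x).take n = (toBratteli y).take n ↔
      x.seg (zero_le : 0 ≤ levelDeg k n) = y.seg (zero_le : 0 ≤ levelDeg k n) := by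
  have hedge : ∀ i, (toBratteli x).edge i = (toBratteli y).edge i ↔
      x.seg (levelDeg_le (k := k) i) = y.seg (levelDeg_le i) := fun i =>
    ⟨fun h => congrArg Subtype.val h, fun h => Subtype.ext h⟩
  have hr : (Λ.bratteli.r ((toBratteli x).edge 0) = Λ.bratteli.r ((toBratteli y).edge 0)) ↔
      x.obj 0 = y.obj 0 := by
    change x.obj (levelDeg k 0) = y.obj (levelDeg k 0) ↔ _
    rw [levelDeg_zero]
  rw [BratteliDiagram.InfPath.take_eq_iff]
  simp only [hedge]
  refine (and_congr_left fun _ => hr).trans ?_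
  induction n with
  | zero =>
    simp only [Nat.not_lt_zero, false_imp_iff, implies_true, and_true]
    rw [levelDeg_zero]
    refine ⟨fun h => ?_, fun h => congrArg Arrow.leftFunc.obj h⟩
    rw [InfPath.seg, InfPath.seg, x.map_refl, y.map_refl, h]
  | succ n ih =>
    constructor
    · rintro ⟨h0, h⟩
      exact InfPath.seg_eq_of_seg_eq (levelDeg_le n)
        (ih.1 ⟨h0, fun i hi => h i (hi.trans n.lt_succ_self)⟩) (h n n.lt_succ_self)
    · intro h
      obtain ⟨h1, h2⟩ := InfPath.seg_eq_of_le (levelDeg_le n) h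
      obtain ⟨h3, h4⟩ := ih.2 h2
      refine ⟨h3, fun i hi => ?_⟩
      rcases Nat.lt_succ_iff_lt_or_eq.1 hi with hi | rfl
      exacts [h4 i hi, h1]

theorem toBratteli_injective : Function.Injective (toBratteli (Λ := Λ)) := by
  intro x y h
  refine InfPath.eq_of_forall_seg_eq fun p => ?_
  obtain ⟨n, hn⟩ := exists_le_levelDeg k p
  exact (InfPath.seg_eq_of_le hn (take_toBratteli_eq_iff.1 (congrArg (·.take n) h))).2

theorem toBratteli_surjective : Function.Surjective (toBratteli (Λ := Λ)) := by
  intro b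
  let v : V := (b.edge 0).1.right
  -- The product of the first `n` edges of `b`. The recorded equality of vertices allows the next
  -- edge to be composed with it.
  let Q : ∀ n, {P : Over v // P.left = (b.edge n).1.right} := fun n =>
    Nat.rec (motive := fun n => {P : Over v // P.left = (b.edge n).1.right}) ⟨Over.mk (𝟙 v), rfl⟩
      (fun n P => ⟨Over.mk ((b.edge n).1.hom ≫ eqToHom P.2.symm ≫ P.1.hom), b.comp n⟩) n
  have hQ : ∀ n, (Q (n + 1)).1 =
    Over.mk ((b.edge n).1.hom ≫ eqToHom (Q n).2.symm ≫ (Q n).1.hom) := fun n => rfl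
  have hdeg : ∀ n, Λ.deg (Q n).1.hom = levelDeg k n := by
    intro n
    induction n with
    | zero => exact (Λ.deg_id v).trans (levelDeg_zero k).symm
    | succ n ih =>
      have h1 : Λ.deg (b.edge n).1.hom = Pi.single (color k n) 1 := (b.edge n).2
      rw [levelDeg_succ, ← ih]
      refine (Λ.deg_comp _ _).trans ?_
      rw [Λ.deg_comp, deg_eqToHom, add_zero]
      exact congrArg _ h1
  let step : ∀ n, (Q (n + 1)).1 ⟶ (Q n).1 := fun n =>
    Over.homMk (U := (Q (n + 1)).1) (V := (Q n).1) ((b.edge n).1.hom ≫ eqToHom (Q n).2.symm)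
      (Category.assoc _ _ _)
  obtain ⟨x, -, hx⟩ := Λ.exists_infPath_of_chain (fun n => (Q n).1) step fun p => by
    obtain ⟨n, hn⟩ := exists_le_levelDeg k p
    exact ⟨n, hn.trans_eq (hdeg n).symm⟩
  refine ⟨x, BratteliDiagram.InfPath.ext (funext fun n => Subtype.ext ?_)⟩
  refine (hx n _ _ (levelDeg_le n) (hdeg n) (hdeg (n + 1))).trans ?_
  exact arrow_comp_eqToHom _ _

theorem toBratteli_mem_cylinder_iff {x y : Λ.InfPath} {n : ℕ} :
    toBratteli y ∈ BratteliDiagram.cylinder ((toBratteli x).take n) ↔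
      y ∈ Λ.cylinder (x.seg (zero_le : 0 ≤ levelDeg k n)) := by
  rw [InfPath.mem_cylinder_seg]
  exact take_toBratteli_eq_iff

theorem continuous_toBratteli : Continuous (toBratteli (Λ := Λ)) := by
  refine continuous_generateFrom_iff.2 ?_
  rintro _ ⟨γ, rfl⟩
  refine isOpen_iff_forall_mem_open.2 fun x hx => ?_
  obtain ⟨n, rfl⟩ : ∃ n, γ = (toBratteli x).take n := ⟨γ.len, hx.symm⟩
  exact ⟨_, fun y hy => toBratteli_mem_cylinder_iff.2 hy, isOpen_cylinder _,
    InfPath.mem_cylinder_seg.2 rfl⟩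

/-- The inverse is continuous because, by cofinality of the level degrees, every cylinder set of `Λ`
contains a level cylinder around each of its points. -/
theorem isHomeomorph_toBratteli : IsHomeomorph (toBratteli (Λ := Λ)) := by
  let e := Equiv.ofBijective _ ⟨toBratteli_injective (Λ := Λ), toBratteli_surjective⟩
  refine isHomeomorph_iff_exists_inverse.2
    ⟨continuous_toBratteli, e.symm, e.left_inv, e.right_inv, ?_⟩
  refine continuous_generateFrom_iff.2 ?_
  rintro _ ⟨l, rfl⟩
  refine isOpen_iff_forall_mem_open.2 fun b hb => ?_
  obtain ⟨x, rfl⟩ := e.surjective b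
  obtain ⟨n, hn⟩ := exists_le_levelDeg k (Λ.deg l.hom)
  refine ⟨BratteliDiagram.cylinder ((e x).take n), fun b' hb' => ?_,
    BratteliDiagram.isOpen_cylinder _, rfl⟩
  obtain ⟨y, rfl⟩ := e.surjective b'
  rw [Set.mem_preimage, e.symm_apply_apply] at hb ⊢
  have h1 := (InfPath.seg_eq_of_le hn (InfPath.mem_cylinder_seg.1
    (toBratteli_mem_cylinder_iff.1 hb'))).2
  exact h1.trans hb

end ToBratteli

end KGraph

end

/-! ### Counting extensions; the measures on the two path spaces -/

noncomputable section

namespace KGraph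

variable {k : ℕ} {V : Type u} [SmallCategory V] {Λ : KGraph k V}

section Counting

variable [Fintype V] [DecidableEq V] [Λ.IsFinite]

omit [DecidableEq V] in
theorem tsum_hom_deg (d : Fin k → ℕ) (v : V) (f : V → ℝ≥0∞) :
    ∑' p : Σ w : V, {b : w ⟶ v // Λ.deg b = d}, f p.1 =
      ∑ w, (Λ.pathMat d v w : ℝ≥0∞) * f w := by
  rw [ENNReal.tsum_sigma' (f := fun p : Σ w : V, {b : w ⟶ v // Λ.deg b = d} => f p.1),
    tsum_fintype]
  refine Finset.sum_congr rfl fun w _ => ?_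
  have := Fintype.ofFinite {b : w ⟶ v // Λ.deg b = d}
  change ∑' _ : {b : w ⟶ v // Λ.deg b = d}, f w = _
  rw [tsum_fintype, Finset.sum_const, nsmul_eq_mul, Finset.card_univ, ← Nat.card_eq_fintype_card]
  rfl

omit [DecidableEq V] [Λ.IsFinite] in
theorem sum_pathMat_mul_ofReal (d : Fin k → ℕ) (v : V) {g : V → ℝ} (hg : ∀ v, 0 ≤ g v) :
    ∑ w, (Λ.pathMat d v w : ℝ≥0∞) * ENNReal.ofReal (g w) =
      ENNReal.ofReal ((Λ.pathMatR d).mulVec g v) := by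
  rw [Matrix.mulVec, dotProduct, ENNReal.ofReal_sum_of_nonneg fun w _ =>
    mul_nonneg (pathMatR_nonneg _ _ _ _) (hg w)]
  refine Finset.sum_congr rfl fun w _ => ?_
  rw [ENNReal.ofReal_mul (pathMatR_nonneg _ _ _ _), pathMatR, Matrix.map_apply,
    ENNReal.ofReal_natCast]

variable [Nonempty V] (hirr : (Λ.adjProd.map (Nat.cast : ℕ → ℝ)).IsIrreducible)

include hirr

omit [Nonempty V] in
-- Prolonging `l` repeatedly by paths of degree `(1, …, 1)` gives a chain with cofinal degrees.
theorem nonempty_cylinder (l : Arrow V) : (Λ.cylinder l).Nonempty := by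
  choose src ext hext using exists_hom_deg hirr 1
  let P : ℕ → Over l.right := fun n => Nat.rec (motive := fun _ => Over l.right) (Over.mk l.hom)
    (fun _ O => Over.mk (ext O.left ≫ O.hom)) n
  have hP : ∀ n, P (n + 1) = Over.mk (ext (P n).left ≫ (P n).hom) := fun n => rfl
  have hdeg : ∀ n, Λ.deg (P n).hom = Λ.deg l.hom + n • 1 := by
    intro n
    induction n with
    | zero =>
      rw [zero_smul, add_zero]
      rfl
    | succ n ih =>
      refine (Λ.deg_comp _ _).trans ?_
      rw [ih, hext, add_smul, one_smul, add_assoc]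
  obtain ⟨x, hx, -⟩ := Λ.exists_infPath_of_chain P
    (fun n => Over.homMk (U := P (n + 1)) (V := P n) (ext (P n).left) rfl) fun p => by
      refine ⟨∑ i, p i, fun i => ?_⟩
      rw [hdeg]
      have := Finset.single_le_sum (f := p) (fun _ _ => Nat.zero_le _) (Finset.mem_univ i)
      simp only [Pi.add_apply, Pi.smul_apply, Pi.one_apply, smul_eq_mul, mul_one]
      omega
  exact ⟨x, hx 0 _ rfl⟩

variable [NeZero k]

omit [Nonempty V] in
theorem noDeadEnds_bratteli : BratteliDiagram.NoDeadEnds Λ.bratteli := by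
  intro n v
  obtain ⟨w, l, hl⟩ := exists_hom_deg hirr (Pi.single (color k n) 1) v
  exact ⟨⟨Arrow.mk l, hl⟩, rfl⟩

omit [Nonempty V] in
/-- The paths of length `n` that extend a given path correspond to the morphisms of the
appropriate degree into its source. -/
theorem exists_equiv_extensions (x : Λ.InfPath) {m n : ℕ} (hmn : m ≤ n) :
    ∃ e : (Σ w : V, {b : w ⟶ x.obj (levelDeg k m) // Λ.deg b = levelDeg k n - levelDeg k m}) ≃
      {l : Λ.bratteli.FinPath // l.len = n ∧ ((toBratteli x).take m).IsSubpath l},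
      ∀ b, ((e b).1.source : V) = b.1 := by
  have hle := levelDeg_mono k hmn
  have hdeg : ∀ (w : V) (b : w ⟶ x.obj (levelDeg k m)), Λ.deg b = levelDeg k n - levelDeg k m →
      Λ.deg (b ≫ x.map (zero_le : 0 ≤ levelDeg k m)) = levelDeg k n := by
    intro w b hb
    rw [Λ.deg_comp, x.deg_map, hb, tsub_zero, add_tsub_cancel_of_le hle]
  -- Each prolongation is realized as an initial segment of an infinite path, so that truncation
  -- turns it into a Bratteli path.
  have hy : ∀ b : (Σ w : V,
      {b : w ⟶ x.obj (levelDeg k m) // Λ.deg b = levelDeg k n - levelDeg k m}),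
      ∃ y : Λ.InfPath, y.seg (zero_le : 0 ≤ levelDeg k n) =
        Arrow.mk (b.2.1 ≫ x.map (zero_le : 0 ≤ levelDeg k m)) := by
    rintro ⟨w, b, hb⟩
    obtain ⟨y, hy⟩ := nonempty_cylinder hirr
      (Arrow.mk (b ≫ x.map (zero_le : 0 ≤ levelDeg k m)))
    exact ⟨y, (mem_cylinder_iff (hdeg w b hb)).1 hy⟩
  choose y hy using hy
  have hsub : ∀ b, ((toBratteli x).take m).IsSubpath ((toBratteli (y b)).take n) := by
    intro b
    have h1 := hy b
    have h2 := (y b).map_trans (zero_le : 0 ≤ levelDeg k m) hle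
    have h3 : Arrow.mk ((y b).map hle ≫ (y b).map (zero_le : 0 ≤ levelDeg k m)) =
        Arrow.mk (b.2.1 ≫ x.map (zero_le : 0 ≤ levelDeg k m)) := by
      rw [← h2]
      exact h1
    have h4 := (Λ.arrow_factorization_unique h3 (by rw [(y b).deg_map, x.deg_map])).2
    rw [← take_toBratteli_eq_iff.2 h4]
    exact BratteliDiagram.InfPath.take_isSubpath_take _ hmn
  let Φ : (Σ w : V, {b : w ⟶ x.obj (levelDeg k m) // Λ.deg b = levelDeg k n - levelDeg k m}) →
      {l : Λ.bratteli.FinPath // l.len = n ∧ ((toBratteli x).take m).IsSubpath l} :=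
    fun b => ⟨(toBratteli (y b)).take n, rfl, hsub b⟩
  have hinj : Function.Injective Φ := by
    rintro b b' h
    have h1 := take_toBratteli_eq_iff.1 (congrArg Subtype.val h)
    rw [hy, hy] at h1
    have h2 := (Λ.arrow_factorization_unique h1 rfl).1
    obtain ⟨w, b, hb⟩ := b
    obtain ⟨w', b', hb'⟩ := b'
    obtain rfl : w = w' := congrArg Arrow.leftFunc.obj h2
    obtain rfl : b = b' := Arrow.mk_injective _ _ h2
    rfl
  have hsurj : Function.Surjective Φ := by
    rintro ⟨l, rfl, hl⟩
    obtain ⟨z, hz⟩ := (noDeadEnds_bratteli hirr).nonempty_cylinder l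
    obtain ⟨z, rfl⟩ := toBratteli_surjective z
    obtain ⟨n, rfl⟩ : ∃ n, l = (toBratteli z).take n := ⟨_, hz.symm⟩
    change levelDeg k m ≤ levelDeg k n at hle
    have h1 : z.seg (zero_le : 0 ≤ levelDeg k m) = x.seg (zero_le : 0 ≤ levelDeg k m) :=
      take_toBratteli_eq_iff.1 (hl.mem_cylinder hz)
    have hobj : z.obj (levelDeg k m) = x.obj (levelDeg k m) := congrArg Arrow.leftFunc.obj h1
    refine ⟨⟨z.obj (levelDeg k n), z.map hle ≫ eqToHom hobj, ?_⟩, Subtype.ext ?_⟩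
    · rw [Λ.deg_comp, deg_eqToHom, zero_add]
      exact z.deg_map hle
    · refine take_toBratteli_eq_iff.2 ((hy _).trans ?_)
      refine (arrow_comp_congr (arrow_comp_eqToHom (z.map hle) hobj) h1.symm).trans ?_
      rw [← z.map_trans]
      rfl
  refine ⟨Equiv.ofBijective Φ ⟨hinj, hsurj⟩, fun b => ?_⟩
  refine ((toBratteli (y b)).source_take n).trans ?_
  exact congrArg Arrow.leftFunc.obj (hy b)

omit [Nonempty V] in
theorem tsum_extensions (γ : Λ.bratteli.FinPath) {n : ℕ} (hn : γ.len ≤ n) (f : V → ℝ≥0∞) :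
    ∑' l : {l : Λ.bratteli.FinPath // l.len = n ∧ γ.IsSubpath l}, f l.1.source =
      ∑ w, (Λ.pathMat (levelDeg k n - levelDeg k γ.len) γ.source w : ℝ≥0∞) * f w := by
  obtain ⟨z, hz⟩ := (noDeadEnds_bratteli hirr).nonempty_cylinder γ
  obtain ⟨x, rfl⟩ := toBratteli_surjective z
  obtain ⟨m, rfl⟩ : ∃ m, γ = (toBratteli x).take m := ⟨_, hz.symm⟩
  obtain ⟨e, he⟩ := exists_equiv_extensions hirr x (show m ≤ n from hn)
  rw [← e.tsum_eq]
  simp only [he]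
  have hs : ((toBratteli x).take m).source = x.obj (levelDeg k m) :=
    (toBratteli x).source_take m
  rw [hs]
  exact tsum_hom_deg _ _ f

omit [Nonempty V] in
theorem tsum_extensions_ofReal (γ : Λ.bratteli.FinPath) {n : ℕ} (hn : γ.len ≤ n) {g : V → ℝ}
    (hg : ∀ v, 0 ≤ g v) :
    ∑' l : {l : Λ.bratteli.FinPath // l.len = n ∧ γ.IsSubpath l}, ENNReal.ofReal (g l.1.source) =
      ENNReal.ofReal ((Λ.pathMatR (levelDeg k n - levelDeg k γ.len)).mulVec g γ.source) :=
  (tsum_extensions hirr γ hn fun v => ENNReal.ofReal (g v)).trans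
    (sum_pathMat_mul_ofReal _ _ hg)

omit [NeZero k] in
theorem rhoPow_tsub_div {m n : Fin k → ℕ} (h : m ≤ n) :
    (Λ.rhoPow n)⁻¹ * Λ.rhoPow (n - m) = (Λ.rhoPow m)⁻¹ := by
  have h1 := (rhoPow_pos hirr m).ne'
  have h2 := (rhoPow_pos hirr (n - m)).ne'
  rw [← add_tsub_cancel_of_le h, rhoPow_add, add_tsub_cancel_left]
  field_simp

omit [NeZero k] in
theorem mulVec_inv_rhoPow_smul {m n : Fin k → ℕ} (h : m ≤ n) (v : V) :
    (Λ.pathMatR (n - m)).mulVec ((Λ.rhoPow n)⁻¹ • Λ.pfVector) v =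
      (Λ.rhoPow m)⁻¹ * Λ.pfVector v := by
  rw [Matrix.mulVec_smul, (isPerronFrobenius_pfVector hirr).pathMatR_mulVec, smul_smul,
    rhoPow_tsub_div hirr h]
  rfl

omit [NeZero k] in
theorem inv_rhoPow_smul_nonneg (n : Fin k → ℕ) (v : V) :
    0 ≤ ((Λ.rhoPow n)⁻¹ • Λ.pfVector) v :=
  mul_nonneg (inv_nonneg.2 (rhoPow_pos hirr n).le) ((isPerronFrobenius_pfVector hirr).1 v).le

/-- The measure on the infinite paths of the Bratteli diagram given by the Perron-Frobenius
eigenvector. -/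
theorem exists_bratteli_measure : ∃ μ : Measure Λ.bratteli.InfPath, IsProbabilityMeasure μ ∧
    ∀ l : Λ.bratteli.FinPath, μ (BratteliDiagram.cylinder l) =
      ENNReal.ofReal ((Λ.rhoPow (levelDeg k l.len))⁻¹ * Λ.pfVector l.source) := by
  have hx := isPerronFrobenius_pfVector hirr
  refine BratteliDiagram.exists_measure_of_consistent (noDeadEnds_bratteli hirr) _ ?_ ?_
  · have h : ∀ v : V, ENNReal.ofReal ((Λ.rhoPow (levelDeg k 0))⁻¹ * Λ.pfVector v) =
        ENNReal.ofReal (Λ.pfVector v) := fun v => by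
      rw [levelDeg_zero, rhoPow_zero, inv_one, one_mul]
    change ∑' v : V, ENNReal.ofReal ((Λ.rhoPow (levelDeg k 0))⁻¹ * Λ.pfVector v) = 1
    simp only [h]
    rw [tsum_fintype, ← ENNReal.ofReal_sum_of_nonneg fun v _ => (hx.1 v).le, hx.2.1,
      ENNReal.ofReal_one]
  -- Consistency is the eigenvector equation for the path matrix of degree `levelDeg k n - levelDeg
  -- k γ.len`.
  · intro γ n hn
    refine Eq.trans ?_ (congrArg ENNReal.ofReal
      (mulVec_inv_rhoPow_smul hirr (levelDeg_mono k hn) γ.source))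
    refine Eq.trans (tsum_congr fun l => ?_)
      (tsum_extensions_ofReal hirr γ hn (inv_rhoPow_smul_nonneg hirr _))
    rw [l.2.1]
    rfl

omit [Nonempty V] [DecidableEq V] [NeZero k] [Fintype V] [Λ.IsFinite] hirr in
-- Used to reduce cylinder sets of arbitrary degree to the degrees `levelDeg k n` seen by the
-- Bratteli diagram.
theorem cylinder_eq_iUnion (l : Arrow V) {n : Fin k → ℕ} (h : Λ.deg l.hom ≤ n) :
    Λ.cylinder l = ⋃ b : (Σ w : V, {b : w ⟶ l.left // Λ.deg b = n - Λ.deg l.hom}),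
      Λ.cylinder (Arrow.mk (b.2.1 ≫ l.hom)) := by
  have hdeg : ∀ b : (Σ w : V, {b : w ⟶ l.left // Λ.deg b = n - Λ.deg l.hom}),
      Λ.deg (Arrow.mk (b.2.1 ≫ l.hom)).hom = n := fun b => by
    refine (Λ.deg_comp _ _).trans ?_
    rw [b.2.2, add_tsub_cancel_of_le h]
  ext x
  rw [Set.mem_iUnion]
  simp only [mem_cylinder_iff (hdeg _)]
  have hx := x.map_trans (zero_le : 0 ≤ Λ.deg l.hom) h
  constructor
  · intro hl
    have hl' : Arrow.mk (x.map (zero_le : 0 ≤ Λ.deg l.hom)) = Arrow.mk l.hom := hl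
    have hobj : x.obj (Λ.deg l.hom) = l.left := congrArg Arrow.leftFunc.obj hl'
    refine ⟨⟨x.obj n, x.map h ≫ eqToHom hobj, ?_⟩, ?_⟩
    · rw [Λ.deg_comp, deg_eqToHom, zero_add]
      exact x.deg_map h
    · have h5 : Arrow.mk ((x.map h ≫ eqToHom hobj) ≫ l.hom) =
          Arrow.mk (x.map h ≫ x.map (zero_le : 0 ≤ Λ.deg l.hom)) :=
        arrow_comp_congr (arrow_comp_eqToHom (x.map h) hobj) hl'.symm
      refine Eq.trans ?_ h5.symm
      rw [← hx]
      rfl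
  · rintro ⟨b, hb⟩
    have h1 : Arrow.mk (x.map h ≫ x.map (zero_le : 0 ≤ Λ.deg l.hom)) =
        Arrow.mk (b.2.1 ≫ l.hom) := by
      rw [← hx]
      exact hb
    exact (Λ.arrow_factorization_unique h1 (by rw [x.deg_map, tsub_zero])).2

omit [Nonempty V] [DecidableEq V] [NeZero k] [Fintype V] [Λ.IsFinite] hirr in
theorem disjoint_cylinder_extension (l : Arrow V) {n : Fin k → ℕ} (h : Λ.deg l.hom ≤ n) :
    Pairwise (Function.onFun Disjoint
      fun b : (Σ w : V, {b : w ⟶ l.left // Λ.deg b = n - Λ.deg l.hom}) =>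
        Λ.cylinder (Arrow.mk (b.2.1 ≫ l.hom))) := by
  have hdeg : ∀ b : (Σ w : V, {b : w ⟶ l.left // Λ.deg b = n - Λ.deg l.hom}),
      Λ.deg (Arrow.mk (b.2.1 ≫ l.hom)).hom = n := fun b => by
    refine (Λ.deg_comp _ _).trans ?_
    rw [b.2.2, add_tsub_cancel_of_le h]
  intro b b' hne
  refine Set.disjoint_left.2 fun x hx hx' => hne ?_
  rw [mem_cylinder_iff (hdeg _)] at hx hx'
  have h2 := (Λ.arrow_factorization_unique (hx.symm.trans hx') rfl).1
  obtain ⟨w, b, hb⟩ := b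
  obtain ⟨w', b', hb'⟩ := b'
  obtain rfl : w = w' := congrArg Arrow.leftFunc.obj h2
  obtain rfl : b = b' := Arrow.mk_injective _ _ h2
  rfl

omit [Nonempty V] in
theorem IsAHLRS.map_toBratteli_cylinder {M : Measure Λ.InfPath} (hM : Λ.IsAHLRS M)
    (l : Λ.bratteli.FinPath) : M.map toBratteli (BratteliDiagram.cylinder l) =
      ENNReal.ofReal ((Λ.rhoPow (levelDeg k l.len))⁻¹ * Λ.pfVector l.source) := by
  obtain ⟨z, hz⟩ := (noDeadEnds_bratteli hirr).nonempty_cylinder l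
  obtain ⟨x, rfl⟩ := toBratteli_surjective z
  obtain ⟨m, rfl⟩ : ∃ m, l = (toBratteli x).take m := ⟨_, hz.symm⟩
  rw [Measure.map_apply continuous_toBratteli.measurable
    (BratteliDiagram.measurableSet_cylinder _)]
  have h1 : toBratteli ⁻¹' BratteliDiagram.cylinder ((toBratteli x).take m) =
      Λ.cylinder (x.seg (zero_le : 0 ≤ levelDeg k m)) :=
    Set.ext fun y => toBratteli_mem_cylinder_iff
  have h2 : Λ.deg (x.seg (zero_le : 0 ≤ levelDeg k m)).hom = levelDeg k m :=
    (x.deg_map _).trans (tsub_zero _)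
  have h3 : ((toBratteli x).take m).source = x.obj (levelDeg k m) := (toBratteli x).source_take m
  rw [h1, hM, h2, h3]
  rfl

/-- Transport `μ` through the inverse homeomorphism. Each cylinder set splits into cylinder sets of
some degree `levelDeg k n`, and the eigenvector equation adds up their masses. -/
theorem exists_isAHLRS {μ : Measure Λ.bratteli.InfPath}
    (hμ : ∀ l : Λ.bratteli.FinPath, μ (BratteliDiagram.cylinder l) =
      ENNReal.ofReal ((Λ.rhoPow (levelDeg k l.len))⁻¹ * Λ.pfVector l.source)) :
    ∃ M, Λ.IsAHLRS M := by
  let e := (isHomeomorph_toBratteli (Λ := Λ)).homeomorph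
  have he : ∀ x, e x = toBratteli x := fun x => rfl
  refine ⟨μ.map e.symm, fun l => ?_⟩
  obtain ⟨n, hn⟩ := exists_le_levelDeg k (Λ.deg l.hom)
  rw [cylinder_eq_iUnion l hn, measure_iUnion (disjoint_cylinder_extension l hn)
    fun b => (isOpen_cylinder _).measurableSet]
  have h1 : ∀ b : (Σ w : V, {b : w ⟶ l.left // Λ.deg b = levelDeg k n - Λ.deg l.hom}),
      μ.map e.symm (Λ.cylinder (Arrow.mk (b.2.1 ≫ l.hom))) =
        ENNReal.ofReal (((Λ.rhoPow (levelDeg k n))⁻¹ • Λ.pfVector) b.1) := by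
    intro b
    have hd : Λ.deg (Arrow.mk (b.2.1 ≫ l.hom)).hom = levelDeg k n := by
      refine (Λ.deg_comp _ _).trans ?_
      rw [b.2.2, add_tsub_cancel_of_le hn]
    obtain ⟨x, hx⟩ := nonempty_cylinder hirr (Arrow.mk (b.2.1 ≫ l.hom))
    rw [mem_cylinder_iff hd] at hx
    rw [Measure.map_apply e.symm.continuous.measurable (isOpen_cylinder _).measurableSet, ← hx]
    have h2 : e.symm ⁻¹' Λ.cylinder (x.seg (zero_le : 0 ≤ levelDeg k n)) =
        BratteliDiagram.cylinder ((toBratteli x).take n) := by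
      ext z
      obtain ⟨y, rfl⟩ := e.surjective z
      rw [Set.mem_preimage, e.symm_apply_apply, he, toBratteli_mem_cylinder_iff]
    have h3 : ((toBratteli x).take n).source = x.obj (levelDeg k n) :=
      (toBratteli x).source_take n
    have h4 : x.obj (levelDeg k n) = b.1 := congrArg Arrow.leftFunc.obj hx
    rw [h2, hμ, h3, h4]
    rfl
  simp only [h1]
  rw [tsum_hom_deg _ _ fun w => ENNReal.ofReal (((Λ.rhoPow (levelDeg k n))⁻¹ • Λ.pfVector) w),
    sum_pathMat_mul_ofReal _ _ (inv_rhoPow_smul_nonneg hirr _), mulVec_inv_rhoPow_smul hirr hn]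
  rfl

omit [Nonempty V] in
theorem IsAHLRS.map_toBratteli_eq {M : Measure Λ.InfPath} (hM : Λ.IsAHLRS M)
    {μ : Measure Λ.bratteli.InfPath}
    (hμ : ∀ l : Λ.bratteli.FinPath, μ (BratteliDiagram.cylinder l) =
      ENNReal.ofReal ((Λ.rhoPow (levelDeg k l.len))⁻¹ * Λ.pfVector l.source)) :
    M.map toBratteli = μ := by
  refine BratteliDiagram.measure_ext_of_cylinder (fun l => ?_) fun l => ?_
  · rw [hM.map_toBratteli_cylinder hirr]
    exact ENNReal.ofReal_ne_top
  · rw [hM.map_toBratteli_cylinder hirr, hμ]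

omit [Nonempty V] in
theorem IsAHLRS.unique {M M' : Measure Λ.InfPath} (hM : Λ.IsAHLRS M) (hM' : Λ.IsAHLRS M') :
    M = M' := by
  let e := (isHomeomorph_toBratteli (Λ := Λ)).homeomorph.toMeasurableEquiv
  have h : M.map e = M'.map e := hM.map_toBratteli_eq hirr (hM'.map_toBratteli_cylinder hirr)
  rw [← e.map_symm_map (μ := M), h, e.map_symm_map]

theorem isAHLRS_aHLRS : Λ.IsAHLRS Λ.aHLRS := by
  obtain ⟨μ, -, hμ⟩ := exists_bratteli_measure hirr
  have hex := exists_isAHLRS hirr hμ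
  rw [aHLRS, dif_pos hex]
  exact hex.choose_spec

end Counting

end KGraph

end

/-! ### Asymptotics of the weighted path sums -/

noncomputable section

namespace KGraph

variable {k : ℕ} {V : Type u} [SmallCategory V] {Λ : KGraph k V}

section RhoProd

variable [NeZero k]

theorem levelDeg_apply_of_le {t : ℕ} (ht : t ≤ k) (i : Fin k) :
    levelDeg k t i = if i.val < t then 1 else 0 := by
  induction t with
  | zero => simp [levelDeg_zero]
  | succ t ih =>
    have hc : color k t = ⟨t, ht⟩ := color_val k ⟨t, ht⟩
    rw [levelDeg_succ, Pi.add_apply, ih (by omega), hc, Pi.single_apply]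
    simp only [Fin.ext_iff]
    split_ifs <;> omega

variable [Fintype V] [DecidableEq V]

variable (Λ) in
theorem rhoPow_levelDeg (q t : ℕ) (ht : t < k) :
    Λ.rhoPow (levelDeg k (q * k + t)) = Λ.rhoProd q t := by
  have h1 : Λ.rhoPow (levelDeg k t) = ∏ i : Fin k with i.val < t, Λ.rho i := by
    rw [rhoPow, Finset.prod_filter]
    refine Finset.prod_congr rfl fun i _ => ?_
    rw [levelDeg_apply_of_le ht.le]
    split_ifs <;> simp
  have h2 : Λ.rhoPow 1 = (∏ i : Fin k with i.val < t, Λ.rho i) *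
      ∏ i : Fin k with t ≤ i.val, Λ.rho i := by
    have := Finset.prod_filter_mul_prod_filter_not Finset.univ (fun i : Fin k => i.val < t) Λ.rho
    simp only [not_lt] at this
    rw [this, rhoPow]
    simp
  rw [levelDeg_mul_add, rhoPow_add, rhoPow_nsmul, h1, h2, rhoProd, mul_pow]
  ring

variable [Λ.IsFinite]

theorem weight_eq (δ : ℝ) (l : Λ.bratteli.FinPath) :
    Λ.weight δ l = Λ.rhoPow (levelDeg k l.len) ^ (-1 / δ) * Λ.pfVector l.source := by
  have h := Λ.rhoPow_levelDeg (l.len / k) (l.len % k) (Nat.mod_lt _ (NeZero.pos k))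
  rw [Nat.div_add_mod'] at h
  rw [weight, h]

end RhoProd

section Analysis

variable [NeZero k] [Fintype V] [DecidableEq V] [Nonempty V] [Λ.IsFinite]
  (hirr : (Λ.adjProd.map (Nat.cast : ℕ → ℝ)).IsIrreducible)

include hirr

omit [NeZero k] in
theorem pfVector_pos (v : V) : 0 < Λ.pfVector v := (isPerronFrobenius_pfVector hirr).1 v

omit [NeZero k] in
theorem pfVector_le_one (v : V) : Λ.pfVector v ≤ 1 := by
  rw [← (isPerronFrobenius_pfVector hirr).2.1]
  exact Finset.single_le_sum (fun w _ => (pfVector_pos hirr w).le) (Finset.mem_univ v)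

theorem weight_pos (δ : ℝ) (l : Λ.bratteli.FinPath) : 0 < Λ.weight δ l := by
  rw [weight_eq]
  exact mul_pos (Real.rpow_pos_of_pos (rhoPow_pos hirr _) _) (pfVector_pos hirr _)

theorem weight_le (δ : ℝ) (l : Λ.bratteli.FinPath) :
    Λ.weight δ l ≤ Λ.rhoPow (levelDeg k l.len) ^ (-1 / δ) := by
  rw [weight_eq]
  exact mul_le_of_le_one_right (Real.rpow_pos_of_pos (rhoPow_pos hirr _) _).le
    (pfVector_le_one hirr _)

theorem weight_le_one {δ : ℝ} (hδ : 0 < δ) (l : Λ.bratteli.FinPath) : Λ.weight δ l ≤ 1 :=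
  (weight_le hirr δ l).trans (Real.rpow_le_one_of_one_le_of_nonpos (one_le_rhoPow hirr _)
    (div_nonpos_of_nonpos_of_nonneg (by norm_num) hδ.le))

omit [NeZero k] in
theorem rhoPow_mono {m n : Fin k → ℕ} (h : m ≤ n) : Λ.rhoPow m ≤ Λ.rhoPow n := by
  rw [← add_tsub_cancel_of_le h, rhoPow_add]
  exact le_mul_of_one_le_right (rhoPow_pos hirr m).le (one_le_rhoPow hirr _)

theorem pow_le_rhoPow_levelDeg (n : ℕ) : Λ.rhoPow 1 ^ (n / k) ≤ Λ.rhoPow (levelDeg k n) := by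
  rw [← rhoPow_nsmul]
  refine rhoPow_mono hirr ?_
  conv_rhs => rw [← Nat.div_add_mod' n k, levelDeg_mul_add]
  exact le_self_add

/-- If every cylinder set has positive diameter, then the spectral radius of `A` exceeds `1`. -/
theorem one_lt_rhoPow_one {δ : ℝ} (hw : Λ.WeightEqDiam δ) : 1 < Λ.rhoPow 1 := by
  refine lt_of_le_of_ne (one_le_rhoPow hirr 1) fun h1 => ?_
  -- If `ρ_1 ⋯ ρ_k = 1`, monotonicity makes every `ρ^{levelDeg k n}` equal to `1`, so the measure of
  -- a cylinder set is the value of `x` at its source.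
  have hR : ∀ n, Λ.rhoPow (levelDeg k n) = 1 := by
    intro n
    refine le_antisymm ?_ (one_le_rhoPow hirr _)
    calc Λ.rhoPow (levelDeg k n) ≤ Λ.rhoPow (levelDeg k (n * k + 0)) :=
          rhoPow_mono hirr (levelDeg_mono k (Nat.le_mul_of_pos_right n (NeZero.pos k)))
      _ = 1 := by
          rw [levelDeg_mul_add, levelDeg_zero, add_zero, rhoPow_nsmul, ← h1, one_pow]
  obtain ⟨μ, hμ1, hμ⟩ := exists_bratteli_measure hirr
  have hμr : ∀ l : Λ.bratteli.FinPath, μ.real (BratteliDiagram.cylinder l) =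
      Λ.pfVector l.source := by
    intro l
    rw [measureReal_def, hμ, hR, inv_one, one_mul]
    exact ENNReal.toReal_ofReal (pfVector_pos hirr l.source).le
  -- The cylinder set of a vertex minimizing `x` has measure `x v`, yet it contains two disjoint
  -- cylinder sets of measure at least `x v` each.
  obtain ⟨v, hv⟩ := Finite.exists_min Λ.pfVector
  let γ : Λ.bratteli.FinPath := BratteliDiagram.nil (B := Λ.bratteli) v
  have hγ : 0 < BratteliDiagram.cylDiam (Λ.weight δ) γ := hw γ ▸ weight_pos hirr δ γ
  obtain ⟨x, hx, y, hy, hxy⟩ := BratteliDiagram.exists_ne_of_cylDiam_pos hγ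
  obtain ⟨n, hn⟩ : ∃ n, x.take n ≠ y.take n := by
    by_contra! h
    exact hxy (BratteliDiagram.InfPath.eq_of_forall_take_eq h)
  have hdisj : Disjoint (BratteliDiagram.cylinder (x.take n))
      (BratteliDiagram.cylinder (y.take n)) :=
    Set.disjoint_left.2 fun z hz hz' => hn (hz.symm.trans hz')
  have hsub : ∀ z ∈ BratteliDiagram.cylinder γ,
      BratteliDiagram.cylinder (z.take n) ⊆ BratteliDiagram.cylinder γ := fun z hz =>
    (BratteliDiagram.isSubpath_of_mem_cylinder hz (z.mem_cylinder_take n)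
      (Nat.zero_le _)).cylinder_subset
  have h2 := measureReal_mono (μ := μ) (Set.union_subset (hsub x hx) (hsub y hy))
  rw [measureReal_union hdisj (BratteliDiagram.measurableSet_cylinder _), hμr, hμr, hμr] at h2
  have h3 : Λ.pfVector γ.source = Λ.pfVector v := rfl
  have h4 := hv (x.take n).source
  have h5 := hv (y.take n).source
  have h6 := pfVector_pos hirr v
  linarith

theorem tendsto_rhoPow_levelDeg (hρ : 1 < Λ.rhoPow 1) :
    Tendsto (fun n => Λ.rhoPow (levelDeg k n)) atTop atTop :=
  tendsto_atTop_mono (pow_le_rhoPow_levelDeg hirr) ((tendsto_pow_atTop_atTop_of_one_lt hρ).comp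
    (Nat.tendsto_div_const_atTop (NeZero.ne k)))

theorem weightVanishes {δ : ℝ} (hδ : 0 < δ) (hρ : 1 < Λ.rhoPow 1) :
    BratteliDiagram.WeightVanishes (Λ.weight δ) := by
  intro ε hε
  have h := (tendsto_rpow_neg_atTop (inv_pos.2 hδ)).comp (tendsto_rhoPow_levelDeg hirr hρ)
  obtain ⟨N, hN⟩ := eventually_atTop.1 (h.eventually_lt_const hε)
  refine (BratteliDiagram.finite_setOf_len_le N).subset fun l hl => ?_
  by_contra! hlen
  have h1 := hN l.len (not_le.1 hlen).le
  have h2 := weight_le hirr δ l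
  rw [neg_div, one_div] at h2
  exact absurd (hl.trans h2) (not_le.2 h1)

omit hirr [Λ.IsFinite] [NeZero k] [DecidableEq V] [Nonempty V] [SmallCategory V] in
theorem add_mul_sum_mul_div (a b z : ℝ) (f g : V → ℝ) :
    (a + b * ∑ w, f w * g w) / z = a / z + b * ∑ w, f w * (g w / z) := by
  simp only [add_div, mul_div_assoc, Finset.sum_div]

/-- The contribution to `∑ w_δ(l)^s` of the paths of length `m + j` that extend a given path of
length `m` with source `v`. -/
def levelTerm (Λ : KGraph k V) (δ s : ℝ) (m j : ℕ) (v : V) : ℝ :=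
  Λ.rhoPow (levelDeg k (m + j)) ^ (-s / δ) *
    (Λ.pathMatR (levelDeg k (m + j) - levelDeg k m)).mulVec (fun w => Λ.pfVector w ^ s) v

omit hirr [Λ.IsFinite] [NeZero k] [DecidableEq V] [Nonempty V] in
theorem mulVec_mono {d : Fin k → ℕ} {f g : V → ℝ} (h : ∀ v, f v ≤ g v) (v : V) :
    (Λ.pathMatR d).mulVec f v ≤ (Λ.pathMatR d).mulVec g v :=
  Finset.sum_le_sum fun w _ => mul_le_mul_of_nonneg_left (h w) (pathMatR_nonneg _ _ _ _)

theorem levelTerm_nonneg (δ s : ℝ) (m j : ℕ) (v : V) : 0 ≤ Λ.levelTerm δ s m j v :=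
  mul_nonneg (Real.rpow_pos_of_pos (rhoPow_pos hirr _) _).le
    (Finset.sum_nonneg fun w _ => mul_nonneg (pathMatR_nonneg _ _ _ _)
      (Real.rpow_pos_of_pos (pfVector_pos hirr w) _).le)

/-- The colours start afresh at level `q k`. A path reaching beyond it factors there, and the rest
counts like a path from level `0`, scaled by `(ρ_1 ⋯ ρ_k)^{-q s / δ}`. -/
theorem levelTerm_add (δ s : ℝ) {m i q : ℕ} (h : m + i = q * k) (j : ℕ) (v : V) :
    Λ.levelTerm δ s m (j + i) v = (Λ.rhoPow 1 ^ q) ^ (-s / δ) *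
      ∑ w, Λ.pathMatR (levelDeg k (q * k) - levelDeg k m) v w * Λ.levelTerm δ s 0 j w := by
  have h1 : m + (j + i) = q * k + j := by omega
  have h2 : levelDeg k (q * k) = q • 1 := by
    have := levelDeg_mul_add k q 0
    rwa [levelDeg_zero, add_zero, add_zero] at this
  have hle : levelDeg k m ≤ levelDeg k (q * k) := levelDeg_mono k (by omega)
  have h3 : levelDeg k (q * k + j) = levelDeg k (q * k) + levelDeg k j := by
    rw [levelDeg_mul_add, h2]
  have h4 : levelDeg k (q * k + j) - levelDeg k m =
      (levelDeg k (q * k) - levelDeg k m) + levelDeg k j := by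
    rw [h3, tsub_add_eq_add_tsub hle]
  have h5 : Λ.rhoPow (levelDeg k (q * k)) = Λ.rhoPow 1 ^ q := by rw [h2, rhoPow_nsmul]
  rw [levelTerm, h1, h4, pathMatR_add, ← Matrix.mulVec_mulVec, h3, rhoPow_add, h5,
    Real.mul_rpow (pow_nonneg (rhoPow_pos hirr 1).le q) (rhoPow_pos hirr _).le, mul_assoc]
  congr 1
  simp only [levelTerm, zero_add, levelDeg_zero, tsub_zero]
  rw [Matrix.mulVec, dotProduct, Finset.mul_sum]
  exact Finset.sum_congr rfl fun w _ => by ring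

omit hirr [NeZero k] in
theorem rhoPow_rpow_mul (hirr : (Λ.adjProd.map (Nat.cast : ℕ → ℝ)).IsIrreducible) (δ s : ℝ)
    (d : Fin k → ℕ) : Λ.rhoPow d ^ (-s / δ) * Λ.rhoPow d = Λ.rhoPow d ^ (1 - s / δ) := by
  conv_lhs => rw [← Real.rpow_one (Λ.rhoPow d), ← Real.rpow_mul (rhoPow_pos hirr d).le, one_mul]
  rw [← Real.rpow_add (rhoPow_pos hirr d)]
  congr 1
  ring

/-- Since `0 < x ≤ 1` and `s ≤ 1`, one has `x ≤ x^s`, and `x` is an eigenvector. -/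
theorem levelTerm_zero_ge {δ s : ℝ} (hs : s ≤ 1) (j : ℕ) (v : V) :
    Λ.rhoPow (levelDeg k j) ^ (1 - s / δ) * Λ.pfVector v ≤ Λ.levelTerm δ s 0 j v := by
  have h1 : ∀ w, Λ.pfVector w ≤ Λ.pfVector w ^ s := fun w => by
    conv_lhs => rw [← Real.rpow_one (Λ.pfVector w)]
    exact Real.rpow_le_rpow_of_exponent_ge (pfVector_pos hirr w) (pfVector_le_one hirr w) hs
  have h2 := mulVec_mono (Λ := Λ) (d := levelDeg k j) h1 v
  rw [(isPerronFrobenius_pfVector hirr).pathMatR_mulVec] at h2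
  rw [levelTerm, zero_add, levelDeg_zero, tsub_zero, ← rhoPow_rpow_mul hirr, mul_assoc]
  exact mul_le_mul_of_nonneg_left h2 (Real.rpow_pos_of_pos (rhoPow_pos hirr _) _).le

/-- As `x` is positive on a finite set, `x^s` is at most a multiple of `x`, with a factor
independent of the level. -/
theorem exists_levelTerm_zero_le (s : ℝ) : ∃ C : ℝ, ∀ (δ : ℝ) (j : ℕ) (v : V),
    Λ.levelTerm δ s 0 j v ≤ C * Λ.rhoPow (levelDeg k j) ^ (1 - s / δ) := by
  set C : ℝ := ∑ v, Λ.pfVector v ^ s / Λ.pfVector v with hC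
  have hpos : ∀ v, 0 ≤ Λ.pfVector v ^ s / Λ.pfVector v := fun v =>
    div_nonneg (Real.rpow_pos_of_pos (pfVector_pos hirr v) s).le (pfVector_pos hirr v).le
  have hC0 : 0 ≤ C := Finset.sum_nonneg fun v _ => hpos v
  have h1 : ∀ w, Λ.pfVector w ^ s ≤ (C • Λ.pfVector) w := fun w => by
    rw [Pi.smul_apply, smul_eq_mul, ← div_le_iff₀ (pfVector_pos hirr w)]
    exact Finset.single_le_sum (fun v _ => hpos v) (Finset.mem_univ w)
  refine ⟨C, fun δ j v => ?_⟩
  have h2 := mulVec_mono (Λ := Λ) (d := levelDeg k j) h1 v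
  rw [Matrix.mulVec_smul, (isPerronFrobenius_pfVector hirr).pathMatR_mulVec, Pi.smul_apply,
    Pi.smul_apply, smul_eq_mul, smul_eq_mul] at h2
  have h3 : C * (Λ.rhoPow (levelDeg k j) * Λ.pfVector v) ≤ C * Λ.rhoPow (levelDeg k j) :=
    mul_le_mul_of_nonneg_left
      (mul_le_of_le_one_right (rhoPow_pos hirr _).le (pfVector_le_one hirr v)) hC0
  rw [levelTerm, zero_add, levelDeg_zero, tsub_zero, ← rhoPow_rpow_mul hirr, mul_left_comm]
  exact mul_le_mul_of_nonneg_left (h2.trans h3) (Real.rpow_pos_of_pos (rhoPow_pos hirr _) _).le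

theorem summable_rhoPow_rpow {δ s : ℝ} (hδ : 0 < δ) (hs : δ < s) (hρ : 1 < Λ.rhoPow 1) :
    Summable fun j => Λ.rhoPow (levelDeg k j) ^ (1 - s / δ) := by
  have hneg : 1 - s / δ < 0 := by
    rw [sub_neg, one_lt_div hδ]
    exact hs
  set r : ℝ := Λ.rhoPow 1 ^ (1 - s / δ) with hr
  have hr0 : 0 ≤ r := (Real.rpow_pos_of_pos (rhoPow_pos hirr 1) _).le
  have hr1 : r < 1 := Real.rpow_lt_one_of_one_lt_of_neg hρ hneg
  -- Each power of `r` occurs for the `k` levels of one period, hence a sum over quotients and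
  -- remainders.
  have h1 : Summable fun p : ℕ × Fin k => r ^ p.1 * (1 : ℝ) :=
    (summable_geometric_of_lt_one hr0 hr1).mul_of_nonneg (g := fun _ : Fin k => (1 : ℝ))
      Summable.of_finite (fun n => pow_nonneg hr0 n) fun _ => zero_le_one
  have h2 : Summable fun j : ℕ => r ^ (j / k) := by
    have := (Nat.divModEquiv k).summable_iff.2 h1
    refine this.congr fun j => ?_
    simp [Nat.divModEquiv]
  refine Summable.of_nonneg_of_le (fun j => (Real.rpow_pos_of_pos (rhoPow_pos hirr _) _).le)
    (fun j => ?_) h2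
  rw [hr, ← Real.rpow_natCast, ← Real.rpow_mul (rhoPow_pos hirr 1).le, mul_comm,
    Real.rpow_mul (rhoPow_pos hirr 1).le, Real.rpow_natCast]
  exact Real.rpow_le_rpow_of_nonpos (pow_pos (rhoPow_pos hirr 1) _)
    (pow_le_rhoPow_levelDeg hirr j) hneg.le

theorem summable_levelTerm_zero {δ s : ℝ} (hδ : 0 < δ) (hs : δ < s) (hρ : 1 < Λ.rhoPow 1) (v : V) :
    Summable fun j => Λ.levelTerm δ s 0 j v := by
  obtain ⟨C, hC⟩ := exists_levelTerm_zero_le hirr s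
  exact Summable.of_nonneg_of_le (fun j => levelTerm_nonneg hirr _ _ _ _ _) (fun j => hC δ j v)
    ((summable_rhoPow_rpow hirr hδ hs hρ).mul_left C)

theorem summable_levelTerm {δ s : ℝ} (hδ : 0 < δ) (hs : δ < s) (hρ : 1 < Λ.rhoPow 1) {m i q : ℕ}
    (h : m + i = q * k) (v : V) :
    Summable (fun j => Λ.levelTerm δ s m j v) ∧
    ∑' j, Λ.levelTerm δ s m j v = ∑ j ∈ Finset.range i, Λ.levelTerm δ s m j v +
      (Λ.rhoPow 1 ^ q) ^ (-s / δ) * ∑ w, Λ.pathMatR (levelDeg k (q * k) - levelDeg k m) v w *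
        ∑' j, Λ.levelTerm δ s 0 j w := by
  have h1 : ∀ w, Summable fun j => Λ.pathMatR (levelDeg k (q * k) - levelDeg k m) v w *
      Λ.levelTerm δ s 0 j w := fun w => (summable_levelTerm_zero hirr hδ hs hρ w).mul_left _
  have h2 : Summable fun j => Λ.levelTerm δ s m (j + i) v :=
    ((summable_sum fun w _ => h1 w).mul_left _).congr fun j =>
      (levelTerm_add hirr δ s h j v).symm
  have h3 := (summable_nat_add_iff (f := fun j => Λ.levelTerm δ s m j v) i).1 h2
  refine ⟨h3, ?_⟩
  refine (h3.sum_add_tsum_nat_add i).symm.trans (congrArg (_ + ·) ?_)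
  rw [tsum_congr fun j => levelTerm_add hirr δ s h j v, tsum_mul_left,
    Summable.tsum_finsetSum fun w _ => h1 w]
  exact congrArg (_ * ·) (Finset.sum_congr rfl fun w _ => tsum_mul_left)

/-- The total sum `∑ w_δ(l)^s`. -/
def totalSum (Λ : KGraph k V) (δ s : ℝ) : ℝ := ∑ v, ∑' j, Λ.levelTerm δ s 0 j v

/-- The lower bound for each level, summed over the vertices, tends to `1` as `s ↘ δ`, so the first
`J` levels alone eventually contribute almost `J`. -/
theorem tendsto_totalSum {δ : ℝ} (hδ : 0 < δ) (hδ1 : δ < 1) (hρ : 1 < Λ.rhoPow 1) :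
    Tendsto (Λ.totalSum δ) (𝓝[>] δ) atTop := by
  refine tendsto_atTop.2 fun b => ?_
  obtain ⟨J, hJ⟩ := exists_nat_gt b
  have hcont : Tendsto (fun s : ℝ => ∑ j ∈ Finset.range J,
      Λ.rhoPow (levelDeg k j) ^ (1 - s / δ)) (𝓝[>] δ) (𝓝 J) := by
    have h1 : ∀ j, Tendsto (fun s : ℝ => Λ.rhoPow (levelDeg k j) ^ (1 - s / δ)) (𝓝[>] δ)
        (𝓝 1) := by
      intro j
      have hc : Continuous fun s : ℝ => Λ.rhoPow (levelDeg k j) ^ (1 - s / δ) :=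
        (Real.continuous_const_rpow (rhoPow_pos hirr _).ne').comp (by fun_prop)
      have := (hc.tendsto δ).mono_left (nhdsWithin_le_nhds (s := Set.Ioi δ))
      rwa [div_self hδ.ne', sub_self, Real.rpow_zero] at this
    have := tendsto_finsetSum (Finset.range J) fun j _ => h1 j
    simpa using this
  have hlt : ∀ᶠ s in 𝓝[>] δ, s < 1 := nhdsWithin_le_nhds (gt_mem_nhds hδ1)
  filter_upwards [self_mem_nhdsWithin, hlt, hcont.eventually_const_lt hJ] with s hs hs1 hb
  refine hb.le.trans ?_
  have hsum := fun v => summable_levelTerm_zero hirr hδ hs hρ v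
  calc ∑ j ∈ Finset.range J, Λ.rhoPow (levelDeg k j) ^ (1 - s / δ)
      = ∑ v, ∑ j ∈ Finset.range J, Λ.rhoPow (levelDeg k j) ^ (1 - s / δ) * Λ.pfVector v := by
        simp only [← Finset.sum_mul, ← Finset.mul_sum, (isPerronFrobenius_pfVector hirr).2.1,
          mul_one]
    _ ≤ ∑ v, ∑ j ∈ Finset.range J, Λ.levelTerm δ s 0 j v :=
        Finset.sum_le_sum fun v _ => Finset.sum_le_sum fun j _ =>
          levelTerm_zero_ge hirr hs1.le j v
    _ ≤ Λ.totalSum δ s := Finset.sum_le_sum fun v _ =>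
        (hsum v).sum_le_tsum _ fun j _ => levelTerm_nonneg hirr _ _ _ _ _

theorem tendsto_levelTerm_div {δ : ℝ} (hδ : 0 < δ) (hδ1 : δ < 1) (hρ : 1 < Λ.rhoPow 1) (m i : ℕ)
    (v : V) : Tendsto (fun s => (∑ j ∈ Finset.range i, Λ.levelTerm δ s m j v) / Λ.totalSum δ s)
      (𝓝[>] δ) (𝓝 0) := by
  have hc : Continuous fun s => ∑ j ∈ Finset.range i, Λ.levelTerm δ s m j v := by
    refine continuous_finsetSum _ fun j _ => Continuous.mul ?_ ?_
    · exact (Real.continuous_const_rpow (rhoPow_pos hirr _).ne').comp (by fun_prop)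
    · refine continuous_finsetSum _ fun w _ => continuous_const.mul ?_
      exact Real.continuous_const_rpow (pfVector_pos hirr w).ne'
  exact ((hc.tendsto δ).mono_left nhdsWithin_le_nhds).div_atTop (tendsto_totalSum hirr hδ hδ1 hρ)

omit hirr [NeZero k] in
theorem tendsto_pow_rpow (hirr : (Λ.adjProd.map (Nat.cast : ℕ → ℝ)).IsIrreducible) {δ : ℝ}
    (hδ : 0 < δ) (q : ℕ) :
    Tendsto (fun s : ℝ => (Λ.rhoPow 1 ^ q) ^ (-s / δ)) (𝓝[>] δ) (𝓝 (Λ.rhoPow 1 ^ q)⁻¹) := by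
  have hc : Continuous fun s : ℝ => (Λ.rhoPow 1 ^ q) ^ (-s / δ) :=
    (Real.continuous_const_rpow (pow_pos (rhoPow_pos hirr 1) q).ne').comp (by fun_prop)
  have := (hc.tendsto δ).mono_left (nhdsWithin_le_nhds (s := Set.Ioi δ))
  rwa [neg_div, div_self hδ.ne', Real.rpow_neg_one] at this

/-- The normalized vectors lie in a compact cube, so only cluster points have to be identified. A
cluster point has coordinate sum `1`. The terms of the first period are negligible, so the recursion
over one period becomes the eigenvector equation in the limit, which leaves only `x`. -/
theorem tendsto_vertexSum_div {δ : ℝ} (hδ : 0 < δ) (hδ1 : δ < 1) (hρ : 1 < Λ.rhoPow 1) (v : V) :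
    Tendsto (fun s => (∑' j, Λ.levelTerm δ s 0 j v) / Λ.totalSum δ s) (𝓝[>] δ)
      (𝓝 (Λ.pfVector v)) := by
  set u : ℝ → V → ℝ := fun s v => (∑' j, Λ.levelTerm δ s 0 j v) / Λ.totalSum δ s with hu
  have hnn : ∀ s v, 0 ≤ ∑' j, Λ.levelTerm δ s 0 j v := fun s v =>
    tsum_nonneg fun j => levelTerm_nonneg hirr _ _ _ _ _
  have hZ := tendsto_totalSum hirr hδ hδ1 hρ
  have hpos := hZ.eventually_gt_atTop 0
  suffices h : Tendsto u (𝓝[>] δ) (𝓝 Λ.pfVector) from (tendsto_pi_nhds.1 h) v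
  refine (isCompact_Icc (a := (0 : V → ℝ)) (b := 1)).tendsto_nhds_of_unique_mapClusterPt ?_ ?_
  · filter_upwards [hpos] with s hs
    refine ⟨fun v => div_nonneg (hnn s v) hs.le, fun v => ?_⟩
    refine (div_le_one hs).2 ?_
    exact Finset.single_le_sum (fun w _ => hnn s w) (Finset.mem_univ v)
  · intro y _ hy
    obtain ⟨U, hU, hUy⟩ := mapClusterPt_iff_ultrafilter.1 hy
    rw [tendsto_pi_nhds] at hUy
    have hy1 : ∑ v, y v = 1 := by
      refine tendsto_nhds_unique (tendsto_finsetSum Finset.univ fun v _ => hUy v)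
        (tendsto_const_nhds.congr' ?_)
      filter_upwards [hU hpos] with s hs
      rw [← Finset.sum_div]
      exact (div_self hs.ne').symm
    have hAy : (Λ.pathMatR 1).mulVec y = Λ.rhoPow 1 • y := by
      funext v
      have h1 : Tendsto (fun s => (∑ j ∈ Finset.range k, Λ.levelTerm δ s 0 j v) /
          Λ.totalSum δ s + (Λ.rhoPow 1 ^ 1) ^ (-s / δ) * ∑ w, Λ.pathMatR 1 v w * u s w) U
          (𝓝 (0 + (Λ.rhoPow 1 ^ 1)⁻¹ * ∑ w, Λ.pathMatR 1 v w * y w)) :=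
        ((tendsto_levelTerm_div hirr hδ hδ1 hρ 0 k v).mono_left hU).add
          (((tendsto_pow_rpow hirr hδ 1).mono_left hU).mul
            (tendsto_finsetSum _ fun w _ => (hUy w).const_mul _))
      have h2 : y v = 0 + (Λ.rhoPow 1 ^ 1)⁻¹ * ∑ w, Λ.pathMatR 1 v w * y w := by
        refine tendsto_nhds_unique (hUy v) (h1.congr' ?_)
        have hgt : ∀ᶠ s in (U : Filter ℝ), δ < s := hU self_mem_nhdsWithin
        filter_upwards [hgt] with s hs
        have h3 := (summable_levelTerm hirr hδ hs hρ (show 0 + k = 1 * k by ring) v).2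
        rw [one_mul, levelDeg_self, levelDeg_zero, tsub_zero] at h3
        simp only [hu]
        rw [h3]
        exact (add_mul_sum_mul_div _ _ _ (Λ.pathMatR _ v) _).symm
      rw [zero_add, pow_one] at h2
      rw [Pi.smul_apply, smul_eq_mul, h2, mul_inv_cancel_left₀ (rhoPow_pos hirr 1).ne']
      rfl
    have hx := isPerronFrobenius_pfVector hirr
    obtain ⟨c, rfl⟩ := (pathMatR_one_irreducible hirr).eq_smul_of_eigen hx.1
      (hx.pathMatR_mulVec 1) hAy
    simp only [Pi.smul_apply, smul_eq_mul, ← Finset.mul_sum, hx.2.1, mul_one] at hy1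
    rw [hy1, one_smul]

/-- The recursion from level `m` to level `m * k`, where the colours start afresh, reduces the limit
to that of the vertex sums; the eigenvector equation evaluates the result. -/
theorem tendsto_pathSum_div {δ : ℝ} (hδ : 0 < δ) (hδ1 : δ < 1) (hρ : 1 < Λ.rhoPow 1) (m : ℕ)
    (v : V) :
    Tendsto (fun s => (∑' j, Λ.levelTerm δ s m j v) / Λ.totalSum δ s) (𝓝[>] δ)
      (𝓝 ((Λ.rhoPow (levelDeg k m))⁻¹ * Λ.pfVector v)) := by
  have hmk : m ≤ m * k := Nat.le_mul_of_pos_right m (NeZero.pos k)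
  have h : m + (m * k - m) = m * k := by omega
  have hlim := (tendsto_levelTerm_div hirr hδ hδ1 hρ m (m * k - m) v).add
    ((tendsto_pow_rpow hirr hδ m).mul (tendsto_finsetSum Finset.univ fun w _ =>
      (tendsto_vertexSum_div hirr hδ hδ1 hρ w).const_mul
        (Λ.pathMatR (levelDeg k (m * k) - levelDeg k m) v w)))
  have h2 : Λ.rhoPow (levelDeg k (m * k)) = Λ.rhoPow 1 ^ m := by
    have := levelDeg_mul_add k m 0
    rw [levelDeg_zero, add_zero, add_zero] at this
    rw [this, rhoPow_nsmul]
  have h3 : 0 + (Λ.rhoPow 1 ^ m)⁻¹ * ∑ w, Λ.pathMatR (levelDeg k (m * k) - levelDeg k m) v w *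
      Λ.pfVector w = (Λ.rhoPow (levelDeg k m))⁻¹ * Λ.pfVector v := by
    have h4 := congrFun ((isPerronFrobenius_pfVector hirr).pathMatR_mulVec
      (levelDeg k (m * k) - levelDeg k m)) v
    rw [← rhoPow_tsub_div hirr (levelDeg_mono k hmk), mul_assoc, h2, zero_add]
    exact congrArg _ h4
  rw [h3] at hlim
  refine hlim.congr' ?_
  filter_upwards [self_mem_nhdsWithin] with s hs
  rw [(summable_levelTerm hirr hδ hs hρ h v).2]
  exact (add_mul_sum_mul_div _ _ _ (Λ.pathMatR _ v) _).symm

end Analysis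

end KGraph

end

/-! ### The zeta function and the Dixmier measure of `Λ` -/

noncomputable section

namespace KGraph

variable {k : ℕ} {V : Type u} [SmallCategory V] {Λ : KGraph k V}

section Zeta

variable [NeZero k] [Fintype V] [DecidableEq V] [Nonempty V] [Λ.IsFinite]
  (hirr : (Λ.adjProd.map (Nat.cast : ℕ → ℝ)).IsIrreducible)

include hirr

theorem weight_rpow (δ s : ℝ) (l : Λ.bratteli.FinPath) : Λ.weight δ l ^ s =
    Λ.rhoPow (levelDeg k l.len) ^ (-s / δ) * (fun v => Λ.pfVector v ^ s) l.source := by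
  refine (congrArg (· ^ s) (weight_eq δ l)).trans ?_
  refine (Real.mul_rpow (Real.rpow_pos_of_pos (rhoPow_pos hirr _) _).le
    (pfVector_pos hirr l.source).le).trans ?_
  rw [← Real.rpow_mul (rhoPow_pos hirr _).le]
  congr 2
  ring

theorem tsum_ofReal_weight_extensions (δ s : ℝ) (γ : Λ.bratteli.FinPath) :
    ∑' l : {l : Λ.bratteli.FinPath // γ.IsSubpath l}, ENNReal.ofReal (Λ.weight δ l.1 ^ s) =
      ∑' j, ENNReal.ofReal (Λ.levelTerm δ s γ.len j γ.source) := by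
  -- The extensions of `γ` are sorted by the number of added edges.
  let e : (Σ j : ℕ, {l : Λ.bratteli.FinPath // l.len = γ.len + j ∧ γ.IsSubpath l}) ≃
      {l : Λ.bratteli.FinPath // γ.IsSubpath l} :=
    { toFun := fun p => ⟨p.2.1, p.2.2.2⟩
      invFun := fun l => ⟨l.1.len - γ.len, l.1, (Nat.add_sub_cancel' l.2.1).symm, l.2⟩
      left_inv := by
        rintro ⟨j, l, h, h'⟩
        obtain rfl : l.len - γ.len = j := by omega
        rfl
      right_inv := fun _ => rfl }
  refine (e.tsum_eq _).symm.trans ((ENNReal.tsum_sigma' _).trans (tsum_congr fun j => ?_))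
  set c : ℝ := Λ.rhoPow (levelDeg k (γ.len + j)) ^ (-s / δ) with hc
  have hc0 : 0 ≤ c := (Real.rpow_pos_of_pos (rhoPow_pos hirr _) _).le
  have hg : ∀ v, 0 ≤ (c • fun v => Λ.pfVector v ^ s) v := fun v =>
    mul_nonneg hc0 (Real.rpow_pos_of_pos (pfVector_pos hirr v) _).le
  refine Eq.trans (tsum_congr fun l => ?_)
    ((tsum_extensions_ofReal hirr γ (Nat.le_add_right γ.len j) hg).trans ?_)
  · refine congrArg ENNReal.ofReal ((weight_rpow hirr δ s l.1).trans ?_)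
    rw [l.2.1]
    rfl
  · rw [Matrix.mulVec_smul]
    rfl

theorem tsum_ofReal_weight (δ s : ℝ) :
    ∑' l : Λ.bratteli.FinPath, ENNReal.ofReal (Λ.weight δ l ^ s) =
      ∑ v, ∑' j, ENNReal.ofReal (Λ.levelTerm δ s 0 j v) := by
  have hnil : ∀ (v : V) (l : Λ.bratteli.FinPath),
      (BratteliDiagram.nil (B := Λ.bratteli) v).IsSubpath l ↔ v = l.range := fun v l =>
    ⟨fun h => h.2.1, fun h => ⟨Nat.zero_le _, h, fun i => i.elim0⟩⟩
  let e : (Σ v : V, {l : Λ.bratteli.FinPath //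
      (BratteliDiagram.nil (B := Λ.bratteli) v).IsSubpath l}) ≃ Λ.bratteli.FinPath :=
    { toFun := fun p => p.2.1
      invFun := fun l => ⟨l.range, l, (hnil _ l).2 rfl⟩
      left_inv := by
        rintro ⟨v, l, h⟩
        obtain rfl := (hnil v l).1 h
        rfl
      right_inv := fun _ => rfl }
  refine (e.tsum_eq _).symm.trans ((ENNReal.tsum_sigma' _).trans ((tsum_fintype _).trans ?_))
  exact Finset.sum_congr rfl fun v _ => tsum_ofReal_weight_extensions hirr δ s _

/-- For `s ≤ δ < 1` every level contributes at least `x v`, so the sum over the levels diverges; for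
`s > δ` the geometric bound applies. -/
theorem tsum_ofReal_weight_lt_top_iff {δ s : ℝ} (hδ : 0 < δ) (hδ1 : δ < 1)
    (hρ : 1 < Λ.rhoPow 1) :
    ∑' l : Λ.bratteli.FinPath, ENNReal.ofReal (Λ.weight δ l ^ s) < ∞ ↔ δ < s := by
  rw [tsum_ofReal_weight hirr, ENNReal.sum_lt_top]
  constructor
  · intro h
    by_contra! hs
    obtain ⟨v⟩ := ‹Nonempty V›
    have hx := pfVector_pos hirr v
    refine (h v (Finset.mem_univ v)).ne (top_unique ?_)
    calc (∞ : ℝ≥0∞) = ∑' _ : ℕ, ENNReal.ofReal (Λ.pfVector v) :=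
          (ENNReal.tsum_const_eq_top_of_ne_zero (ENNReal.ofReal_pos.2 hx).ne').symm
      _ ≤ _ := ENNReal.tsum_le_tsum fun j => ENNReal.ofReal_le_ofReal <|
          (le_mul_of_one_le_left hx.le (Real.one_le_rpow (one_le_rhoPow hirr _) ?_)).trans
            (levelTerm_zero_ge hirr (hs.trans hδ1.le) j v)
    rw [sub_nonneg]
    exact (div_le_one hδ).2 hs
  · intro hs v _
    rw [← ENNReal.ofReal_tsum_of_nonneg (fun j => levelTerm_nonneg hirr _ _ _ _ _)
      (summable_levelTerm_zero hirr hδ hs hρ v)]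
    exact ENNReal.ofReal_lt_top

theorem summable_weight_rpow {δ s : ℝ} (hδ : 0 < δ) (hδ1 : δ < 1) (hρ : 1 < Λ.rhoPow 1)
    (hs : δ < s) : Summable fun l : Λ.bratteli.FinPath => Λ.weight δ l ^ s :=
  (ENNReal.summable_toReal ((tsum_ofReal_weight_lt_top_iff hirr hδ hδ1 hρ).2 hs).ne).congr
    fun l => ENNReal.toReal_ofReal (Real.rpow_pos_of_pos (weight_pos hirr δ l) s).le

/-- No convergence is needed: a divergent real sum of nonnegative terms and the real value of `∞`
are both `0`. -/
theorem tsum_weight_extensions (δ s : ℝ) (γ : Λ.bratteli.FinPath) :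
    ∑' l : {l : Λ.bratteli.FinPath // γ.IsSubpath l}, Λ.weight δ l.1 ^ s =
      ∑' j, Λ.levelTerm δ s γ.len j γ.source := by
  have h := congrArg ENNReal.toReal (tsum_ofReal_weight_extensions hirr δ s γ)
  rw [ENNReal.tsum_toReal_eq fun _ => ENNReal.ofReal_ne_top,
    ENNReal.tsum_toReal_eq fun _ => ENNReal.ofReal_ne_top] at h
  refine Eq.trans (tsum_congr fun l => ?_) (h.trans (tsum_congr fun j => ?_))
  · exact (ENNReal.toReal_ofReal (Real.rpow_pos_of_pos (weight_pos hirr δ l.1) s).le).symm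
  · exact ENNReal.toReal_ofReal (levelTerm_nonneg hirr δ s _ j γ.source)

theorem tsum_weight {δ s : ℝ} (hδ : 0 < δ) (hρ : 1 < Λ.rhoPow 1) (hs : δ < s) :
    ∑' l : Λ.bratteli.FinPath, Λ.weight δ l ^ s = Λ.totalSum δ s := by
  have h0 : ∀ v, 0 ≤ ∑' j, Λ.levelTerm δ s 0 j v := fun v =>
    tsum_nonneg fun j => levelTerm_nonneg hirr _ _ _ _ _
  have h := congrArg ENNReal.toReal (tsum_ofReal_weight hirr δ s)
  simp only [← ENNReal.ofReal_tsum_of_nonneg (fun j => levelTerm_nonneg hirr _ _ _ _ _)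
      (summable_levelTerm_zero hirr hδ hs hρ _)] at h
  rw [ENNReal.tsum_toReal_eq fun _ => ENNReal.ofReal_ne_top,
    ← ENNReal.ofReal_sum_of_nonneg fun v _ => h0 v,
    ENNReal.toReal_ofReal (Finset.sum_nonneg fun v _ => h0 v)] at h
  refine Eq.trans (tsum_congr fun l => ?_) h
  exact (ENNReal.toReal_ofReal (Real.rpow_pos_of_pos (weight_pos hirr δ l) s).le).symm

theorem tendsto_tsum_weight {δ : ℝ} (hδ : 0 < δ) (hδ1 : δ < 1) (hρ : 1 < Λ.rhoPow 1) :
    Tendsto (fun s => ∑' l : Λ.bratteli.FinPath, Λ.weight δ l ^ s) (𝓝[>] δ) atTop := by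
  refine (tendsto_totalSum hirr hδ hδ1 hρ).congr' ?_
  filter_upwards [self_mem_nhdsWithin] with s hs
  exact (tsum_weight hirr hδ hρ hs).symm

theorem tendsto_tsum_weight_extensions_div {δ : ℝ} (hδ : 0 < δ) (hδ1 : δ < 1)
    (hρ : 1 < Λ.rhoPow 1) (γ : Λ.bratteli.FinPath) :
    Tendsto (fun s => (∑' l : {l : Λ.bratteli.FinPath // γ.IsSubpath l}, Λ.weight δ l.1 ^ s) /
        ∑' l : Λ.bratteli.FinPath, Λ.weight δ l ^ s) (𝓝[>] δ)
      (𝓝 ((Λ.rhoPow (levelDeg k γ.len))⁻¹ * Λ.pfVector γ.source)) := by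
  refine (tendsto_pathSum_div hirr hδ hδ1 hρ γ.len γ.source).congr' ?_
  filter_upwards [self_mem_nhdsWithin] with s hs
  exact congrArg₂ (· / ·) (tsum_weight_extensions hirr δ s γ).symm
    (tsum_weight hirr hδ hρ hs).symm

variable {δ : ℝ} (hδ : 0 < δ) (hδ1 : δ < 1) (hw : Λ.WeightEqDiam δ)

include hδ hw

theorem opZeta_dirac_weight {s : ℝ} (hs : 0 < s) :
    opZeta (BratteliDiagram.dirac (Λ.weight δ)) s =
      ∑' l : Λ.bratteli.FinPath, ENNReal.ofReal (Λ.weight δ l ^ s) := by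
  rw [BratteliDiagram.opZeta_dirac (fun l => hw l ▸ weight_pos hirr δ l)
    ⟨1, fun l => hw l ▸ weight_le_one hirr hδ l⟩ hs]
  exact tsum_congr fun l => by rw [← hw l]

include hδ1

theorem opZeta_dirac_lt_top_iff {s : ℝ} (hs : 0 < s) :
    opZeta (BratteliDiagram.dirac (Λ.weight δ)) s < ∞ ↔ δ < s := by
  rw [opZeta_dirac_weight hirr hδ hw hs]
  exact tsum_ofReal_weight_lt_top_iff hirr hδ hδ1 (one_lt_rhoPow_one hirr hw)

theorem abscissa_dirac : abscissa (BratteliDiagram.dirac (Λ.weight δ)) = δ := by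
  have h : {s : ℝ | 0 < s ∧ opZeta (BratteliDiagram.dirac (Λ.weight δ)) s < ∞} = Set.Ioi δ := by
    ext s
    constructor
    · rintro ⟨h0, h1⟩
      exact (opZeta_dirac_lt_top_iff hirr hδ hδ1 hw h0).1 h1
    · intro h1
      have h0 : 0 < s := hδ.trans h1
      exact ⟨h0, (opZeta_dirac_lt_top_iff hirr hδ hδ1 hw h0).2 h1⟩
  rw [abscissa, h, csInf_Ioi]

theorem isDixmierMeasure (τ : BratteliDiagram.ChoiceFunction (Λ.weight δ))
    {μ : Measure Λ.bratteli.InfPath} [IsProbabilityMeasure μ]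
    (hμ : ∀ l, μ (BratteliDiagram.cylinder l) =
      ENNReal.ofReal ((Λ.rhoPow (levelDeg k l.len))⁻¹ * Λ.pfVector l.source)) :
    BratteliDiagram.IsDixmierMeasure τ μ := by
  have hρ := one_lt_rhoPow_one hirr hw
  refine BratteliDiagram.isDixmierMeasure_of_tendsto (weight_pos hirr δ)
    (weightVanishes hirr hδ hρ) ⟨1, weight_le_one hirr hδ⟩ hw hδ
    (abscissa_dirac hirr hδ hδ1 hw) (fun s hs => summable_weight_rpow hirr hδ hδ1 hρ hs)
    (tendsto_tsum_weight hirr hδ hδ1 hρ) (fun γ => ?_) τ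
  rw [measureReal_def, hμ, ENNReal.toReal_ofReal (mul_pos (inv_pos.2 (rhoPow_pos hirr _))
    (pfVector_pos hirr γ.source)).le]
  exact tendsto_tsum_weight_extensions_div hirr hδ hδ1 hρ γ

theorem dixmierMeasure_eq (τ : BratteliDiagram.ChoiceFunction (Λ.weight δ))
    {μ : Measure Λ.bratteli.InfPath} [IsProbabilityMeasure μ]
    (hμ : ∀ l, μ (BratteliDiagram.cylinder l) =
      ENNReal.ofReal ((Λ.rhoPow (levelDeg k l.len))⁻¹ * Λ.pfVector l.source)) :
    BratteliDiagram.dixmierMeasure τ = μ :=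
  BratteliDiagram.dixmierMeasure_eq (weight_pos hirr δ) (isDixmierMeasure hirr hδ hδ1 hw τ hμ)

end Zeta

end KGraph

end

/-! ### Conclusion: the Dixmier measure is `M` -/

theorem mainTheorem3 {k : ℕ} [NeZero k] {V : Type u} [SmallCategory V] [Fintype V] [DecidableEq V]
    [Nonempty V] (Λ : KGraph k V) [Λ.IsFinite] (hconn : Λ.StronglyConnected)
    (hirr : (Λ.adjProd.map (Nat.cast : ℕ → ℝ)).IsIrreducible)
    (δ : ℝ) (hδ0 : 0 < δ) (hδ1 : δ < 1) (hw : Λ.WeightEqDiam δ) :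
    -- the Perron-Frobenius eigenvector and the measure `M` are well defined,
    -- and the two path spaces are canonically homeomorphic
    (Λ.IsPerronFrobenius Λ.pfVector ∧ ∀ x, Λ.IsPerronFrobenius x → x = Λ.pfVector) ∧
    (Λ.IsAHLRS Λ.aHLRS ∧ ∀ M, Λ.IsAHLRS M → M = Λ.aHLRS) ∧
    IsHomeomorph (KGraph.toBratteli (Λ := Λ)) ∧
    -- choice functions exist, and for each of them:
    Nonempty (BratteliDiagram.ChoiceFunction (Λ.weight δ)) ∧
    ∀ τ : BratteliDiagram.ChoiceFunction (Λ.weight δ),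
      -- the zeta function has abscissa of convergence `δ`
      (∀ s : ℝ, 0 < s → (opZeta (BratteliDiagram.dirac (Λ.weight δ)) s < ∞ ↔ δ < s)) ∧
      abscissa (BratteliDiagram.dirac (Λ.weight δ)) = δ ∧
      -- the Dixmier trace induces a unique finite measure `μ_δ`
      BratteliDiagram.IsDixmierMeasure τ (BratteliDiagram.dixmierMeasure τ) ∧
      (∀ μ, BratteliDiagram.IsDixmierMeasure τ μ → μ = BratteliDiagram.dixmierMeasure τ) ∧
      -- the values of `μ_δ` on cylinder sets as limits
      (∀ γ : Λ.bratteli.FinPath,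
        Tendsto (fun s : ℝ =>
            (∑' l : {l : Λ.bratteli.FinPath // γ.IsSubpath l}, Λ.weight δ l.1 ^ s) /
              ∑' l : Λ.bratteli.FinPath, Λ.weight δ l ^ s)
          (𝓝[>] δ) (𝓝 ((BratteliDiagram.dixmierMeasure τ).real (BratteliDiagram.cylinder γ)))) ∧
      -- `μ_δ` is a probability measure with the stated values on cylinder sets
      IsProbabilityMeasure (BratteliDiagram.dixmierMeasure τ) ∧
      (∀ (l : Λ.bratteli.FinPath) (q t : ℕ), t < k → l.len = q * k + t →
        BratteliDiagram.dixmierMeasure τ (BratteliDiagram.cylinder l) =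
          ENNReal.ofReal (((∏ i : Fin k with i.val < t, Λ.rho i) ^ (q + 1))⁻¹ *
            ((∏ i : Fin k with t ≤ i.val, Λ.rho i) ^ q)⁻¹ * Λ.pfVector l.source)) ∧
      -- `μ_δ` is the measure `M`, and it depends neither on `δ` nor on `τ`
      Λ.aHLRS.map KGraph.toBratteli = BratteliDiagram.dixmierMeasure τ ∧
      ∀ δ' : ℝ, 0 < δ' → δ' < 1 → Λ.WeightEqDiam δ' →
        ∀ τ' : BratteliDiagram.ChoiceFunction (Λ.weight δ'),
          BratteliDiagram.dixmierMeasure τ' = BratteliDiagram.dixmierMeasure τ := by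
  have hpf := KGraph.isPerronFrobenius_pfVector hirr
  -- This `μ` depends only on `x` and the `ρ_i`. Every Dixmier measure, for any admissible `δ` and
  -- `τ`, equals it, which gives the independence.
  obtain ⟨μ, hμ1, hμ⟩ := KGraph.exists_bratteli_measure hirr
  have hM := KGraph.isAHLRS_aHLRS hirr
  have hwpos := KGraph.weight_pos hirr δ
  have hρ := KGraph.one_lt_rhoPow_one hirr hw
  refine ⟨⟨hpf, fun x hx => KGraph.IsPerronFrobenius.unique hirr hx hpf⟩,
    ⟨hM, fun M h => KGraph.IsAHLRS.unique hirr h hM⟩, KGraph.isHomeomorph_toBratteli,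
    BratteliDiagram.exists_choiceFunction (KGraph.noDeadEnds_bratteli hirr) hwpos
      (KGraph.weightVanishes hirr hδ0 hρ) hw, fun τ => ?_⟩
  have hτ := KGraph.dixmierMeasure_eq hirr hδ0 hδ1 hw τ hμ
  have hD := KGraph.isDixmierMeasure hirr hδ0 hδ1 hw τ hμ
  rw [hτ]
  refine ⟨fun s hs => KGraph.opZeta_dirac_lt_top_iff hirr hδ0 hδ1 hw hs,
    KGraph.abscissa_dirac hirr hδ0 hδ1 hw, hD, fun ν hν => hν.unique hwpos hD, fun γ => ?_, hμ1,
    fun l q t ht hl => ?_, hM.map_toBratteli_eq hirr hμ,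
    fun δ' hδ0' hδ1' hw' τ' => KGraph.dixmierMeasure_eq hirr hδ0' hδ1' hw' τ' hμ⟩
  · rw [measureReal_def, hμ, ENNReal.toReal_ofReal (mul_pos (inv_pos.2 (KGraph.rhoPow_pos hirr _))
      (KGraph.pfVector_pos hirr γ.source)).le]
    exact KGraph.tendsto_tsum_weight_extensions_div hirr hδ0 hδ1 hρ γ
  · rw [hμ, hl, KGraph.rhoPow_levelDeg Λ q t ht, KGraph.rhoProd, mul_inv]
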